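/- Let $n\ge 2$ and let $a_0,\dots,a_{n-1}$ be positive integers; put $k=a_0+\dots+a_{n-1}$, $b_i=a_1+\dots+a_i$ for $1\le i\le n-1$ and $b_i=k$ for $i\ge n$. For a real sequence $x=(x_i)_{i\ge1}$ with finite support let $\psi_i(x)=x_1+\dots+x_i$ if $i<n$ and $\psi_i(x)=x_{i-n+1}+\dots+x_i$ if $i\ge n$. Let $\Pi$ be the set of finitely supported real sequences $x$ with $x_i\ge0$ and $\psi_i(x)\le b_i$ for all $i\ge1$. Its facets are $\Gamma_i=\Pi\cap\{\psi_i(x)=b_i\}$ and $\Delta_i=\Pi\cap\{x_i=0\}$, $i\geq 1$. A vertex is a point of $\Pi$ for which the set of facets containing it is maximal. An edge is a subset of $\Pi$ with more than one point for which the set of facets containing it is maximal among such subsets, and which is the whole intersection of these facets. If $e$ is an edge containing a vertex $u$, its direction vector at $u$ is the minimal nonzero integral vector $\varepsilon$ with $u+\varepsilon\in e$. For a vertex $u$ let $C_u$ be the cone with apex $u$ generated by the direction vectors of all edges containing $u$, let $C_u^m=C_u\cap\{x_i=0 \text{ for } i>m\}$, and let $l_u$ be the largest $l$ with $u\in\Gamma_l$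 ($l_u=0$ if there is none). For an integral sequence $x$ let $\exp x=\prod_i t_i^{x_i}$, and let $\exp^*x$ be the monomial in $z_1,\dots,z_{n-1},q$ obtained from it by the substitution $t_{j(n-1)+r}=z_rq^j$ ($j\ge0$, $1\le r\le n-1$). For a finite-dimensional rational cone $C$ let $\sigma(C)$ be the rational function $\theta S(C)/\theta$, where $S(C)=\sum_{x\in C\text{ integral}}\exp x$ and $\theta\neq 0$ is any Laurent polynomial such that $\theta S(C)$ is a Laurent polynomial; let $\sigma^*(C)$ be the result of the above substitution in $\sigma(C)$, when it is applicable. Let $S^*(\Pi)=\sum_{x\in\Pi\text{ integral}}\exp^*x$. Identify monomials in $z_1,\dots,z_{n-1},q$ with exponents of weights of $\widehat{\mathfrak{sl}_n}$ by $z_r=\exp(\alpha_1+\dots+\alpha_r)$, $q=\exp(-\delta)$, where $\alpha_0,\dots,\alpha_{n-1}$ are the simple roots and $\delta=\alpha_0+\dots+\alpha_{n-1}$; weights are ordered by $\mu\le\nu$ iff $\nu-\mu$ is a sum of simple roots. Let $R$ be the ring of formal Laurent series in $z_1,\dots,z_{n-1},q$ over $\mathbb C$ whose support is contained in a finite union of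 sets $\{\mu:\mu\le\nu\}$. Let $T$ be the ring of rational functions $N/D$ with $N$ a Laurent polynomial and $D$ a product of factors $1-\exp\alpha$, $\alpha$ a (real or imaginary) root of $\widehat{\mathfrak{sl}_n}$; these factors are invertible in $R$, which gives an embedding $T\to R$. Then the following hold. 1. The series $S^*(\Pi)$ is well defined (every coefficient is a finite sum) and belongs to $R$. 2. For every vertex $u$ of $\Pi$ and every $m\ge l_u$ the function $\sigma^*(C_u^m)$ is defined and belongs to $T$. Let $\tau_u^m\in R$ be its image. As $m\to\infty$, each coefficient of $\tau_u^m$ stabilizes, and the limit series $\tau_u$ belongs to $R$. 3. In $R$ one has $$S^*(\Pi)=\sum_{u\text{ vertex of }\Pi}\tau_u ,$$ where for each monomial only finitely many $\tau_u$ have a nonzero coefficient, and the identity holds coefficientwise. -/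

import Mathlib

noncomputable section

namespace InfBrion

/-! ### Weights and characters

`n` is the rank parameter of the affine Lie algebra of type `A_{n-1}^{(1)}`.  The pair `(c, d)` stands
for the Laurent monomial `z_1^{c_0} ... z_{n-1}^{c_{n-2}} q^d`, that is, for the weight
`∑ c_{r-1} γ_r - d δ`, where `exp γ_r = z_r` and `exp (-δ) = q`. -/

/-- Exponents of Laurent monomials in `z_1, ..., z_{n-1}, q`, viewed as weights. -/
def Weight (n : ℕ) : Type := (Fin (n - 1) → ℤ) × ℤ

instance (n : ℕ) : AddCommGroup (Weight n) := inferInstanceAs (AddCommGroup ((Fin (n - 1) → ℤ) × ℤ))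

instance (n : ℕ) : TwoUniqueSums (Weight n) :=
  inferInstanceAs (TwoUniqueSums ((Fin (n - 1) → ℤ) × ℤ))

/-- The weight `γ_i = α_1 + ... + α_i` for `0 ≤ i ≤ n - 1` (so `γ_0 = 0`). -/
def gam (n i : ℕ) : Weight n := (fun r => if (r : ℕ) + 1 = i then 1 else 0, 0)

/-- The imaginary root `δ`, with `exp (-δ) = q`. -/
def delta (n : ℕ) : Weight n := (0, -1)

/-- The simple roots `α_0 = δ - (α_1 + ... + α_{n-1})` and `α_j = γ_j - γ_{j-1}`, `1 ≤ j ≤ n - 1`. -/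
def simpleRoot (n : ℕ) (j : Fin n) : Weight n :=
  if (j : ℕ) = 0 then delta n - gam n (n - 1) else gam n j - gam n (j - 1)

/-- The roots of the affine Lie algebra: `β + m δ` with `β` a root of `sl_n` (that is, `γ_i - γ_j` with
`0 ≤ i ≠ j ≤ n - 1`), and the imaginary roots `m δ` with `m ≠ 0`. -/
def IsRoot (n : ℕ) (α : Weight n) : Prop :=
  (∃ (i j : ℕ) (m : ℤ), i < n ∧ j < n ∧ i ≠ j ∧ α = gam n i - gam n j + m • delta n) ∨
    ∃ m : ℤ, m ≠ 0 ∧ α = m • delta n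

/-- The height functional: it is `1` on each simple root. -/
def height (n : ℕ) : Weight n →+ ℤ where
  toFun w := ∑ r : Fin (n - 1), (((r : ℕ) : ℤ) + 1) * w.1 r - n * w.2
  map_zero' := by
    change ∑ r : Fin (n - 1), (((r : ℕ) : ℤ) + 1) * (0 : ℤ) - n * (0 : ℤ) = 0
    simp
  map_add' x y := by
    change ∑ r : Fin (n - 1), (((r : ℕ) : ℤ) + 1) * (x.1 r + y.1 r) - n * (x.2 + y.2) = _
    simp only [mul_add, Finset.sum_add_distrib]
    ring

lemma height_gam (n i : ℕ) (hi : i < n) : height n (gam n i) = i := by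
  change ∑ r : Fin (n - 1), (((r : ℕ) : ℤ) + 1) * (if (r : ℕ) + 1 = i then 1 else 0) - n * (0 : ℤ) = i
  rcases i with _ | i
  · simp
  · rw [Finset.sum_eq_single (⟨i, by omega⟩ : Fin (n - 1))]
    · simp
    · intro b _ hb
      have : (b : ℕ) ≠ i := fun h => hb (Fin.ext h)
      simp [this]
    · simp

lemma height_delta (n : ℕ) : height n (delta n) = n := by
  change ∑ r : Fin (n - 1), (((r : ℕ) : ℤ) + 1) * (0 : ℤ) - n * (-1 : ℤ) = n
  simp

lemma height_simpleRoot (n : ℕ) (j : Fin n) : height n (simpleRoot n j) = 1 := by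
  have hj := j.2
  unfold simpleRoot
  split_ifs with h
  · rw [map_sub, height_delta, height_gam _ _ (by omega)]; omega
  · rw [map_sub, height_gam _ _ hj, height_gam _ _ (by omega)]; omega

/-- The poset of weights: `μ ≤ ν` iff `ν - μ` is a sum of simple roots. -/
instance (n : ℕ) : PartialOrder (Weight n) where
  le μ ν := ∃ c : Fin n → ℕ, ν - μ = ∑ j, c j • simpleRoot n j
  le_refl μ := ⟨0, by simp⟩
  le_trans μ ν ρ := by
    rintro ⟨c, hc⟩ ⟨d, hd⟩
    refine ⟨c + d, ?_⟩
    simp only [Pi.add_apply, add_smul, Finset.sum_add_distrib, ← hc, ← hd]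
    abel
  le_antisymm μ ν := by
    rintro ⟨c, hc⟩ ⟨d, hd⟩
    have h1 := congrArg (height n) hc
    have h2 := congrArg (height n) hd
    simp only [map_sub, map_sum, map_nsmul, height_simpleRoot, nsmul_eq_mul, mul_one]
      at h1 h2
    have hc0 : (0 : ℤ) ≤ ∑ j, (c j : ℤ) := Finset.sum_nonneg fun _ _ => by positivity
    have hd0 : (0 : ℤ) ≤ ∑ j, (d j : ℤ) := Finset.sum_nonneg fun _ _ => by positivity
    have hz : ∑ j, (c j : ℤ) = 0 := by linarith
    have hz' : ∀ j, c j = 0 := fun j => by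
      have := (Finset.sum_eq_zero_iff_of_nonneg (fun j _ => by positivity)).1 hz j (Finset.mem_univ j)
      exact_mod_cast this
    simp only [hz', zero_smul, Finset.sum_const_zero] at hc
    exact (sub_eq_zero.1 hc).symm

lemma Weight.le_def {n : ℕ} {μ ν : Weight n} :
    μ ≤ ν ↔ ∃ c : Fin n → ℕ, ν - μ = ∑ j, c j • simpleRoot n j := Iff.rfl

instance (n : ℕ) : IsOrderedAddMonoid (Weight n) where
  add_le_add_left μ ν h ρ := by
    obtain ⟨c, hc⟩ := h
    exact ⟨c, by rw [← hc]; abel⟩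

instance (n : ℕ) : IsOrderedCancelAddMonoid (Weight n) := IsOrderedAddMonoid.toIsOrderedCancelAddMonoid

/-- The ring `R` of characters: formal sums `∑ c_w exp w` whose support is contained in a union of
finitely many lower sets `{w | w ≤ ν}` of the poset of weights, with the convolution product. The
ambient Hahn series ring, over the reversed order, only supplies the product: every function with such
a support is a Hahn series. -/
def CharRing (n : ℕ) : Subalgebra ℂ (HahnSeries (Weight n)ᵒᵈ ℂ) where
  carrier := {f | ∃ s : Finset (Weight n),
    ∀ w : Weight n, f.coeff (OrderDual.toDual w) ≠ 0 → ∃ ν ∈ s, w ≤ ν}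
  mul_mem' := by
    classical
    rintro f g ⟨s, hs⟩ ⟨t, ht⟩
    refine ⟨Finset.image₂ (· + ·) s t, fun w hw => ?_⟩
    obtain ⟨x, hx, y, hy, hxy⟩ := HahnSeries.support_mul_subset (x := f) (y := g) hw
    obtain ⟨μ, hμ, hμ'⟩ := hs (OrderDual.ofDual x) hx
    obtain ⟨ν, hν, hν'⟩ := ht (OrderDual.ofDual y) hy
    refine ⟨μ + ν, Finset.mem_image₂_of_mem hμ hν, ?_⟩
    have : w = OrderDual.ofDual x + OrderDual.ofDual y := (congrArg OrderDual.ofDual hxy).symm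
    rw [this]
    exact add_le_add hμ' hν'
  add_mem' := by
    classical
    rintro f g ⟨s, hs⟩ ⟨t, ht⟩
    refine ⟨s ∪ t, fun w hw => ?_⟩
    by_cases hf : f.coeff (OrderDual.toDual w) = 0
    · have hg : g.coeff (OrderDual.toDual w) ≠ 0 := fun hg => hw (by simp [hf, hg])
      obtain ⟨ν, hν, h⟩ := ht w hg
      exact ⟨ν, Finset.mem_union_right _ hν, h⟩
    · obtain ⟨ν, hν, h⟩ := hs w hf
      exact ⟨ν, Finset.mem_union_left _ hν, h⟩
  algebraMap_mem' r := by
    refine ⟨{0}, fun w hw => ⟨0, by simp, ?_⟩⟩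
    by_contra h
    apply hw
    rw [HahnSeries.algebraMap_apply]
    apply HahnSeries.coeff_single_of_ne
    rintro h'
    exact h (le_of_eq (congrArg OrderDual.ofDual h'))

/-- The coefficient of `exp w` in a character. -/
def charCoeff {n : ℕ} (f : CharRing n) (w : Weight n) : ℂ := f.1.coeff (OrderDual.toDual w)

/-- The monomial `exp w`, as a character. -/
def charMonomial (n : ℕ) : Multiplicative (Weight n) →* CharRing n where
  toFun w := ⟨HahnSeries.single (OrderDual.toDual w.toAdd) 1, {w.toAdd}, fun v hv => by
    refine ⟨w.toAdd, by simp, ?_⟩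
    by_contra h
    apply hv
    apply HahnSeries.coeff_single_of_ne
    rintro h'
    exact h (le_of_eq (congrArg OrderDual.ofDual h'))⟩
  map_one' := rfl
  map_mul' v w := by
    apply Subtype.ext
    change HahnSeries.single (OrderDual.toDual v.toAdd + OrderDual.toDual w.toAdd) (1 : ℂ) =
      HahnSeries.single (OrderDual.toDual v.toAdd) 1 * HahnSeries.single (OrderDual.toDual w.toAdd) 1
    rw [HahnSeries.single_mul_single, one_mul]

/-- Laurent polynomials in `z_1, ..., z_{n-1}, q`. -/
abbrev LaurentZ (n : ℕ) : Type := AddMonoidAlgebra ℂ (Weight n)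

/-- Laurent polynomials as characters. -/
def toChar (n : ℕ) : LaurentZ n →ₐ[ℂ] CharRing n :=
  AddMonoidAlgebra.lift ℂ (CharRing n) (Weight n) (charMonomial n)

/-- The admissible denominators: products of factors `1 - exp α` with `α` a root. -/
def rootDenominators (n : ℕ) : Submonoid (LaurentZ n) :=
  Submonoid.closure {D | ∃ α, IsRoot n α ∧ D = 1 - AddMonoidAlgebra.single α 1}

/-- The rational function `f` in `z_1, ..., z_{n-1}, q` lies in the ring `T` of quotients `N / D` of
Laurent polynomials with `D` a product of factors `1 - exp α`, `α` a root, and `g` is its image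
`N D⁻¹` under the embedding of `T` into `R` (the denominators being invertible in `R`). -/
def IsCharOf {n : ℕ} (f : FractionRing (LaurentZ n)) (g : CharRing n) : Prop :=
  ∃ N D : LaurentZ n, D ∈ rootDenominators n ∧ D ≠ 0 ∧ IsUnit (toChar n D) ∧
    f = algebraMap _ _ N / algebraMap _ _ D ∧ g * toChar n D = toChar n N

/-- The image in `R` of a rational function does not depend on the chosen quotient. -/
lemma IsCharOf.unique {n : ℕ} {f : FractionRing (LaurentZ n)} {g g' : CharRing n}
    (h : IsCharOf f g) (h' : IsCharOf f g') : g = g' := by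
  obtain ⟨N, D, -, hD, hu, hf, hg⟩ := h
  obtain ⟨N', D', -, hD', hu', hf', hg'⟩ := h'
  have inj := IsFractionRing.injective (LaurentZ n) (FractionRing (LaurentZ n))
  have hz : ∀ x : LaurentZ n, x ≠ 0 → algebraMap (LaurentZ n) (FractionRing (LaurentZ n)) x ≠ 0 :=
    fun x hx h0 => hx (inj (by rw [h0, map_zero]))
  have e : N * D' = N' * D := by
    apply inj
    rw [hf, div_eq_div_iff (hz D hD) (hz D' hD')] at hf'
    simpa using hf'
  have e' := congrArg (toChar n) e
  rw [map_mul, map_mul, ← hg, ← hg'] at e'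
  apply (hu.mul hu').mul_right_cancel
  linear_combination e'

/-! ### Rational cones, generating functions and the specialised functions `σ^*`

The countable dimensional space of finitely supported real sequences is `ℕ →₀ ℝ`.  All sequences are
indexed from `0`: the value at `i : ℕ` is the `(i+1)`-st term, and the variables `t_1, t_2, ...` are
likewise indexed by `ℕ`. -/

/-- An integral sequence as a point of the real space. -/
def toReal (x : ℕ →₀ ℤ) : ℕ →₀ ℝ := x.mapRange (fun c : ℤ => (c : ℝ)) Int.cast_zero

/-- Laurent polynomials in the variables `t_1, t_2, ...`. -/
abbrev LaurentT : Type := AddMonoidAlgebra ℂ (ℕ →₀ ℤ)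

/-- The coefficients of the series `S(C)`, the sum of the monomials `exp x` over integral `x ∈ C`. -/
def genSeries (C : Set (ℕ →₀ ℝ)) (x : ℕ →₀ ℤ) : ℂ := C.indicator 1 (toReal x)

/-- The product `θ F` of a Laurent polynomial and a formal Laurent series. -/
def mulSeries (θ : LaurentT) (F : (ℕ →₀ ℤ) → ℂ) (x : ℕ →₀ ℤ) : ℂ :=
  θ.coeff.sum fun y c => c * F (x - y)

/-- `f` is the rational function `σ(C) = θ S(C) / θ`, where `θ` is any nonzero Laurent polynomial such
that `θ S(C)` is a Laurent polynomial. -/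
def IsSigma (C : Set (ℕ →₀ ℝ)) (f : FractionRing LaurentT) : Prop :=
  ∃ θ P : LaurentT, θ ≠ 0 ∧ (∀ x, mulSeries θ (genSeries C) x = P.coeff x) ∧
    f = algebraMap _ _ P / algebraMap _ _ θ

/-- The exponent of the monomial `z_r q^j` substituted for `t_{j(n-1)+r}`; with the indexing from `0`,
the variable number `i` has `j = i / (n-1)` and `r - 1 = i % (n-1)`. -/
def varWeight (n i : ℕ) : Weight n :=
  (fun r => if (r : ℕ) = i % (n - 1) then 1 else 0, ((i / (n - 1) : ℕ) : ℤ))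

/-- The exponent of the monomial `exp^* x`. -/
def starWeight (n : ℕ) : (ℕ →₀ ℤ) →+ Weight n :=
  Finsupp.liftAddHom fun i => zmultiplesHom (Weight n) (varWeight n i)

/-- The substitution on Laurent polynomials. -/
def starPoly (n : ℕ) : LaurentT →+* LaurentZ n :=
  AddMonoidAlgebra.mapDomainRingHom ℂ (starWeight n)

/-- The substitution is applicable to the rational function `f` in the `t_i`, and `g` is the result. -/
def IsSubstitution (n : ℕ) (f : FractionRing LaurentT) (g : FractionRing (LaurentZ n)) : Prop :=
  ∃ P θ : LaurentT, starPoly n θ ≠ 0 ∧ f = algebraMap _ _ P / algebraMap _ _ θ ∧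
    g = algebraMap _ _ (starPoly n P) / algebraMap _ _ (starPoly n θ)

/-- `g = σ^*(C)`. -/
def IsSigmaStar (n : ℕ) (C : Set (ℕ →₀ ℝ)) (g : FractionRing (LaurentZ n)) : Prop :=
  ∃ f, IsSigma C f ∧ IsSubstitution n f g

/-- `g = S^*(A)`, the sum of the monomials `exp^* x` over the integral points `x` of `A`; this includes
that the sum is well defined. -/
def IsGenFun {n : ℕ} (A : Set (ℕ →₀ ℝ)) (g : CharRing n) : Prop :=
  ∀ w : Weight n, {x : ℕ →₀ ℤ | toReal x ∈ A ∧ starWeight n x = w}.Finite ∧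
    charCoeff g w = ({x : ℕ →₀ ℤ | toReal x ∈ A ∧ starWeight n x = w}.ncard : ℂ)

/-! ### The polytope `Π` -/

/-- `ψ_i(x)`, the sum of the last `n` terms `x_{i-n+1} + ... + x_i`, or `x_1 + ... + x_i` if `i < n`
(at the index `i : ℕ`, that is, for the `(i+1)`-st functional). -/
def psi (n i : ℕ) (x : ℕ →₀ ℝ) : ℝ := ∑ j ∈ Finset.Icc (i + 1 - n) i, x j

/-- The bounds: the `(i+1)`-st one is `a_1 + ... + a_{i+1}` if `i + 1 ≤ n - 1`, and the level
`k = a_0 + ... + a_{n-1}` otherwise. -/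
def bound {n : ℕ} (a : Fin n → ℕ) (i : ℕ) : ℕ :=
  if i + 1 < n then ∑ j ∈ (Finset.univ : Finset (Fin n)).filter (fun j : Fin n => 1 ≤ (j : ℕ) ∧ (j : ℕ) ≤ i + 1), a j else ∑ j, a j

variable {n : ℕ} (a : Fin n → ℕ)

/-- The polytope `Π`. -/
def polytope : Set (ℕ →₀ ℝ) := {x | (∀ i, 0 ≤ x i) ∧ ∀ i, psi n i x ≤ bound a i}

/-- The facets `Γ_i`. -/
def facetG (i : ℕ) : Set (ℕ →₀ ℝ) := {x ∈ polytope a | psi n i x = bound a i}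

/-- The facets `Δ_i`. -/
def facetD (i : ℕ) : Set (ℕ →₀ ℝ) := {x ∈ polytope a | x i = 0}

/-- The set of the facets of `Π` that contain the subset `A`. -/
def facetsThrough (A : Set (ℕ →₀ ℝ)) : Set (Set (ℕ →₀ ℝ)) :=
  {X ∈ Set.range (facetG a) ∪ Set.range (facetD a) | A ⊆ X}

/-- A vertex: a point of `Π` for which the set of facets containing it is maximal. -/
def IsVertex (u : ℕ →₀ ℝ) : Prop :=
  u ∈ polytope a ∧ ∀ v ∈ polytope a,
    facetsThrough a {u} ⊆ facetsThrough a {v} → facetsThrough a {v} ⊆ facetsThrough a {u}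

/-- An edge: a subset of `Π` of more than one point for which the set of facets containing it is maximal
amongst such subsets, and which is the whole intersection of these facets. -/
def IsEdge (e : Set (ℕ →₀ ℝ)) : Prop :=
  e.Nontrivial ∧ e = polytope a ∩ ⋂₀ facetsThrough a e ∧
    ∀ e' ⊆ polytope a, e'.Nontrivial →
      facetsThrough a e ⊆ facetsThrough a e' → facetsThrough a e' ⊆ facetsThrough a e

/-- `ε` is the direction vector at `u` of an edge through `u`: the minimal nonzero integral vector with
`u + ε` on the edge. -/
def IsDirection (u : ℕ →₀ ℝ) (ε : ℕ →₀ ℤ) : Prop :=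
  ∃ e, IsEdge a e ∧ u ∈ e ∧ ε ≠ 0 ∧ u + toReal ε ∈ e ∧
    ∀ η : ℕ →₀ ℤ, u + toReal η ∈ e → ∃ k : ℕ, η = k • ε

/-- The vertex cone `C_u`. -/
def vertexCone (u : ℕ →₀ ℝ) : Set (ℕ →₀ ℝ) :=
  {x | x - u ∈ PointedCone.hull ℝ (toReal '' {ε | IsDirection a u ε})}

/-- The section `C_u^m` of `C_u` by the space of sequences that vanish after the first `m` terms. -/
def coneSection (u : ℕ →₀ ℝ) (m : ℕ) : Set (ℕ →₀ ℝ) := {x ∈ vertexCone a u | ∀ i, m ≤ i → x i = 0}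

/-- `l_u`, the maximal index (counted from `1`) of a facet `Γ` containing `u`, and `0` if there is
none. -/
def lastG (u : ℕ →₀ ℝ) : ℕ := sSup {l | ∃ i, l = i + 1 ∧ u ∈ facetG a i}

/-- `g = τ_u^m`, the image in `R` of `σ^*(C_u^m)`. -/
def IsVertexChar (u : ℕ →₀ ℝ) (m : ℕ) (g : CharRing n) : Prop :=
  ∃ f, IsSigmaStar n (coneSection a u m) f ∧ IsCharOf f g

/-- `g = τ_u`: the characters `τ_u^m` exist for all `m ≥ l_u`, and each of their coefficients
stabilizes, as `m` grows, at the corresponding coefficient of `g`. -/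
def IsLimitChar (u : ℕ →₀ ℝ) (g : CharRing n) : Prop :=
  ∃ τ : ℕ → CharRing n, (∀ m, lastG a u ≤ m → IsVertexChar a u m (τ m)) ∧
    ∀ w, ∃ M, ∀ m, M ≤ m → charCoeff (τ m) w = charCoeff g w

end InfBrion

end

/-! The identity is a limit of finite-dimensional Brion identities, all taken after the
substitution. In terms of partial sums ("nodes", the first `n` of which are the base and have
partial sum 0), every inequality of Π bounds the difference of two nodes. The section of Π by the
first `m` coordinates is therefore a lattice polytope of the affine braid arrangement, and the
arrangement triangulates it unimodularly. The tangent cone at any lattice point `v` is the disjoint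
union of the relatively open cones at `v` of the simplices through `v` (`tangentSum_hasPhi`). For
one simplex with at least two vertices, the contributions of its vertices cancel by Lagrange
interpolation (`sum_prod_inv_sub`). Hence the tangent cone sums over all lattice points, not only
the vertices, add up to the sum of the exponentials (`sum_tangentSum`). Nonzero nonnegative vectors
of partial sums have nonzero weight, so no denominator vanishes under the substitution.

The main point is to evaluate the tangent cone sums at points lying on no Γ beyond the window. Nodes
whose positions differ by `(n - 1) t` and whose values differ by `k t` form a block. Free nodes in a
block have the same weight, so permuting them does not change a specialised sum. In suitably shifted
coordinates, the sum of the indicators of the cone over all block permutations is the determinant of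
a 0/1 matrix (`sum_interlacing`). A term of the Leibniz formula only imposes inequalities along
chains of nodes. If some chain is not attached to the base, the term is invariant under a
translation of nonzero weight and sums to 0. If for some permutation all nodes are attached to the
base, then all blocks are singletons and every free node has a tight inequality to a lower node,
that is, the pattern is regular. So points with non-regular patterns contribute 0
(`HasPhi.eq_zero_of_not_regular`), while regular ones are vertices with a unimodular cone whose
generators have roots as weights (`IsRegularPattern.hasPhi`).

To connect this with the cones of the statement, vertices are described by rigidity: no nonempty set
of free nodes can be moved while keeping the tight inequalities. Indecomposable tangent directions
take only the values 0 and one sign on nodes, so they are edge directions. Thus the lattice points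
of the vertex cone are exactly those satisfying the inequalities tight at the vertex
(`toReal_mem_vertexCone_iff`).

For the limit, enlarging the window multiplies the sum at a vertex by `1 / (1 - exp α)` with the
height of `α` tending to minus infinity, so coefficients stabilise (`exists_limit`). The points
lying on some Γ beyond the window remain. For large `m` they all have small height, and their total
contribution is a quotient whose expansion vanishes at the given weight (`HasChar.coeff_eq_zero`).
Comparing coefficients finishes the proof (`InfBrion.coeff_sum_eq`). -/

noncomputable section

namespace InfBrion

open AddMonoidAlgebra

/-! ### Specialised generating functions of summable functions on a lattice -/

section Phi

variable {H H' : Type*} [AddCommGroup H] [AddCommGroup H'] {n : ℕ}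

/-- The action of a lattice on its functions by translations. -/
def shiftHom (H : Type*) [AddCommGroup H] : Multiplicative H →* Module.End ℂ (H → ℂ) where
  toFun y := LinearMap.funLeft ℂ ℂ fun x => x - y.toAdd
  map_one' := by
    ext F x
    simp [LinearMap.funLeft_apply]
  map_mul' y z := by
    ext F x
    simp only [LinearMap.funLeft_apply, toAdd_mul, Module.End.mul_apply]
    congr 1
    abel

/-- The action of Laurent polynomials on formal Laurent series. -/
def act : AddMonoidAlgebra ℂ H →ₐ[ℂ] Module.End ℂ (H → ℂ) := lift ℂ _ H (shiftHom H)

lemma act_apply (θ : AddMonoidAlgebra ℂ H) (F : H → ℂ) (x : H) :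
    act θ F x = θ.coeff.sum fun y c => c * F (x - y) := by
  unfold act
  rw [lift_apply, Finsupp.sum, Finsupp.sum, LinearMap.sum_apply, Finset.sum_apply]
  rfl

lemma act_single (y : H) (c : ℂ) (F : H → ℂ) (x : H) :
    act (single y c) F x = c * F (x - y) := by
  rw [act, lift_single]; rfl

lemma act_coeff (θ P : AddMonoidAlgebra ℂ H) : act θ (P.coeff : H → ℂ) = ((θ * P).coeff : H → ℂ) := by
  induction θ using AddMonoidAlgebra.induction_linear with
  | zero => simp
  | add f g hf hg => rw [map_add, LinearMap.add_apply, hf, hg, add_mul]; rfl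
  | single y c =>
    ext x
    rw [act_single, coeff_single_mul_apply, neg_add_eq_sub]

/-- The substitution homomorphism attached to a homomorphism of lattices. -/
def starMap (st : H →+ Weight n) : AddMonoidAlgebra ℂ H →+* LaurentZ n := mapDomainRingHom ℂ st

@[simp] lemma starMap_single (st : H →+ Weight n) (x : H) (c : ℂ) :
    starMap st (single x c) = single (st x) c := by
  simp [starMap]

/-- The field of rational functions in `z_1, ..., z_{n-1}, q`. -/
abbrev RatZ (n : ℕ) : Type := FractionRing (LaurentZ n)

/-- Laurent polynomials as rational functions. -/
abbrev toRat (n : ℕ) : LaurentZ n →+* RatZ n := algebraMap _ _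

lemma toRat_injective : Function.Injective (toRat n) := IsFractionRing.injective _ _

lemma toRat_ne_zero {P : LaurentZ n} (h : P ≠ 0) : toRat n P ≠ 0 := fun h0 =>
  h (toRat_injective (by rw [h0, map_zero]))

/-- The monomial `exp w` as a rational function. -/
def ex (w : Weight n) : RatZ n := toRat n (single w 1)

lemma ex_add (v w : Weight n) : ex (v + w) = ex v * ex w := by
  rw [ex, ex, ex, ← map_mul, single_mul_single, one_mul]

lemma ex_zero : ex (0 : Weight n) = 1 := by
  rw [ex, ← AddMonoidAlgebra.one_def, map_one]

lemma ex_neg_mul (w : Weight n) : ex (-w) * ex w = 1 := by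
  rw [← ex_add, neg_add_cancel, ex_zero]

lemma ex_ne_zero (w : Weight n) : ex w ≠ 0 := right_ne_zero_of_mul_eq_one (ex_neg_mul w)

lemma ex_injective : Function.Injective (ex : Weight n → RatZ n) := fun _ _ h =>
  single_left_injective one_ne_zero (toRat_injective h)

lemma single_sub_ne_zero {v w : Weight n} (h : v ≠ w) :
    (single v 1 - single w 1 : LaurentZ n) ≠ 0 := fun h0 =>
  h (single_left_injective one_ne_zero (sub_eq_zero.1 h0))

lemma one_sub_single_ne_zero {w : Weight n} (h : w ≠ 0) : (1 - single w 1 : LaurentZ n) ≠ 0 := by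
  rw [AddMonoidAlgebra.one_def]
  exact single_sub_ne_zero h.symm

lemma one_sub_ex_ne_zero {w : Weight n} (h : w ≠ 0) : 1 - ex w ≠ 0 := fun h0 =>
  h (ex_injective (by rw [ex_zero]; exact (sub_eq_zero.1 h0).symm))

lemma toRat_one_sub (w : Weight n) : toRat n (1 - single w 1) = 1 - ex w := by
  rw [map_sub, map_one, ex]

/-- `f` is the specialisation of the sum of `F x * exp x` over the lattice. -/
def HasPhi (st : H →+ Weight n) (F : H → ℂ) (f : RatZ n) : Prop :=
  ∃ θ P : AddMonoidAlgebra ℂ H, starMap st θ ≠ 0 ∧ act θ F = (P.coeff : H → ℂ) ∧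
    f = toRat n (starMap st P) / toRat n (starMap st θ)

variable {st : H →+ Weight n} {F G : H → ℂ} {f g : RatZ n}

/-- The group algebra is commutative, so `θ' P` and `θ P'` are both `θ θ' F`. Cross-multiplication
is allowed because the specialised denominators are nonzero. -/
lemma HasPhi.unique (hf : HasPhi st F f) (hg : HasPhi st F g) : f = g := by
  obtain ⟨θ, P, hθ, hP, rfl⟩ := hf
  obtain ⟨θ', P', hθ', hP', rfl⟩ := hg
  have h : θ' * P = θ * P' := by
    apply coeff_injective
    apply DFunLike.coe_injective
    rw [← act_coeff, ← act_coeff, ← hP, ← hP', ← Module.End.mul_apply, ← Module.End.mul_apply,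
      ← map_mul, ← map_mul, mul_comm]
  rw [div_eq_div_iff (toRat_ne_zero hθ) (toRat_ne_zero hθ'), ← map_mul, ← map_mul, ← map_mul,
    ← map_mul, mul_comm P, h, mul_comm]

lemma HasPhi.add (hf : HasPhi st F f) (hg : HasPhi st G g) : HasPhi st (F + G) (f + g) := by
  obtain ⟨θ, P, hθ, hP, rfl⟩ := hf
  obtain ⟨θ', P', hθ', hP', rfl⟩ := hg
  refine ⟨θ * θ', θ' * P + θ * P', ?_, ?_, ?_⟩
  · rw [map_mul]; exact mul_ne_zero hθ hθ'
  · rw [map_add, coeff_add, Finsupp.coe_add, ← act_coeff, ← act_coeff, ← hP, ← hP',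
      ← Module.End.mul_apply, ← Module.End.mul_apply, ← map_mul, ← map_mul, mul_comm θ]
  · rw [div_add_div _ _ (toRat_ne_zero hθ) (toRat_ne_zero hθ')]
    simp only [map_mul, map_add]
    ring

lemma HasPhi.smul (hf : HasPhi st F f) (c : ℂ) :
    HasPhi st (c • F) (toRat n (single 0 c) * f) := by
  obtain ⟨θ, P, hθ, hP, rfl⟩ := hf
  refine ⟨θ, single 0 c * P, hθ, ?_, ?_⟩
  · rw [map_smul, hP]
    ext x
    simp [coeff_single_mul_apply]
  · rw [map_mul, map_mul, starMap_single, map_zero, mul_div_assoc]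

lemma HasPhi.zero : HasPhi st 0 0 :=
  ⟨1, 0, by simp, by ext; simp, by simp⟩

lemma HasPhi.sum {κ : Type*} (s : Finset κ) {F : κ → H → ℂ} {f : κ → RatZ n}
    (h : ∀ i ∈ s, HasPhi st (F i) (f i)) : HasPhi st (∑ i ∈ s, F i) (∑ i ∈ s, f i) := by
  classical
  induction s using Finset.induction_on with
  | empty => exact HasPhi.zero
  | insert a s ha ih =>
    rw [Finset.sum_insert ha, Finset.sum_insert ha]
    exact (h a (Finset.mem_insert_self a s)).add
      (ih fun i hi => h i (Finset.mem_insert_of_mem hi))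

lemma act_one_sub_single (ε : H) (F : H → ℂ) :
    act (1 - single ε 1) F = fun x => F x - F (x - ε) := by
  ext x
  rw [map_sub, map_one, LinearMap.sub_apply, Module.End.one_apply, Pi.sub_apply, act_single,
    one_mul]

/-- Functions invariant under a translation that is visible to the weights have zero sum. -/
lemma HasPhi.of_periodic {ε : H} (hε : st ε ≠ 0) (hF : ∀ x, F (x - ε) = F x) : HasPhi st F 0 := by
  refine ⟨1 - single ε 1, 0, ?_, ?_, by simp⟩
  · rw [map_sub, map_one, starMap_single]
    exact one_sub_single_ne_zero hε
  · rw [act_one_sub_single]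
    ext x
    simp [hF]

/-- Division by `1 - exp ε`. -/
lemma HasPhi.div_one_sub {ε : H} (hε : st ε ≠ 0) (hG : HasPhi st G g)
    (hF : ∀ x, F x - F (x - ε) = G x) : HasPhi st F (g * (1 - ex (st ε))⁻¹) := by
  obtain ⟨θ, P, hθ, hP, rfl⟩ := hG
  refine ⟨θ * (1 - single ε 1), P, ?_, ?_, ?_⟩
  · rw [map_mul, map_sub, map_one, starMap_single]
    exact mul_ne_zero hθ (one_sub_single_ne_zero hε)
  · rw [map_mul, Module.End.mul_apply, act_one_sub_single, ← hP]
    congr 1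
    ext x
    exact hF x
  · rw [map_mul, map_sub, map_one, starMap_single, map_mul, toRat_one_sub]
    field_simp

lemma HasPhi.single (v : H) : HasPhi st (Set.indicator {v} 1) (ex (st v)) := by
  refine ⟨1, AddMonoidAlgebra.single v 1, by simp, ?_, by simp [ex]⟩
  ext x
  rw [map_one, Module.End.one_apply, coeff_single]
  by_cases h : x = v
  · simp [h]
  · rw [Set.indicator_of_notMem (by simpa using h), Finsupp.single_eq_of_ne h]

/-- The sum over a unimodular cone. -/
lemma HasPhi.cone {κ : Type*} (s : Finset κ) (ε : κ → H) (v : H)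
    (hε : ∀ i ∈ s, st (ε i) ≠ 0)
    (hind : ∀ c : κ → ℤ, ∑ i ∈ s, c i • ε i = 0 → ∀ i ∈ s, c i = 0) :
    HasPhi st (Set.indicator {x | ∃ c : κ → ℕ, x = v + ∑ i ∈ s, c i • ε i} 1)
      (ex (st v) * ∏ i ∈ s, (1 - ex (st (ε i)))⁻¹) := by
  classical
  induction s using Finset.induction_on with
  | empty =>
    simpa [Set.ofPred_eq_eq_singleton] using HasPhi.single (st := st) v
  | insert a s ha ih =>
    have hne : ∀ j ∈ s, j ≠ a := fun j hj h => ha (h ▸ hj)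
    have hupZ : ∀ (c : κ → ℤ) (t : ℤ), ∑ i ∈ s, Function.update c a t i • ε i = ∑ i ∈ s, c i • ε i :=
      fun c t => Finset.sum_congr rfl fun j hj => by rw [Function.update_of_ne (hne j hj)]
    have hupN : ∀ (c : κ → ℕ) (t : ℕ), ∑ i ∈ s, Function.update c a t i • ε i = ∑ i ∈ s, c i • ε i :=
      fun c t => Finset.sum_congr rfl fun j hj => by rw [Function.update_of_ne (hne j hj)]
    rw [Finset.prod_insert ha, mul_comm (_)⁻¹, ← mul_assoc]
    -- Subtracting from the cone its translate by the new generator leaves the cone on the old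
    -- generators.
    refine HasPhi.div_one_sub (hε a (Finset.mem_insert_self a s))
      (ih (fun i hi => hε i (Finset.mem_insert_of_mem hi)) fun c hc i hi => ?_) fun x => ?_
    · have := hind (Function.update c a 0) (by
        rw [Finset.sum_insert ha, Function.update_self, zero_smul, zero_add, hupZ, hc])
        i (Finset.mem_insert_of_mem hi)
      rwa [Function.update_of_ne (hne i hi)] at this
    · set A := {x | ∃ c : κ → ℕ, x = v + ∑ i ∈ insert a s, c i • ε i}
      set B := {x | ∃ c : κ → ℕ, x = v + ∑ i ∈ s, c i • ε i}
      have hBA : B ⊆ A := by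
        rintro y ⟨c, rfl⟩
        refine ⟨Function.update c a 0, ?_⟩
        rw [Finset.sum_insert ha, Function.update_self, zero_smul, zero_add, hupN]
      have hAA : x - ε a ∈ A → x ∈ A := by
        rintro ⟨c, hc⟩
        refine ⟨Function.update c a (c a + 1), ?_⟩
        rw [Finset.sum_insert ha] at hc
        rw [Finset.sum_insert ha, Function.update_self, sub_eq_iff_eq_add.1 hc, add_smul, one_smul,
          hupN]
        abel
      have hAB : x ∈ A → x - ε a ∉ A → x ∈ B := by
        rintro ⟨c, hc⟩ h
        rw [Finset.sum_insert ha] at hc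
        rcases Nat.eq_zero_or_pos (c a) with h0 | h0
        · exact ⟨c, by rw [hc, h0, zero_smul, zero_add]⟩
        · refine absurd ⟨Function.update c a (c a - 1), ?_⟩ h
          rw [Finset.sum_insert ha, Function.update_self, hc, hupN]
          obtain ⟨m, hm⟩ : ∃ m, c a = m + 1 := ⟨c a - 1, by omega⟩
          rw [hm, Nat.add_sub_cancel, add_smul, one_smul]
          abel
      -- By independence the coefficient of `ε a` is determined by `x`; it cannot be both 0 and `d a
      -- + 1`.
      have hBn : x ∈ B → x - ε a ∉ A := by
        rintro ⟨c, hc⟩ ⟨d, hd⟩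
        have key := hind (Function.update (fun i => (d i : ℤ) - c i) a (d a + 1)) (by
          rw [Finset.sum_insert ha, hupZ, Function.update_self]
          rw [Finset.sum_insert ha, hc] at hd
          simp only [sub_smul, Finset.sum_sub_distrib, natCast_zsmul, add_smul, one_smul]
          have e : (v + ∑ i ∈ s, c i • ε i) - ε a - (v + (d a • ε a + ∑ i ∈ s, d i • ε i)) = 0 := by
            rw [hd, sub_self]
          rw [← neg_eq_zero, ← e]
          abel) a (Finset.mem_insert_self a s)
        rw [Function.update_self] at key
        omega
      by_cases h1 : x ∈ A <;> by_cases h2 : x - ε a ∈ A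
      · have h3 : x ∉ B := fun h => hBn h h2
        simp [Set.indicator, h1, h2, h3]
      · have h3 : x ∈ B := hAB h1 h2
        simp [Set.indicator, h1, h2, h3]
      · exact absurd (hAA h2) h1
      · have h3 : x ∉ B := fun h => h1 (hBA h)
        simp [Set.indicator, h1, h2, h3]

/-- Invariance under an automorphism and a translation. -/
lemma HasPhi.comp_equiv (e : H ≃+ H) (he : ∀ x, st (e x) = st x) (w : H)
    (hF : HasPhi st F f) : HasPhi st (fun x => F (e x + w)) (ex (-st w) * f) := by
  obtain ⟨θ, P, hθ, hP, rfl⟩ := hF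
  have hs : ∀ θ : AddMonoidAlgebra ℂ H, starMap st (mapDomainRingHom ℂ (e.symm : H →+ H) θ) =
      starMap st θ := fun θ => by
    induction θ using AddMonoidAlgebra.induction_linear with
    | zero => simp
    | add f g hf hg => rw [map_add, map_add, hf, hg, map_add]
    | single y c => simp [← he (e.symm y)]
  have ha : ∀ θ : AddMonoidAlgebra ℂ H, act (mapDomainRingHom ℂ (e.symm : H →+ H) θ)
      (fun x => F (e x + w)) = fun x => act θ F (e x + w) := fun θ => by
    induction θ using AddMonoidAlgebra.induction_linear with
    | zero => ext; simp
    | add f g hf hg =>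
      ext x
      rw [map_add, map_add, map_add, LinearMap.add_apply, hf, hg, LinearMap.add_apply]; rfl
    | single y c =>
      ext x
      simp only [mapDomainRingHom_apply, mapDomain_single, AddMonoidHom.coe_coe, act_single, map_sub,
        AddEquiv.apply_symm_apply]
      congr 2
      abel
  refine ⟨mapDomainRingHom ℂ (e.symm : H →+ H) θ,
    mapDomainRingHom ℂ (e.symm : H →+ H) (AddMonoidAlgebra.single (-w) 1 * P), by rwa [hs], ?_, ?_⟩
  · rw [ha, hP]
    ext x
    have : ∀ Q : AddMonoidAlgebra ℂ H,
        (mapDomainRingHom ℂ (e.symm : H →+ H) Q).coeff x = Q.coeff (e x) := fun Q => by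
      have := Finsupp.mapDomain_apply (f := e.symm) e.symm.injective Q.coeff (e x)
      rwa [e.symm_apply_apply] at this
    rw [this, coeff_single_mul_apply]
    simp [add_comm]
  · rw [hs, hs, map_mul, starMap_single, map_mul, map_neg, mul_div_assoc, ex]

/-- Extension by zero along an embedding of lattices. -/
lemma HasPhi.map {st' : H' →+ Weight n} (ι : H →+ H') (hι : Function.Injective ι)
    (hst : ∀ x, st' (ι x) = st x) (A : Set H) (hF : HasPhi st (A.indicator 1) f) :
    HasPhi st' ((ι '' A).indicator 1) f := by
  obtain ⟨θ, P, hθ, hP, rfl⟩ := hF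
  have hs : ∀ θ : AddMonoidAlgebra ℂ H, starMap st' (mapDomainRingHom ℂ ι θ) =
      starMap st θ := fun θ => by
    induction θ using AddMonoidAlgebra.induction_linear with
    | zero => simp
    | add f g hf hg => rw [map_add, map_add, hf, hg, map_add]
    | single y c => simp [hst]
  have hin : ∀ x, (ι '' A).indicator (1 : H' → ℂ) (ι x) = A.indicator 1 x := fun x => by
    by_cases h : x ∈ A
    · rw [Set.indicator_of_mem h, Set.indicator_of_mem (Set.mem_image_of_mem ι h)]; rfl
    · rw [Set.indicator_of_notMem h, Set.indicator_of_notMem]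
      rwa [hι.mem_set_image]
  have ha : ∀ (θ : AddMonoidAlgebra ℂ H) (x : H), act (mapDomainRingHom ℂ ι θ)
      ((ι '' A).indicator 1) (ι x) = act θ (A.indicator 1) x := fun θ x => by
    induction θ using AddMonoidAlgebra.induction_linear with
    | zero => simp
    | add f g hf hg =>
      rw [map_add, map_add, map_add, LinearMap.add_apply, Pi.add_apply, hf, hg]; rfl
    | single y c =>
      simp only [mapDomainRingHom_apply, mapDomain_single, act_single, ← map_sub, hin]
  have hn : ∀ (θ : AddMonoidAlgebra ℂ H) (x : H'), x ∉ Set.range ι →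
      act (mapDomainRingHom ℂ ι θ) ((ι '' A).indicator 1) x = 0 := fun θ x hx => by
    induction θ using AddMonoidAlgebra.induction_linear with
    | zero => simp
    | add f g hf hg => rw [map_add, map_add, LinearMap.add_apply, Pi.add_apply, hf, hg, add_zero]
    | single y c =>
      simp only [mapDomainRingHom_apply, mapDomain_single, act_single]
      rw [Set.indicator_of_notMem, mul_zero]
      rintro ⟨z, -, hz⟩
      exact hx ⟨z + y, by rw [map_add, hz, sub_add_cancel]⟩
  refine ⟨mapDomainRingHom ℂ ι θ, mapDomainRingHom ℂ ι P, by rwa [hs], ?_, by rw [hs, hs]⟩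
  ext x
  by_cases hx : x ∈ Set.range ι
  · obtain ⟨y, rfl⟩ := hx
    rw [ha, hP]
    exact (Finsupp.mapDomain_apply hι P.coeff y).symm
  · rw [hn θ x hx]
    exact (Finsupp.mapDomain_of_notMem_range P.coeff x hx).symm

lemma HasPhi.isSigmaStar {C : Set (ℕ →₀ ℝ)} {f : RatZ n}
    (h : HasPhi (starWeight n) (genSeries C) f) : IsSigmaStar n C f := by
  obtain ⟨θ, P, hθ, hP, rfl⟩ := h
  refine ⟨_, ⟨θ, P, ?_, fun x => ?_, rfl⟩, P, θ, hθ, rfl, rfl⟩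
  · rintro rfl
    exact hθ (map_zero _)
  · rw [← hP, act_apply]; rfl

end Phi

end InfBrion

end

noncomputable section

namespace InfBrion

open AddMonoidAlgebra

/-! ### Brion's formula for polytopes cut out by differences of coordinates -/

section Brion

set_option linter.unusedSectionVars false

variable {ι : Type*} {n : ℕ}

/-- The vertex sets of the faces of the affine braid arrangement. -/
def IsSimplex (f : Finset (ι → ℤ)) : Prop :=
  ∀ v ∈ f, ∀ w ∈ f, (v ≤ w ∨ w ≤ v) ∧ ∀ i, w i - v i ≤ 1

/-- The elements form a chain. At a coordinate where the largest element `M` exceeds the second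
largest, the unit bound forces all the others to have the value `M i - 1`. Combining that coordinate
of the relation with the vanishing of the total coefficient kills the coefficient of `M`, and `M`
can be removed. -/
lemma IsSimplex.affineIndependent {f : Finset (ι → ℤ)} (hf : IsSimplex f) (c : (ι → ℤ) → ℤ)
    (h0 : ∑ w ∈ f, c w = 0) (h1 : ∑ w ∈ f, c w • w = 0) : ∀ w ∈ f, c w = 0 := by
  classical
  induction hk : f.card using Nat.strong_induction_on generalizing f with
  | _ k ih =>
  rcases f.eq_empty_or_nonempty with rfl | hne
  · simp
  obtain ⟨M, hM⟩ := f.exists_maximal hne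
  have hle : ∀ w ∈ f, w ≤ M := fun w hw => by
    rcases (hf w hw M hM.1).1 with h | h
    · exact h
    · exact hM.2 hw h
  have hcM : c M = 0 := by
    rcases (f.erase M).eq_empty_or_nonempty with he | hne'
    · rw [← Finset.add_sum_erase _ _ hM.1, he, Finset.sum_empty, add_zero] at h0
      exact h0
    · obtain ⟨M', hM'⟩ := (f.erase M).exists_maximal hne'
      have hM'f := Finset.mem_of_mem_erase hM'.1
      have hle' : ∀ w ∈ f.erase M, w ≤ M' := fun w hw => by
        rcases (hf w (Finset.mem_of_mem_erase hw) M' hM'f).1 with h | h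
        · exact h
        · exact hM'.2 hw h
      obtain ⟨i, hi⟩ : ∃ i, M' i < M i := by
        by_contra! h
        exact Finset.ne_of_mem_erase hM'.1 (le_antisymm (hle _ hM'f) h)
      have e1 := congrFun h1 i
      rw [Finset.sum_apply, ← Finset.add_sum_erase _ _ hM.1,
        Finset.sum_congr rfl fun w (hw : w ∈ f.erase M) => show (c w • w) i = c w * (M i - 1) by
          have h2 : w i ≤ M' i := hle' w hw i
          have h3 := (hf w (Finset.mem_of_mem_erase hw) M hM.1).2 i
          rw [Pi.smul_apply, smul_eq_mul, show w i = M i - 1 by omega], ← Finset.sum_mul] at e1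
      rw [← Finset.add_sum_erase _ _ hM.1] at h0
      simp only [Pi.smul_apply, smul_eq_mul, Pi.zero_apply] at e1
      linear_combination e1 - (M i - 1) * h0
  intro w hw
  by_cases hwM : w = M
  · rw [hwM, hcM]
  refine ih (f.erase M).card (by rw [← hk]; exact Finset.card_erase_lt_of_mem hM.1)
    (fun v hv w hw => hf v (Finset.mem_of_mem_erase hv) w (Finset.mem_of_mem_erase hw)) ?_ ?_ rfl
    w (Finset.mem_erase.2 ⟨hwM, hw⟩)
  · rwa [← Finset.add_sum_erase _ _ hM.1, hcM, zero_add] at h0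
  · rwa [← Finset.add_sum_erase _ _ hM.1, hcM, zero_smul, zero_add] at h1

variable [DecidableEq ι] [Fintype ι]

lemma IsSimplex.linearIndependent {f : Finset (ι → ℤ)} (hf : IsSimplex f) {v : ι → ℤ} (hv : v ∈ f)
    (c : (ι → ℤ) → ℤ) (h : ∑ w ∈ f.erase v, c w • (w - v) = 0) : ∀ w ∈ f.erase v, c w = 0 := by
  intro w hw
  have hup : ∀ t : ℤ, ∀ w ∈ f.erase v, Function.update c v t w = c w := fun t w hw =>
    Function.update_of_ne (Finset.ne_of_mem_erase hw) t c
  have := hf.affineIndependent (Function.update c v (-∑ w ∈ f.erase v, c w)) ?_ ?_ w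
    (Finset.mem_of_mem_erase hw)
  · rwa [hup _ w hw] at this
  · rw [← Finset.add_sum_erase _ _ hv, Function.update_self, Finset.sum_congr rfl (hup _),
      neg_add_cancel]
  · rw [← Finset.add_sum_erase _ _ hv, Function.update_self,
      Finset.sum_congr rfl fun w hw => congrArg (· • w) (hup _ w hw), ← h]
    simp only [smul_sub, Finset.sum_sub_distrib, ← Finset.sum_smul, neg_smul]
    abel

/-- The relatively open cone at the vertex `v` of the simplex `f`. -/
def openCone (v : ι → ℤ) (f : Finset (ι → ℤ)) : Set (ι → ℤ) :=
  {x | ∃ c : (ι → ℤ) → ℕ, x = v + ∑ w ∈ f.erase v, (c w + 1) • (w - v)}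

/-- The specialised sum over the relatively open cone. -/
def openConeSum (st : (ι → ℤ) →+ Weight n) (v : ι → ℤ) (f : Finset (ι → ℤ)) : RatZ n :=
  ex (st v) * ∏ w ∈ f.erase v, (ex (st (w - v)) * (1 - ex (st (w - v)))⁻¹)

variable {st : (ι → ℤ) →+ Weight n}

lemma IsSimplex.weight_ne {f : Finset (ι → ℤ)} (hf : IsSimplex f)
    (hst : ∀ x : ι → ℤ, 0 ≤ x → x ≠ 0 → st x ≠ 0) {v w : ι → ℤ} (hv : v ∈ f) (hw : w ∈ f)
    (hne : w ≠ v) : st (w - v) ≠ 0 := by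
  rcases (hf v hv w hw).1 with h | h
  · exact hst _ (sub_nonneg.2 h) (sub_ne_zero.2 hne)
  · have := hst _ (sub_nonneg.2 h) (sub_ne_zero.2 hne.symm)
    rwa [← neg_sub, map_neg, Ne, neg_eq_zero] at this

lemma ex_sum {κ : Type*} (s : Finset κ) (f : κ → Weight n) :
    ex (∑ i ∈ s, f i) = ∏ i ∈ s, ex (f i) := by
  classical
  induction s using Finset.induction_on with
  | empty => rw [Finset.sum_empty, Finset.prod_empty, ex_zero]
  | insert a s ha ih => rw [Finset.sum_insert ha, Finset.prod_insert ha, ex_add, ih]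

/-- On lattice points the relatively open cone is the closed one translated by the sum of its
generators. -/
lemma IsSimplex.hasPhi {f : Finset (ι → ℤ)} (hf : IsSimplex f)
    (hst : ∀ x : ι → ℤ, 0 ≤ x → x ≠ 0 → st x ≠ 0) {v : ι → ℤ} (hv : v ∈ f) :
    HasPhi st ((openCone v f).indicator 1) (openConeSum st v f) := by
  have h := HasPhi.cone (st := st) (f.erase v) (fun w => w - v) (v + ∑ w ∈ f.erase v, (w - v))
    (fun w hw => hf.weight_ne hst hv (Finset.mem_of_mem_erase hw) (Finset.ne_of_mem_erase hw))
    (hf.linearIndependent hv)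
  convert h using 1
  · congr 1
    ext x
    simp only [openCone, Set.mem_ofPred_eq, add_smul, one_smul, Finset.sum_add_distrib]
    refine exists_congr fun c => ?_
    rw [add_comm (∑ w ∈ f.erase v, c w • (w - v)), add_assoc]
  · rw [openConeSum, Finset.prod_mul_distrib, map_add, ex_add, map_sum, ex_sum, mul_assoc]

/-- The `t`-th layer of an integral function. -/
def layerVal (t z : ℤ) : ℤ := if 1 ≤ t ∧ t ≤ z then 1 else if t ≤ -1 ∧ z ≤ t then -1 else 0

lemma layerVal_zero (t : ℤ) : layerVal t 0 = 0 := by unfold layerVal; split_ifs <;> omega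

lemma layerVal_mono (t : ℤ) {y z : ℤ} (h : y ≤ z) : layerVal t y ≤ layerVal t z := by
  unfold layerVal; split_ifs <;> omega

lemma layerVal_sub_le (t y z : ℤ) : layerVal t y - layerVal t z ≤ 1 := by
  unfold layerVal; split_ifs <;> omega

lemma layerVal_sub_le' (s t z : ℤ) : layerVal t z - layerVal s z ≤ 1 := by
  unfold layerVal; split_ifs <;> omega

/-- Layers with positive index are nonnegative and decrease as the index grows; those with negative
index are nonpositive and increase as the index decreases; layer 0 is zero. So the layers of a
vector form a chain. -/
lemma layerVal_total (s t : ℤ) :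
    (∀ z, layerVal s z ≤ layerVal t z) ∨ ∀ z, layerVal t z ≤ layerVal s z := by
  unfold layerVal
  by_cases h : s ≤ t
  · by_cases hs : 1 ≤ s
    · right; intro z; split_ifs <;> omega
    · by_cases ht : 1 ≤ t
      · left; intro z; split_ifs <;> omega
      · by_cases ht0 : t = 0
        · left; intro z; split_ifs <;> omega
        · right; intro z; split_ifs <;> omega
  · by_cases hs : 1 ≤ t
    · left; intro z; split_ifs <;> omega
    · by_cases ht : 1 ≤ s
      · right; intro z; split_ifs <;> omega
      · by_cases ht0 : s = 0
        · right; intro z; split_ifs <;> omega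
        · left; intro z; split_ifs <;> omega

lemma sum_layerVal_nat (M : ℕ) (z : ℤ) (hz : |z| ≤ M) :
    ∑ t ∈ Finset.Icc (-(M : ℤ)) M, layerVal t z = z := by
  rw [abs_le] at hz
  rcases le_total 0 z with h0 | h0
  · rw [Finset.sum_congr rfl (g := fun t => if t ∈ Finset.Icc 1 z then (1 : ℤ) else 0)]
    · rw [← Finset.sum_filter, Finset.sum_const,
        show Finset.filter (fun t => t ∈ Finset.Icc 1 z) (Finset.Icc (-(M : ℤ)) M) = Finset.Icc 1 z by
          ext t; simp only [Finset.mem_filter, Finset.mem_Icc]; omega]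
      simp [h0]
    · intro t _
      unfold layerVal
      simp only [Finset.mem_Icc]
      split_ifs <;> omega
  · rw [Finset.sum_congr rfl (g := fun t => if t ∈ Finset.Icc z (-1) then (-1 : ℤ) else 0)]
    · rw [← Finset.sum_filter, Finset.sum_const,
        show Finset.filter (fun t => t ∈ Finset.Icc z (-1)) (Finset.Icc (-(M : ℤ)) M) =
          Finset.Icc z (-1) by
          ext t; simp only [Finset.mem_filter, Finset.mem_Icc]; omega]
      simp [h0]
    · intro t _
      unfold layerVal
      simp only [Finset.mem_Icc]
      split_ifs <;> omega

/-- The `t`-th layer of a vector. -/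
def layer (d : ι → ℤ) (t : ℤ) : ι → ℤ := fun i => layerVal t (d i)

/-- A bound for the entries of a vector. -/
def entryBound (d : ι → ℤ) : ℕ := ∑ i, (d i).natAbs

lemma abs_le_entryBound (d : ι → ℤ) (i : ι) : |d i| ≤ entryBound d := by
  have : (d i).natAbs ≤ entryBound d :=
    Finset.single_le_sum (f := fun i => (d i).natAbs) (fun _ _ => Nat.zero_le _) (Finset.mem_univ i)
  rw [Int.abs_eq_natAbs]
  exact_mod_cast this

lemma sum_layer (d : ι → ℤ) :
    ∑ t ∈ Finset.Icc (-(entryBound d : ℤ)) (entryBound d), layer d t = d := by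
  ext i
  rw [Finset.sum_apply]
  exact sum_layerVal_nat _ _ (abs_le_entryBound d i)

/-- The simplex at `v` whose open cone contains `v + d`. -/
def simplexAt (v d : ι → ℤ) : Finset (ι → ℤ) :=
  (Finset.Icc (-(entryBound d : ℤ)) (entryBound d)).image fun t => v + layer d t

lemma add_layer_mem (v d : ι → ℤ) (t : ℤ) : v + layer d t ∈ simplexAt v d := by
  by_cases h : t ∈ Finset.Icc (-(entryBound d : ℤ)) (entryBound d)
  · exact Finset.mem_image_of_mem _ h
  -- Beyond the entry bound a layer is zero, hence equal to layer 0.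
  · refine Finset.mem_image.2 ⟨0, by simp, ?_⟩
    congr 1
    ext i
    have := abs_le.1 (abs_le_entryBound d i)
    rw [Finset.mem_Icc] at h
    unfold layer layerVal
    split_ifs <;> omega

lemma mem_simplexAt {v d w : ι → ℤ} : w ∈ simplexAt v d ↔ ∃ t, w = v + layer d t := by
  refine ⟨fun h => ?_, ?_⟩
  · obtain ⟨t, -, rfl⟩ := Finset.mem_image.1 h
    exact ⟨t, rfl⟩
  · rintro ⟨t, rfl⟩
    exact add_layer_mem v d t

lemma layer_zero (d : ι → ℤ) : layer d 0 = 0 := by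
  ext i
  simp [layer, layerVal]

lemma self_mem_simplexAt (v d : ι → ℤ) : v ∈ simplexAt v d :=
  mem_simplexAt.2 ⟨0, by rw [layer_zero, add_zero]⟩

lemma isSimplex_simplexAt (v d : ι → ℤ) : IsSimplex (simplexAt v d) := by
  intro x hx y hy
  obtain ⟨s, rfl⟩ := mem_simplexAt.1 hx
  obtain ⟨t, rfl⟩ := mem_simplexAt.1 hy
  refine ⟨?_, fun i => ?_⟩
  · rcases layerVal_total s t with h | h
    · exact Or.inl fun i => (Int.add_le_add_iff_left _).2 (h (d i))
    · exact Or.inr fun i => (Int.add_le_add_iff_left _).2 (h (d i))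
  · have := layerVal_sub_le' s t (d i)
    simp only [Pi.add_apply, layer]
    omega

/-- The vector `x - v` is the sum of its layers. Collecting equal layers writes it as a combination
of the vertices minus `v`, each with its positive multiplicity. -/
lemma mem_openCone_simplexAt (v x : ι → ℤ) : x ∈ openCone v (simplexAt v (x - v)) := by
  set d := x - v with hd
  set I := Finset.Icc (-(entryBound d : ℤ)) (entryBound d) with hI
  set φ : ℤ → ι → ℤ := fun t => v + layer d t with hφ
  have h1 : d = ∑ w ∈ I.image φ, (I.filter fun t => φ t = w).card • (w - v) := by
    rw [← Finset.sum_comp (fun w => w - v) φ]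
    simp only [hφ, add_sub_cancel_left]
    exact (sum_layer d).symm
  have hs : simplexAt v d = I.image φ := rfl
  have hv : v ∈ I.image φ := self_mem_simplexAt v d
  -- Coefficients in `openCone` are `c w + 1`, whence the multiplicity minus one.
  refine ⟨fun w => (I.filter fun t => φ t = w).card - 1, ?_⟩
  rw [hs]
  rw [← Finset.add_sum_erase _ _ hv, sub_self, smul_zero, zero_add] at h1
  rw [← sub_eq_iff_eq_add', ← hd]
  refine h1.trans (Finset.sum_congr rfl fun w hw => ?_)
  obtain ⟨t, ht, hw'⟩ := Finset.mem_image.1 (Finset.mem_of_mem_erase hw)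
  have : 0 < (I.filter fun t => φ t = w).card :=
    Finset.card_pos.2 ⟨t, Finset.mem_filter.2 ⟨ht, hw'⟩⟩
  rw [Nat.sub_add_cancel this]

/-- A vertex `w ≥ v` is recovered from `d = x - v` by a threshold. With `t` the sum of the
coefficients of the vertices above `w`, one has `d i ≥ t` exactly where `w i = v i + 1`, so `w = v +
layer d t`. Vertices below `v` are symmetric, with a negative threshold. Uniqueness of coefficients
then excludes further vertices. -/
lemma eq_simplexAt_of_mem_openCone {v x : ι → ℤ} {f : Finset (ι → ℤ)} (hf : IsSimplex f) (hv : v ∈ f)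
    (hx : x ∈ openCone v f) : f = simplexAt v (x - v) := by
  classical
  obtain ⟨c, hc⟩ := hx
  set d := x - v with hd
  have hdi : ∀ i, d i = ∑ w ∈ f.erase v, ((c w : ℤ) + 1) * (w i - v i) := fun i => by
    rw [hd, hc, add_sub_cancel_left, Finset.sum_apply]
    refine Finset.sum_congr rfl fun w _ => ?_
    rw [Pi.smul_apply, nsmul_eq_mul]
    push_cast
    rfl
  have hsub : f ⊆ simplexAt v d := by
    intro w hw
    by_cases hwv : w = v
    · rw [hwv]; exact self_mem_simplexAt v d
    have hw' : w ∈ f.erase v := Finset.mem_erase.2 ⟨hwv, hw⟩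
    rw [mem_simplexAt]
    rcases (hf v hv w hw).1 with h | h
    · set U := (f.erase v).filter (w ≤ ·) with hU
      have hwU : w ∈ U := Finset.mem_filter.2 ⟨hw', le_refl w⟩
      have hUpos : (c w : ℤ) + 1 ≤ ∑ u ∈ U, ((c u : ℤ) + 1) :=
        Finset.single_le_sum (f := fun u => (c u : ℤ) + 1) (fun u _ => by positivity) hwU
      refine ⟨∑ u ∈ U, ((c u : ℤ) + 1), ?_⟩
      ext i
      have h1 := (hf v hv w hw).2 i
      have h2 : v i ≤ w i := h i
      have hrest : ∀ u ∈ (f.erase v).filter (¬ w ≤ ·), u ≤ w := fun u hu => by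
        rw [Finset.mem_filter] at hu
        exact (hf w hw u (Finset.mem_of_mem_erase hu.1)).1.resolve_left hu.2
      have hsplit : d i = ∑ u ∈ U, ((c u : ℤ) + 1) * (u i - v i) +
          ∑ u ∈ (f.erase v).filter (¬ w ≤ ·), ((c u : ℤ) + 1) * (u i - v i) := by
        rw [hdi, Finset.sum_filter_add_sum_filter_not]
      rcases (show w i = v i + 1 ∨ w i = v i by omega) with h3 | h3
      · have e1 : ∑ u ∈ U, ((c u : ℤ) + 1) ≤ ∑ u ∈ U, ((c u : ℤ) + 1) * (u i - v i) :=
          Finset.sum_le_sum fun u hu => by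
            have : w i ≤ u i := (Finset.mem_filter.1 hu).2 i
            nlinarith
        have e2 : 0 ≤ ∑ u ∈ (f.erase v).filter (¬ w ≤ ·), ((c u : ℤ) + 1) * (u i - v i) :=
          Finset.sum_nonneg fun u hu => by
            have h4 := (hf u (Finset.mem_of_mem_erase (Finset.mem_filter.1 hu).1) w hw).2 i
            exact mul_nonneg (by positivity) (by omega)
        simp only [Pi.add_apply, layer, layerVal]
        rw [if_pos (by constructor <;> linarith), h3]
      · have e1 : ∑ u ∈ U, ((c u : ℤ) + 1) * (u i - v i) < ∑ u ∈ U, ((c u : ℤ) + 1) := by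
          refine Finset.sum_lt_sum (fun u hu => ?_) ⟨w, hwU, ?_⟩
          · have := (hf v hv u (Finset.mem_of_mem_erase (Finset.mem_filter.1 hu).1)).2 i
            nlinarith
          · rw [h3, sub_self, mul_zero]; positivity
        have e2 : ∑ u ∈ (f.erase v).filter (¬ w ≤ ·), ((c u : ℤ) + 1) * (u i - v i) ≤ 0 :=
          Finset.sum_nonpos fun u hu => by
            have h4 : u i ≤ w i := hrest u hu i
            exact mul_nonpos_of_nonneg_of_nonpos (by positivity) (by omega)
        simp only [Pi.add_apply, layer, layerVal]
        rw [if_neg (by rintro ⟨_, h⟩; linarith), if_neg (by rintro ⟨h, _⟩; linarith [hUpos]), h3,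
          add_zero]
    · set U := (f.erase v).filter (· ≤ w) with hU
      have hwU : w ∈ U := Finset.mem_filter.2 ⟨hw', le_refl w⟩
      have hUpos : (c w : ℤ) + 1 ≤ ∑ u ∈ U, ((c u : ℤ) + 1) :=
        Finset.single_le_sum (f := fun u => (c u : ℤ) + 1) (fun u _ => by positivity) hwU
      refine ⟨-∑ u ∈ U, ((c u : ℤ) + 1), ?_⟩
      ext i
      have h1 := (hf w hw v hv).2 i
      have h2 : w i ≤ v i := h i
      have hrest : ∀ u ∈ (f.erase v).filter (¬ · ≤ w), w ≤ u := fun u hu => by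
        rw [Finset.mem_filter] at hu
        exact (hf u (Finset.mem_of_mem_erase hu.1) w hw).1.resolve_left hu.2
      have hsplit : d i = ∑ u ∈ U, ((c u : ℤ) + 1) * (u i - v i) +
          ∑ u ∈ (f.erase v).filter (¬ · ≤ w), ((c u : ℤ) + 1) * (u i - v i) := by
        rw [hdi, Finset.sum_filter_add_sum_filter_not]
      rcases (show w i = v i - 1 ∨ w i = v i by omega) with h3 | h3
      · have e1 : ∑ u ∈ U, ((c u : ℤ) + 1) * (u i - v i) ≤ ∑ u ∈ U, -((c u : ℤ) + 1) :=
          Finset.sum_le_sum fun u hu => by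
            have : u i ≤ w i := (Finset.mem_filter.1 hu).2 i
            nlinarith
        have e2 : ∑ u ∈ (f.erase v).filter (¬ · ≤ w), ((c u : ℤ) + 1) * (u i - v i) ≤ 0 :=
          Finset.sum_nonpos fun u hu => by
            have h4 := (hf w hw u (Finset.mem_of_mem_erase (Finset.mem_filter.1 hu).1)).2 i
            exact mul_nonpos_of_nonneg_of_nonpos (by positivity) (by omega)
        rw [Finset.sum_neg_distrib] at e1
        simp only [Pi.add_apply, layer, layerVal]
        rw [if_neg (by rintro ⟨h, _⟩; linarith), if_pos (by constructor <;> linarith), h3]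
        ring
      · have e1 : ∑ u ∈ U, -((c u : ℤ) + 1) < ∑ u ∈ U, ((c u : ℤ) + 1) * (u i - v i) := by
          refine Finset.sum_lt_sum (fun u hu => ?_) ⟨w, hwU, ?_⟩
          · have := (hf u (Finset.mem_of_mem_erase (Finset.mem_filter.1 hu).1) v hv).2 i
            nlinarith
          · rw [h3, sub_self, mul_zero]; linarith
        have e2 : 0 ≤ ∑ u ∈ (f.erase v).filter (¬ · ≤ w), ((c u : ℤ) + 1) * (u i - v i) :=
          Finset.sum_nonneg fun u hu => by
            have h4 : w i ≤ u i := hrest u hu i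
            exact mul_nonneg (by positivity) (by omega)
        rw [Finset.sum_neg_distrib] at e1
        simp only [Pi.add_apply, layer, layerVal]
        rw [if_neg (by rintro ⟨h, _⟩; linarith), if_neg (by rintro ⟨_, h⟩; linarith [hUpos]), h3,
          add_zero]
  -- A vertex of `simplexAt v d` outside `f` would have a positive coefficient in the difference of
  -- the two expansions of `x`, against linear independence.
  refine hsub.antisymm fun w hw => ?_
  by_contra hwf
  have hwv : w ≠ v := fun h => hwf (h ▸ hv)
  obtain ⟨c', hc'⟩ := mem_openCone_simplexAt v x
  have e : ∑ w ∈ (simplexAt v d).erase v,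
      ((c' w : ℤ) + 1 - if w ∈ f then (c w : ℤ) + 1 else 0) • (w - v) = 0 := by
    simp only [sub_smul, Finset.sum_sub_distrib, ite_smul, zero_smul]
    rw [sub_eq_zero, ← Finset.sum_filter,
      show ((simplexAt v d).erase v).filter (· ∈ f) = f.erase v by
        ext w
        simp only [Finset.mem_filter, Finset.mem_erase]
        exact ⟨fun h => ⟨h.1.1, h.2⟩, fun h => ⟨⟨h.1, hsub h.2⟩, h.2⟩⟩]
    have := hc'.symm.trans hc
    have := add_left_cancel this
    simpa only [← natCast_zsmul, Nat.cast_add, Nat.cast_one] using this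
  have := (isSimplex_simplexAt v d).linearIndependent (self_mem_simplexAt v d) _ e w
    (Finset.mem_erase.2 ⟨hwv, hw⟩)
  rw [if_neg hwf] at this
  omega

/-- A coordinate of a vector, or zero. -/
def coord (o : Option ι) (d : ι → ℤ) : ℤ := o.elim 0 d

lemma coord_layer (o : Option ι) (d : ι → ℤ) (t : ℤ) :
    coord o (layer d t) = layerVal t (coord o d) := by
  cases o with
  | none => exact (layerVal_zero t).symm
  | some i => rfl

lemma coord_add (o : Option ι) (d e : ι → ℤ) : coord o (d + e) = coord o d + coord o e := by
  cases o <;> rfl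

lemma coord_sub (o : Option ι) (d e : ι → ℤ) : coord o (d - e) = coord o d - coord o e := by
  cases o <;> rfl

lemma coord_sum {κ : Type*} (o : Option ι) (s : Finset κ) (d : κ → ι → ℤ) :
    coord o (∑ k ∈ s, d k) = ∑ k ∈ s, coord o (d k) := by
  cases o with
  | none => simp [coord]
  | some i => simp [coord, Finset.sum_apply]

/-- The polytope-tangent set at `v`: the constraints that are tight at `v`. -/
def tangentSet {𝒞 : Type*} (i j : 𝒞 → Option ι) (b : 𝒞 → ℤ) (v : ι → ℤ) : Set (ι → ℤ) :=
  {x | ∀ c, coord (i c) v - coord (j c) v = b c → coord (i c) x - coord (j c) x ≤ b c}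

/-- This is where the form of the inequalities matters. A layer changes a difference of two
coordinates by at most 1, so it respects the inequalities that are strict at `v`, their slack being
a positive integer. For a tight inequality, taking layers is monotone, and conversely summing the
layers gives back `x - v`. -/
lemma simplexAt_subset_iff {𝒞 : Type*} {i j : 𝒞 → Option ι} {b : 𝒞 → ℤ} {P : Finset (ι → ℤ)}
    (hP : ∀ x, x ∈ P ↔ ∀ c, coord (i c) x - coord (j c) x ≤ b c) {v : ι → ℤ} (hv : v ∈ P)
    (x : ι → ℤ) : simplexAt v (x - v) ⊆ P ↔ x ∈ tangentSet i j b v := by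
  constructor
  · intro h c hc
    have hl : ∀ t, coord (i c) (layer (x - v) t) - coord (j c) (layer (x - v) t) ≤ 0 := fun t => by
      have := (hP _).1 (h (add_layer_mem v (x - v) t)) c
      rw [coord_add, coord_add] at this
      linarith
    have := Finset.sum_nonpos fun t (_ : t ∈ Finset.Icc (-(entryBound (x - v) : ℤ))
      (entryBound (x - v))) => hl t
    rw [Finset.sum_sub_distrib, ← coord_sum, ← coord_sum, sum_layer, coord_sub, coord_sub] at this
    linarith
  · intro h w hw
    obtain ⟨t, rfl⟩ := mem_simplexAt.1 hw
    rw [hP]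
    intro c
    rw [coord_add, coord_add, coord_layer, coord_layer]
    rcases ((hP v).1 hv c).lt_or_eq with h1 | h1
    · linarith [layerVal_sub_le t (coord (i c) (x - v)) (coord (j c) (x - v))]
    · have h2 := h c h1
      have h3 := layerVal_mono t (show coord (i c) (x - v) ≤ coord (j c) (x - v) by
        rw [coord_sub, coord_sub]; linarith)
      linarith

open Classical in
/-- The specialised sum over the tangent cone at `v` of the union of the simplices in `P`. -/
def tangentSum (st : (ι → ℤ) →+ Weight n) (P : Finset (ι → ℤ)) (v : ι → ℤ) : RatZ n :=
  ∑ f ∈ P.powerset.filter fun f => IsSimplex f ∧ v ∈ f, openConeSum st v f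

/-- Every point `x` of the tangent set lies in the open cone of exactly one simplex inside `P`,
namely `simplexAt v (x - v)`. -/
lemma tangentSum_hasPhi {𝒞 : Type*} {i j : 𝒞 → Option ι} {b : 𝒞 → ℤ} {P : Finset (ι → ℤ)}
    (hP : ∀ x, x ∈ P ↔ ∀ c, coord (i c) x - coord (j c) x ≤ b c)
    (hst : ∀ x : ι → ℤ, 0 ≤ x → x ≠ 0 → st x ≠ 0) {v : ι → ℤ} (hv : v ∈ P) :
    HasPhi st ((tangentSet i j b v).indicator 1) (tangentSum st P v) := by
  classical
  have h := HasPhi.sum (st := st) (P.powerset.filter fun f => IsSimplex f ∧ v ∈ f)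
    (F := fun f => (openCone v f).indicator 1) (f := fun f => openConeSum st v f)
    (fun f hf => (Finset.mem_filter.1 hf).2.1.hasPhi hst (Finset.mem_filter.1 hf).2.2)
  have e : tangentSum st P v =
      ∑ f ∈ P.powerset.filter fun f => IsSimplex f ∧ v ∈ f, openConeSum st v f := by
    unfold tangentSum
    congr!
  rw [e]
  convert h using 1
  ext x
  rw [Finset.sum_apply]
  have hout : ∀ f ∈ P.powerset.filter (fun f => IsSimplex f ∧ v ∈ f), f ≠ simplexAt v (x - v) →
      (openCone v f).indicator (1 : (ι → ℤ) → ℂ) x = 0 := fun f hf hne => by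
    obtain ⟨-, h1, h2⟩ := Finset.mem_filter.1 hf
    exact Set.indicator_of_notMem (fun hx => hne (eq_simplexAt_of_mem_openCone h1 h2 hx)) _
  by_cases hx : x ∈ tangentSet i j b v
  · rw [Finset.sum_eq_single_of_mem (simplexAt v (x - v)) _ hout,
      Set.indicator_of_mem hx, Set.indicator_of_mem (mem_openCone_simplexAt v x)]
    exact Finset.mem_filter.2 ⟨Finset.mem_powerset.2 ((simplexAt_subset_iff hP hv x).2 hx),
      isSimplex_simplexAt _ _, self_mem_simplexAt _ _⟩
  · rw [Set.indicator_of_notMem hx]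
    refine (Finset.sum_eq_zero fun f hf => hout f hf ?_).symm
    rintro rfl
    exact hx ((simplexAt_subset_iff hP hv x).1
      (Finset.mem_powerset.1 (Finset.mem_filter.1 hf).1))

/-- The sum is the coefficient of degree `s.card - 1 ≥ 1` of the interpolation polynomial of the
constant 1 at the nodes `X v`. -/
lemma sum_prod_inv_sub {F κ : Type*} [Field F] [DecidableEq κ] (s : Finset κ) (X : κ → F)
    (hX : Set.InjOn X s) (hs : 2 ≤ s.card) : ∑ v ∈ s, ∏ w ∈ s.erase v, (X v - X w)⁻¹ = 0 := by
  have h := Lagrange.coeff_eq_sum (P := 1) hX (by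
    rw [Polynomial.degree_one]; exact_mod_cast (by omega : 0 < s.card))
  rw [Polynomial.coeff_one, if_neg (by omega)] at h
  rw [h]
  refine Finset.sum_congr rfl fun v _ => ?_
  rw [Polynomial.eval_one, one_div, Finset.prod_inv_distrib]

/-- Clearing the denominators of `ex (st (w - v))` turns each contribution into the product of all
`ex (st w)`, common to all `v`, times the term of `sum_prod_inv_sub` with nodes `ex (st w)`. -/
lemma IsSimplex.sum_openConeSum {f : Finset (ι → ℤ)} (hf : IsSimplex f)
    (hst : ∀ x : ι → ℤ, 0 ≤ x → x ≠ 0 → st x ≠ 0) (hc : 2 ≤ f.card) :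
    ∑ v ∈ f, openConeSum st v f = 0 := by
  have hinj : Set.InjOn (fun w => ex (st w)) f := fun v hv w hw h => by
    by_contra hne
    apply hf.weight_ne hst hw hv hne
    rw [map_sub, sub_eq_zero]
    exact ex_injective h
  have h : ∀ v ∈ f, openConeSum st v f =
      (∏ w ∈ f, ex (st w)) * ∏ w ∈ f.erase v, (ex (st v) - ex (st w))⁻¹ := fun v hv => by
    rw [openConeSum, ← Finset.mul_prod_erase _ _ hv, mul_assoc, ← Finset.prod_mul_distrib]
    congr 1
    refine Finset.prod_congr rfl fun w hw => ?_
    have h0 := ex_ne_zero (st v)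
    have h1 : ex (st v) - ex (st w) ≠ 0 := sub_ne_zero.2 fun h =>
      Finset.ne_of_mem_erase hw (hinj hv (Finset.mem_of_mem_erase hw) h).symm
    have h2 : ex (st (w - v)) = ex (st w) / ex (st v) := by
      rw [eq_div_iff h0, ← ex_add, ← map_add, sub_add_cancel]
    have h3 : 1 - ex (st (w - v)) = (ex (st v) - ex (st w)) / ex (st v) := by
      rw [h2]; field_simp
    rw [h3, h2]
    field_simp
  rw [Finset.sum_congr rfl h, ← Finset.mul_sum, sum_prod_inv_sub f _ hinj hc, mul_zero]

/-- Brion's formula, as a sum over all lattice points. -/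
lemma sum_tangentSum (P : Finset (ι → ℤ))
    (hst : ∀ x : ι → ℤ, 0 ≤ x → x ≠ 0 → st x ≠ 0) :
    ∑ v ∈ P, tangentSum st P v = ∑ v ∈ P, ex (st v) := by
  classical
  have h1 : ∑ v ∈ P, tangentSum st P v =
      ∑ f ∈ P.powerset.filter IsSimplex, ∑ v ∈ f, openConeSum st v f := by
    unfold tangentSum
    refine Finset.sum_comm' fun v f => ?_
    simp only [Finset.mem_filter, Finset.mem_powerset]
    exact ⟨fun h => ⟨h.2.2.2, h.2.1, h.2.2.1⟩, fun h => ⟨h.2.1 h.1, h.2.1, h.2.2, h.1⟩⟩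
  have hs : P.image (fun v => ({v} : Finset (ι → ℤ))) ⊆ P.powerset.filter IsSimplex := by
    intro f hf
    obtain ⟨v, hv, rfl⟩ := Finset.mem_image.1 hf
    refine Finset.mem_filter.2 ⟨by simpa using hv, fun x hx y hy => ?_⟩
    rw [Finset.mem_singleton.1 hx, Finset.mem_singleton.1 hy]
    simp
  -- After grouping by simplices only the singletons survive.
  rw [h1, ← Finset.sum_subset hs, Finset.sum_image fun v _ w _ h => Finset.singleton_injective h]
  · refine Finset.sum_congr rfl fun v _ => ?_
    rw [Finset.sum_singleton, openConeSum, Finset.erase_singleton, Finset.prod_empty, mul_one]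
  · intro f hf hf'
    obtain ⟨h2, h3⟩ := Finset.mem_filter.1 hf
    rcases Nat.lt_or_ge f.card 2 with h | h
    · rcases f.eq_empty_or_nonempty with rfl | hne
      · simp
      · obtain ⟨v, rfl⟩ := Finset.card_eq_one.1 (show f.card = 1 by
          have := hne.card_pos; omega)
        exact absurd (Finset.mem_image.2 ⟨v, by simpa using h2, rfl⟩) hf'
    · exact h3.sum_openConeSum hst h

end Brion

end InfBrion

end

noncomputable section

namespace InfBrion

/-! ### Interlacing patterns -/

/-- The position and the level determine the block of a node. -/
def blockKey (n : ℕ) (k v p : ℤ) : ℤ × ℤ := (v % k, p - (n - 1) * (v / k))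

lemma blockKey_eq_iff {n : ℕ} {k v p v' p' : ℤ} (hk : 0 < k) :
    blockKey n k v p = blockKey n k v' p' ↔ ∃ t : ℤ, v = v' + k * t ∧ p = p' + (n - 1) * t := by
  unfold blockKey
  rw [Prod.mk.injEq]
  constructor
  · rintro ⟨h1, h2⟩
    refine ⟨v / k - v' / k, ?_, by linear_combination h2⟩
    have e1 := Int.mul_ediv_add_emod v k
    have e2 := Int.mul_ediv_add_emod v' k
    linear_combination e2 - e1 + h1
  · rintro ⟨t, rfl, rfl⟩
    rw [Int.add_mul_emod_self_left, Int.add_mul_ediv_left _ _ hk.ne']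
    exact ⟨rfl, by ring⟩

/-- The inequalities satisfied by the extended sequence of partial sums of a lattice point of the
polytope; the terms before the `n`-th one are fixed. -/
structure IsPattern (n N : ℕ) (k : ℤ) (y : ℕ → ℤ) : Prop where
  two_le : 2 ≤ n
  pos : 0 < k
  base : ∀ P, P + 1 < n → y P < y (P + 1)
  wrap : y (n - 1) < y 0 + k
  mono : ∀ P, n ≤ P + 1 → y P ≤ y (P + 1)
  win : ∀ P, y (P + n) ≤ y P + k
  slack : y (N + 1) < y (N + 1 - n) + k

section Pattern

variable {n N : ℕ} {k : ℤ} {y : ℕ → ℤ}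

/-- The block of a node. -/
def nodeKey (n : ℕ) (k : ℤ) (y : ℕ → ℤ) (P : ℕ) : ℤ × ℤ := blockKey n k (y P) P

namespace IsPattern

variable (hy : IsPattern n N k y)
include hy

lemma le_succ (P : ℕ) : y P ≤ y (P + 1) := by
  rcases Nat.lt_or_ge (P + 1) n with h | h
  · exact (hy.base P h).le
  · exact hy.mono P h

/-- A window of length `n` starting one node earlier gives the bound, by monotonicity; at the first
node `wrap` takes its place. -/
lemma row (P : ℕ) : y (P + (n - 1)) ≤ y P + k := by
  have h2 := hy.two_le
  rcases P with _ | P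
  · rw [zero_add]; exact hy.wrap.le
  · have h := hy.win P
    have h1 := hy.le_succ P
    rw [show P + 1 + (n - 1) = P + n by omega]
    linarith

lemma row_mul (P t : ℕ) : y (P + (n - 1) * t) ≤ y P + k * t := by
  induction t with
  | zero => simp
  | succ t ih =>
    have := hy.row (P + (n - 1) * t)
    rw [Nat.mul_succ, ← add_assoc]
    push_cast
    linarith

/-- The last of the `t` steps is a full window of length `n`, which gains one position over
`row_mul`. -/
lemma diag (P t : ℕ) (ht : 1 ≤ t) : y (P + (n - 1) * t + 1) ≤ y P + k * t := by
  obtain ⟨t, rfl⟩ : ∃ s, t = s + 1 := ⟨t - 1, by omega⟩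
  have h2 := hy.two_le
  have h := hy.win (P + (n - 1) * t)
  have h1 := hy.row_mul P t
  rw [show P + (n - 1) * (t + 1) + 1 = P + (n - 1) * t + n by rw [Nat.mul_succ]; omega]
  push_cast
  linarith

lemma exists_mul_of_blockKey_eq {v v' : ℤ} {i j : ℕ} (hij : i < j)
    (h : blockKey n k v j = blockKey n k v' i) :
    ∃ t : ℕ, 1 ≤ t ∧ v = v' + k * t ∧ j = i + (n - 1) * t := by
  obtain ⟨t, h1, h2⟩ := (blockKey_eq_iff hy.pos).1 h
  have hn : ((n - 1 : ℕ) : ℤ) = n - 1 := by have := hy.two_le; omega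
  have ht : 0 < t := by
    by_contra! ht
    have : ((n : ℤ) - 1) * t ≤ 0 :=
      mul_nonpos_of_nonneg_of_nonpos (by have := hy.two_le; omega) ht
    omega
  lift t to ℕ using ht.le
  refine ⟨t, by omega, h1, ?_⟩
  zify
  rw [hn, h2]

/-- Two nodes of a block are joined by a chain of nodes in that block. -/
lemma of_nodeKey_eq {i j : ℕ} (hij : i < j) (h : nodeKey n k y j = nodeKey n k y i) :
    ∃ Q, i ≤ Q ∧ j = Q + (n - 1) ∧ y j = y Q + k ∧ y (j + 1) = y j ∧
      nodeKey n k y Q = nodeKey n k y i := by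
  obtain ⟨t, ht, h1, h2⟩ := hy.exists_mul_of_blockKey_eq hij h
  obtain ⟨t, rfl⟩ : ∃ s, t = s + 1 := ⟨t - 1, by omega⟩
  -- Being in one block means `y j = y i + k (t + 1)`, the largest value these bounds allow; so all
  -- of them are equalities, including the one for `j + 1`.
  have h3 := hy.row_mul i t
  have h4 := hy.row (i + (n - 1) * t)
  have h5 := hy.diag i (t + 1) (by omega)
  have h6 := hy.le_succ j
  have hj : j = i + (n - 1) * t + (n - 1) := by rw [h2]; ring
  rw [← hj] at h4
  rw [← h2] at h5
  push_cast at h1 h5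
  refine ⟨i + (n - 1) * t, Nat.le_add_right _ _, hj, by linarith, by linarith, ?_⟩
  refine (blockKey_eq_iff hy.pos).2 ⟨t, by linarith, ?_⟩
  have := hy.two_le
  push_cast [Nat.cast_sub (by omega : 1 ≤ n)]
  ring

/-- A later node `j` of a block ends with a tight window at `j + 1`, and `slack` excludes this for
`j = N`. Hence the last node, whose weight has an exceptional form, shares its block with no earlier
node. -/
lemma lt_of_nodeKey_eq {i j : ℕ} (hij : i < j) (hj : j ≤ N) (h : nodeKey n k y j = nodeKey n k y i) :
    j < N := by
  obtain ⟨Q, -, h1, h2, h3, -⟩ := hy.of_nodeKey_eq hij h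
  have h2' := hy.two_le
  refine lt_of_le_of_ne hj fun hN => ?_
  have h4 := hy.slack
  rw [← hN, show j + 1 - n = Q by omega] at h4
  linarith

/-- From a base node the first step by `n - 1` positions is strictly less than `k`, so the chain to
a later node of its block cannot be tight. -/
lemma not_base_of_nodeKey_eq {i j : ℕ} (hij : i < j) (h : nodeKey n k y j = nodeKey n k y i) :
    n ≤ i := by
  by_contra! hi
  obtain ⟨t, ht, h1, h2⟩ := hy.exists_mul_of_blockKey_eq hij h
  obtain ⟨t, rfl⟩ : ∃ s, t = s + 1 := ⟨t - 1, by omega⟩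
  have h2n := hy.two_le
  have h4 : y (i + (n - 1)) < y i + k := by
    rcases i with _ | i
    · rw [zero_add]; exact hy.wrap
    · have h := hy.win i
      have h1 := hy.base i hi
      rw [show i + 1 + (n - 1) = i + n by omega]
      linarith
  have h3 := hy.row_mul (i + (n - 1)) t
  rw [show i + (n - 1) + (n - 1) * t = j by rw [h2]; ring] at h3
  push_cast at h1
  linarith

/-- A node with an inhabited previous block has a lower neighbour. -/
lemma exists_lower {a b : ℕ} (ha : n ≤ a) (h : nodeKey n k y b = blockKey n k (y a) (a - 1)) :
    y (a - 1) = y a ∨ y a = y (a - n) + k := by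
  have h2n := hy.two_le
  have ha1 := hy.le_succ (a - 1)
  rw [show a - 1 + 1 = a by omega] at ha1
  have han := hy.win (a - n)
  rw [Nat.sub_add_cancel ha] at han
  have hcast : ((a : ℤ) - 1) = ((a - 1 : ℕ) : ℤ) := by omega
  rw [hcast] at h
  -- If `b` is at or after `a - 1`, the row bound forces `y (a - 1) = y a`. If `b` is before, the
  -- chain from `b` passes through `a - n`, and the window from `a - n` to `a` is tight.
  rcases lt_trichotomy (a - 1) b with hb | hb | hb
  · obtain ⟨t, ht, h1, h2⟩ := hy.exists_mul_of_blockKey_eq hb h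
    have h3 := hy.row_mul (a - 1) t
    rw [← h2, h1] at h3
    left; linarith
  · obtain ⟨t, h1, h2⟩ := (blockKey_eq_iff hy.pos).1 h
    have : ((n : ℤ) - 1) * t = 0 := by omega
    rcases mul_eq_zero.1 this with h3 | h3
    · omega
    · rw [h3, mul_zero, add_zero] at h1
      left; rw [hb, h1]
  · obtain ⟨t, ht, h1, h2⟩ := hy.exists_mul_of_blockKey_eq hb h.symm
    obtain ⟨t, rfl⟩ : ∃ s, t = s + 1 := ⟨t - 1, by omega⟩
    have h3 := hy.row_mul b t
    rw [show b + (n - 1) * t = a - n by rw [Nat.mul_succ] at h2; omega] at h3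
    push_cast at h1
    right; linarith

end IsPattern

/-- Every block is a singleton and every free node has a lower neighbour. -/
def IsRegularPattern (n N : ℕ) (k : ℤ) (y : ℕ → ℤ) : Prop :=
  (∀ i j, i < j → j ≤ N → nodeKey n k y j ≠ nodeKey n k y i) ∧
    ∀ a, n ≤ a → a ≤ N → y (a - 1) = y a ∨ y a = y (a - n) + k

/-- The inequalities of the tangent cone, in coordinates shifted so that the ones between the nodes
`a - n` and `a` become strict. -/
def IsInterlacing (n N : ℕ) (k : ℤ) (y z : ℕ → ℤ) : Prop :=
  ∀ a, n ≤ a → a ≤ N → (y (a - 1) = y a → z (a - 1) ≤ z a) ∧ (y a = y (a - n) + k → z a < z (a - n))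

/-- Strict monotonicity in the blocks. -/
def IsBlockSorted (n N : ℕ) (k : ℤ) (y z : ℕ → ℤ) : Prop :=
  ∀ i j, i < j → j ≤ N → nodeKey n k y j = nodeKey n k y i → z j < z i

/-- By `of_nodeKey_eq` the node `j` and its predecessor `Q` in the block are tied through `j + 1`:
`z j ≤ z (j + 1) < z Q`. Induction descends along the block. -/
lemma IsInterlacing.sorted (hy : IsPattern n N k y) {z : ℕ → ℤ} (hz : IsInterlacing n N k y z) :
    IsBlockSorted n N k y z := by
  intro i j
  induction j using Nat.strong_induction_on with
  | _ j ih =>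
  intro hij hjN h
  have h2n := hy.two_le
  have hlt := hy.lt_of_nodeKey_eq hij hjN h
  obtain ⟨Q, hiQ, h1, h2, h3, h4⟩ := hy.of_nodeKey_eq hij h
  have h5 := hz (j + 1) (by omega) (by omega)
  rw [Nat.add_sub_cancel, show j + 1 - n = Q by omega] at h5
  have h6 := h5.1 h3.symm
  have h7 := h5.2 (by rw [h3, h2])
  rcases hiQ.eq_or_lt with rfl | hiQ
  · omega
  · have := ih Q (by omega) hiQ (by omega) h4
    omega

/-! The determinant. Its rows and columns are indexed by the links: a link joins a node to its
successor if these have the same level, and to nothing otherwise. -/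

/-- The links between the nodes up to `N`. -/
abbrev Link (n N : ℕ) (y : ℕ → ℤ) : Type :=
  Fin (N + 1) ⊕ {a : Fin (N + 1) // n ≤ (a : ℕ) ∧ y (a - 1) < y a}

namespace Link

/-- The position of a link. -/
def pos : Link n N y → ℕ
  | Sum.inl P => P
  | Sum.inr a => a.1 - 1

/-- The level of a link. -/
def level : Link n N y → ℤ
  | Sum.inl P => y P
  | Sum.inr a => y a.1

/-- The lower node of a link. -/
def lower : Link n N y → Option ℕ
  | Sum.inl P => some P
  | Sum.inr _ => none

/-- The upper node of a link. -/
def upper : Link n N y → Option ℕ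
  | Sum.inl P => if n ≤ (P : ℕ) + 1 ∧ (P : ℕ) + 1 ≤ N ∧ y (P + 1) = y P then some (P + 1) else none
  | Sum.inr a => some a.1

/-- The block of the lower node of a link. -/
def key (k : ℤ) (l : Link n N y) : ℤ × ℤ := blockKey n k l.level l.pos

/-- An injective numbering of the links. -/
def number : Link n N y → ℕ
  | Sum.inl P => 2 * P
  | Sum.inr a => 2 * (a.1 - 1) + 1

lemma number_injective (hn : 2 ≤ n) : Function.Injective (number : Link n N y → ℕ) := by
  intro l l' h
  rcases l with P | a <;> rcases l' with Q | b <;> simp only [number] at h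
  · congr 1; exact Fin.ext (by omega)
  · omega
  · omega
  · have ha := a.2.1
    have hb := b.2.1
    congr 1; exact Subtype.ext (Fin.ext (by omega))

lemma number_lt {l l' : Link n N y} (h : number l' < number l) : l'.pos ≤ l.pos := by
  rcases l with P | a <;> rcases l' with Q | b <;> simp only [number, pos] at h ⊢ <;> omega

lemma lower_eq_some {l : Link n N y} {b : ℕ} (h : l.lower = some b) :
    b = l.pos ∧ l.level = y b ∧ b ≤ N ∧ ∃ h, l = Sum.inl ⟨b, h⟩ := by
  rcases l with P | a
  · obtain rfl : (P : ℕ) = b := by simpa [lower] using h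
    exact ⟨rfl, rfl, by omega, P.2, rfl⟩
  · simp [lower] at h

lemma upper_eq_some (hn : 2 ≤ n) {l : Link n N y} {a : ℕ} (h : l.upper = some a) :
    a = l.pos + 1 ∧ l.level = y a ∧ n ≤ a ∧ a ≤ N := by
  rcases l with P | b
  · simp only [upper] at h
    split_ifs at h with h1
    obtain rfl : (P : ℕ) + 1 = a := by simpa using h
    exact ⟨rfl, h1.2.2.symm, h1.1, h1.2.1⟩
  · obtain rfl : (b.1 : ℕ) = a := by simpa [upper] using h
    have := b.2.1
    exact ⟨by simp only [pos]; omega, rfl, this, by omega⟩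

end Link

end Pattern

end InfBrion

end

noncomputable section

namespace InfBrion

/-! ### The 0/1 determinant of a pattern and interlacing. -/

section Pattern

variable {n N : ℕ} {k : ℤ} {y : ℕ → ℤ}

namespace Link

lemma pos_le (l : Link n N y) : l.pos ≤ N := by
  rcases l with P | a <;> simp only [pos] <;> omega

lemma le_level (l : Link n N y) : y l.pos ≤ l.level := by
  rcases l with P | a
  · exact le_refl _
  · exact a.2.2.le

lemma level_le (hy : IsPattern n N k y) (l : Link n N y) : l.level ≤ y (l.pos + 1) := by
  have hn := hy.two_le
  rcases l with P | a
  · exact hy.le_succ P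
  · have := a.2.1
    simp only [level, pos]
    rw [show (a.1 : ℕ) - 1 + 1 = a.1 by omega]

lemma lower_eq {l : Link n N y} (h : l.level = y l.pos) : l.lower = some l.pos := by
  rcases l with P | a
  · rfl
  · exact absurd h a.2.2.ne'

lemma upper_eq (hn : 2 ≤ n) {l : Link n N y} (h : l.level = y (l.pos + 1)) (h1 : n ≤ l.pos + 1)
    (h2 : l.pos + 1 ≤ N) : l.upper = some (l.pos + 1) := by
  rcases l with P | a
  · simp only [upper, pos] at *
    rw [if_pos ⟨h1, h2, h.symm⟩]
  · have := a.2.1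
    simp only [upper, pos]
    rw [show (a.1 : ℕ) - 1 + 1 = a.1 by omega]

/-- Two links of a block at different positions. -/
lemma of_key_eq (hy : IsPattern n N k y) {l l' : Link n N y} (h : l.key k = l'.key k)
    (hlt : l'.pos < l.pos) : l'.lower = some l'.pos ∧ l.upper = some (l.pos + 1) ∧
      ∃ Q, Q + n = l.pos + 1 ∧ y (l.pos + 1) = y Q + k ∧ l'.pos ≤ Q ∧
        nodeKey n k y Q = nodeKey n k y l'.pos := by
  have hn := hy.two_le
  obtain ⟨t, ht, h1, h2⟩ := hy.exists_mul_of_blockKey_eq hlt h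
  have h3 := hy.diag l'.pos t ht
  rw [← h2] at h3
  have h4 := l.level_le hy
  have h5 := l'.le_level
  have h6 := l.pos_le
  obtain ⟨t, rfl⟩ : ∃ s, t = s + 1 := ⟨t - 1, by omega⟩
  have h7 := hy.row_mul l'.pos t
  have hQ : l'.pos + (n - 1) * t + n = l.pos + 1 := by rw [h2, Nat.mul_succ]; omega
  have h8 := hy.win (l'.pos + (n - 1) * t)
  rw [hQ] at h8
  push_cast at h1 h3
  -- Otherwise the window ending at `N + 1` would be tight.
  have h9 : l.pos + 1 ≤ N := by
    by_contra hN
    have hN : l.pos = N := by omega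
    have := hy.slack
    rw [← hN, show l.pos + 1 - n = l'.pos + (n - 1) * t by omega] at this
    linarith
  refine ⟨lower_eq (by linarith), upper_eq hn (by linarith) (by omega) h9,
    l'.pos + (n - 1) * t, hQ, by linarith, Nat.le_add_right _ _, ?_⟩
  refine (blockKey_eq_iff hy.pos).2 ⟨t, by linarith, ?_⟩
  push_cast [Nat.cast_sub (by omega : 1 ≤ n)]
  ring

lemma eq_of_key_eq (hy : IsPattern n N k y) {l l' : Link n N y} (h : l.key k = l'.key k)
    (hp : l.pos = l'.pos) : l = l' := by
  have hn := hy.two_le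
  have hl : l.level = l'.level := by
    obtain ⟨t, h1, h2⟩ := (blockKey_eq_iff hy.pos).1 h
    have : ((n : ℤ) - 1) * t = 0 := by omega
    rcases mul_eq_zero.1 this with h3 | h3
    · omega
    · rw [h1, h3]; ring
  rcases l with P | a <;> rcases l' with Q | b <;> simp only [pos, level] at hp hl
  · congr 1; exact Fin.ext hp
  · exact absurd hl (by rw [hp]; exact b.2.2.ne)
  · exact absurd hl (by rw [← hp]; exact a.2.2.ne')
  · have ha := a.2.1
    have hb := b.2.1
    congr 1; exact Subtype.ext (Fin.ext (by omega))

end Link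

open Classical in
/-- The matrix of the order relations between the ends of links in the same block. -/
def linkMatrix (n N : ℕ) (k : ℤ) (y z : ℕ → ℤ) : Matrix (Link n N y) (Link n N y) ℂ := fun l l' =>
  if l.key k = l'.key k ∧ ∀ a ∈ l.upper, ∀ b ∈ l'.lower, z b ≤ z a then 1 else 0

lemma linkMatrix_eq_one {z : ℕ → ℤ} {l l' : Link n N y} (h : l.key k = l'.key k)
    (h' : ∀ a ∈ l.upper, ∀ b ∈ l'.lower, z b ≤ z a) : linkMatrix n N k y z l l' = 1 := by
  rw [linkMatrix, if_pos ⟨h, h'⟩]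

lemma linkMatrix_ne_zero {z : ℕ → ℤ} {l l' : Link n N y} : linkMatrix n N k y z l l' ≠ 0 ↔
    l.key k = l'.key k ∧ ∀ a ∈ l.upper, ∀ b ∈ l'.lower, z b ≤ z a := by
  unfold linkMatrix
  split_ifs with h
  · simpa using h
  · simpa using h

lemma linkMatrix_eq_of_iff {z z' : ℕ → ℤ} {l l' m m' : Link n N y}
    (h : linkMatrix n N k y z l l' ≠ 0 ↔ linkMatrix n N k y z' m m' ≠ 0) :
    linkMatrix n N k y z l l' = linkMatrix n N k y z' m m' := by
  rw [linkMatrix_ne_zero, linkMatrix_ne_zero] at h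
  unfold linkMatrix
  rw [if_congr h rfl rfl]

lemma linkMatrix_eq_zero {z : ℕ → ℤ} {l l' : Link n N y}
    (h : ¬ (l.key k = l'.key k ∧ ∀ a ∈ l.upper, ∀ b ∈ l'.lower, z b ≤ z a)) :
    linkMatrix n N k y z l l' = 0 := by
  rw [linkMatrix, if_neg h]

lemma IsBlockSorted.le {z : ℕ → ℤ} (hz : IsBlockSorted n N k y z) {i j : ℕ} (hij : i ≤ j) (hj : j ≤ N)
    (h : nodeKey n k y j = nodeKey n k y i) : z j ≤ z i := by
  rcases hij.eq_or_lt with rfl | hij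
  · exact le_refl _
  · exact (hz i j hij hj h).le

/-- With the links ordered by position the matrix is triangular. Its diagonal entries are 1 by the
weak inequalities between neighbours. Left of the diagonal in a block, the upper node has a value
strictly below that of an earlier node `Q` of the block, hence below that of the lower node of the
column. -/
lemma det_linkMatrix_of_interlacing (hy : IsPattern n N k y) {z : ℕ → ℤ}
    (hz : IsInterlacing n N k y z) : (linkMatrix n N k y z).det = 1 := by
  have hn := hy.two_le
  have hs := hz.sorted hy
  let _ : LinearOrder (Link n N y) := LinearOrder.lift' Link.number (Link.number_injective hn)
  rw [Matrix.det_of_isUpperTriangular]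
  · refine Finset.prod_eq_one fun l _ => linkMatrix_eq_one rfl fun a ha b hb => ?_
    obtain ⟨rfl, h1, h2, h3⟩ := Link.upper_eq_some hn ha
    obtain ⟨rfl, h4, -⟩ := Link.lower_eq_some hb
    exact (hz _ h2 h3).1 (by rw [Nat.add_sub_cancel, ← h4, h1])
  · intro l l' hlt
    refine linkMatrix_eq_zero ?_
    rintro ⟨hk, h⟩
    have hlt' : l'.pos < l.pos := by
      refine lt_of_le_of_ne (Link.number_lt hlt) fun hp => ?_
      rw [Link.eq_of_key_eq hy hk hp.symm] at hlt
      exact lt_irrefl (Link.number l') hlt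
    obtain ⟨h1, h2, Q, h3, h4, h5, h6⟩ := Link.of_key_eq hy hk hlt'
    have h7 := h _ h2 _ h1
    have h8 := (Link.upper_eq_some hn h2).2.2
    have h9 := (hz _ h8.1 h8.2).2 (by rw [show l.pos + 1 - n = Q by omega, h4])
    rw [show l.pos + 1 - n = Q by omega] at h9
    have := hs.le h5 (by omega) h6
    omega

/-- If `f` moved some element up, applying `f` again would move its image up as well, and so on
beyond the bound; moving down runs into 0 in the same way. -/
lemma pos_eq_of_mono {α β : Type*} (pos : α → ℕ) (cls : α → β) (f : α → α) (B : ℕ)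
    (hB : ∀ x, pos x ≤ B) (hcls : ∀ x, cls (f x) = cls x)
    (hf : ∀ x y, cls x = cls y → pos x < pos y → pos (f x) < pos (f y)) (x : α) :
    pos (f x) = pos x := by
  apply le_antisymm
  · induction hd : B - pos x using Nat.strong_induction_on generalizing x with
    | _ d ih =>
    by_contra! h
    have h1 := hf x (f x) (hcls x).symm h
    have h2 := ih (B - pos (f x)) (by have := hB (f x); omega) (f x) rfl
    omega
  · induction hd : pos x using Nat.strong_induction_on generalizing x with
    | _ d ih =>
    by_contra! h
    have h1 := hf (f x) x (hcls x) (by omega)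
    have h2 := ih (pos (f x)) (by omega) (f x) rfl
    omega

/-- Because `z` is sorted in blocks, the nonzero entries of a row form a final segment of the links
of its block, starting at `f l`, and these starting points increase weakly with the row. A nonzero
determinant rules out zero rows and equal rows, so they increase strictly, and `pos_eq_of_mono` puts
every start on the diagonal. Nonzero diagonal entries are the weak inequalities, and zeros to the
left of the diagonal are the strict ones. -/
lemma interlacing_of_det_ne_zero (hy : IsPattern n N k y) {z : ℕ → ℤ}
    (hz : IsBlockSorted n N k y z) (hdet : (linkMatrix n N k y z).det ≠ 0) :
    IsInterlacing n N k y z := by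
  classical
  have hn := hy.two_le
  set M := linkMatrix n N k y z with hM
  have hrow : ∀ l, ∃ l', M l l' ≠ 0 := fun l => by
    by_contra! h
    exact hdet (Matrix.det_eq_zero_of_row_eq_zero l h)
  have hmin : ∀ l, ∃ l', M l l' ≠ 0 ∧ ∀ l'', M l l'' ≠ 0 → l'.pos ≤ l''.pos := fun l => by
    obtain ⟨l', h1, h2⟩ := (Finset.univ.filter fun l' => M l l' ≠ 0).exists_min_image
      Link.pos (by obtain ⟨l', h⟩ := hrow l; exact ⟨l', by simpa using h⟩)
    exact ⟨l', by simpa using h1, fun l'' h => h2 l'' (by simpa using h)⟩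
  choose f hf1 hf2 using hmin
  have hup : ∀ l l' l'' : Link n N y, M l l' ≠ 0 → l'.key k = l''.key k → l'.pos < l''.pos →
      M l l'' ≠ 0 := fun l l' l'' h1 h2 h3 => by
    rw [hM, linkMatrix_ne_zero] at h1 ⊢
    refine ⟨h1.1.trans h2, fun a ha b hb => ?_⟩
    have h4 := (Link.of_key_eq hy h2.symm h3).1
    have h5 := h1.2 a ha _ h4
    obtain ⟨rfl, h6, h7, -⟩ := Link.lower_eq_some hb
    obtain ⟨-, h8, -⟩ := Link.lower_eq_some h4
    have h9 : nodeKey n k y l''.pos = nodeKey n k y l'.pos := by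
      have := h2.symm
      unfold Link.key at this
      rwa [h6, h8] at this
    exact (hz _ _ h3 h7 h9).le.trans h5
  have hiff : ∀ l l', M l l' ≠ 0 ↔ l.key k = l'.key k ∧ (f l).pos ≤ l'.pos := fun l l' => by
    have hk := (linkMatrix_ne_zero.1 (hf1 l)).1
    constructor
    · intro h
      exact ⟨(linkMatrix_ne_zero.1 h).1, hf2 l l' h⟩
    · rintro ⟨h1, h2⟩
      rcases h2.eq_or_lt with h2 | h2
      · rw [← Link.eq_of_key_eq hy (hk.symm.trans h1) h2]
        exact hf1 l
      · exact hup l (f l) l' (hf1 l) (hk.symm.trans h1) h2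
  have hmono : ∀ l l' : Link n N y, l.key k = l'.key k → l.pos < l'.pos → (f l).pos < (f l').pos := by
    intro l l' h1 h2
    have hle : (f l).pos ≤ (f l').pos := by
      apply hf2
      have h3 := linkMatrix_ne_zero.1 (hf1 l')
      rw [hM, linkMatrix_ne_zero]
      refine ⟨h1.trans h3.1, fun a ha b hb => ?_⟩
      have h4 := (Link.of_key_eq hy h1.symm h2).2.1
      have h5 := h3.2 _ h4 b hb
      obtain ⟨rfl, h6, h7, -⟩ := Link.upper_eq_some hn ha
      obtain ⟨-, h8, -, h10⟩ := Link.upper_eq_some hn h4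
      have h9 : nodeKey n k y (l'.pos + 1) = nodeKey n k y (l.pos + 1) := by
        obtain ⟨t, e1, e2⟩ := (blockKey_eq_iff hy.pos).1 h1.symm
        refine (blockKey_eq_iff hy.pos).2 ⟨t, by rw [← h8, ← h6, e1], ?_⟩
        push_cast
        linarith
      exact h5.trans (hz _ _ (by omega) h10 h9).le
    refine lt_of_le_of_ne hle fun he => hdet ?_
    refine Matrix.det_zero_of_row_eq (i := l) (j := l') (by rintro rfl; omega) ?_
    ext l''
    exact linkMatrix_eq_of_iff (by rw [hiff, hiff, h1, he])
  have hfix := pos_eq_of_mono Link.pos (Link.key k) f N Link.pos_le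
    (fun l => (linkMatrix_ne_zero.1 (hf1 l)).1.symm) hmono
  intro a ha haN
  constructor
  · intro h
    set l : Link n N y := Sum.inl ⟨a - 1, by omega⟩ with hl
    have h1 : M l l ≠ 0 := (hiff l l).2 ⟨rfl, (hfix l).le⟩
    have h2 : l.upper = some a := by
      have := Link.upper_eq hn (l := l)
        (by simp only [hl, Link.level, Link.pos]; rw [Nat.sub_add_cancel (by omega), h])
        (by simp only [hl, Link.pos]; omega) (by simp only [hl, Link.pos]; omega)
      rw [this]
      simp only [hl, Link.pos]
      congr 1; omega
    exact (linkMatrix_ne_zero.1 h1).2 a h2 (a - 1) rfl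
  · intro h
    obtain ⟨l, hl1, hl2, hl3⟩ : ∃ l : Link n N y, l.pos + 1 = a ∧ l.level = y a ∧ l.upper = some a := by
      have hle := hy.le_succ (a - 1)
      rw [Nat.sub_add_cancel (by omega)] at hle
      rcases hle.eq_or_lt with h1 | h1
      · refine ⟨Sum.inl ⟨a - 1, by omega⟩, by simp only [Link.pos]; omega, h1, ?_⟩
        simp only [Link.upper]
        rw [Nat.sub_add_cancel (by omega), if_pos ⟨ha, haN, h1.symm⟩]
      · exact ⟨Sum.inr ⟨⟨a, by omega⟩, ha, h1⟩, by simp only [Link.pos]; omega, rfl, rfl⟩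
    set l' : Link n N y := Sum.inl ⟨a - n, by omega⟩ with hl'
    have hp : l'.pos = a - n := rfl
    have hk : l.key k = l'.key k := by
      refine (blockKey_eq_iff hy.pos).2 ⟨1, ?_, ?_⟩
      · rw [hl2, h, mul_one]; rfl
      · rw [hp]
        push_cast [Nat.cast_sub ha]
        rw [← hl1]
        push_cast
        ring
    by_contra! hlt
    -- The column of `a - n` is left of the diagonal in the row of `a`, so this entry has to vanish.
    have h1 : M l l' ≠ 0 := by
      rw [hM, linkMatrix_ne_zero]
      refine ⟨hk, fun a' ha' b hb => ?_⟩
      obtain rfl : a = a' := by rw [hl3] at ha'; simpa using ha'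
      obtain rfl : a - n = b := by simpa [hl', Link.lower] using hb
      exact hlt
    have h2 := ((hiff l l').1 h1).2
    rw [hfix, hp] at h2
    have := hy.two_le
    omega

lemma det_linkMatrix_of_tie {z : ℕ → ℤ} {i j : ℕ} (hij : i < j)
    (hj : j ≤ N) (h : nodeKey n k y j = nodeKey n k y i) (hz : z i = z j) :
    (linkMatrix n N k y z).det = 0 := by
  classical
  refine Matrix.det_zero_of_column_eq (i := Sum.inl ⟨i, by omega⟩) (j := Sum.inl ⟨j, by omega⟩)
    (by simp; omega) fun l => ?_
  refine linkMatrix_eq_of_iff ?_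
  rw [linkMatrix_ne_zero, linkMatrix_ne_zero, show Link.key k (Sum.inl ⟨i, by omega⟩ : Link n N y) =
    Link.key k (Sum.inl ⟨j, by omega⟩ : Link n N y) from h.symm]
  simp [Link.lower, hz]

end Pattern

end InfBrion

end

noncomputable section

namespace InfBrion

/-! ### Chains in the Leibniz terms, block permutations, and vanishing for non-regular patterns. -/

section Pattern

variable {n N : ℕ} {k : ℤ} {y : ℕ → ℤ}

namespace Link

lemma exists_upper (hy : IsPattern n N k y) {a : ℕ} (ha : n ≤ a) (haN : a ≤ N) :
    ∃ l : Link n N y, l.upper = some a := by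
  have hn := hy.two_le
  have hle := hy.le_succ (a - 1)
  rw [Nat.sub_add_cancel (by omega)] at hle
  rcases hle.eq_or_lt with h1 | h1
  · refine ⟨Sum.inl ⟨a - 1, by omega⟩, ?_⟩
    simp only [upper]
    rw [Nat.sub_add_cancel (by omega), if_pos ⟨ha, haN, h1.symm⟩]
  · exact ⟨Sum.inr ⟨⟨a, by omega⟩, ha, h1⟩, rfl⟩

lemma eq_of_upper (hy : IsPattern n N k y) {l l' : Link n N y} {a : ℕ} (h : l.upper = some a)
    (h' : l'.upper = some a) : l = l' := by
  obtain ⟨h1, h2, -⟩ := upper_eq_some hy.two_le h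
  obtain ⟨h3, h4, -⟩ := upper_eq_some hy.two_le h'
  have : l.pos = l'.pos := by omega
  exact eq_of_key_eq hy (by unfold key; rw [this, h2, h4]) this

lemma key_of_upper (hy : IsPattern n N k y) {l : Link n N y} {a : ℕ} (h : l.upper = some a) :
    l.key k = blockKey n k (y a) ((a : ℤ) - 1) := by
  obtain ⟨h1, h2, -⟩ := upper_eq_some hy.two_le h
  unfold key
  rw [h2, h1]
  push_cast
  congr 1
  ring

lemma key_of_lower {l : Link n N y} {b : ℕ} (h : l.lower = some b) :
    l.key k = nodeKey n k y b := by
  obtain ⟨h1, h2, -⟩ := lower_eq_some h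
  unfold key nodeKey
  rw [h2, h1]

lemma eq_of_lower {l l' : Link n N y} {b : ℕ} (h : l.lower = some b) (h' : l'.lower = some b) :
    l = l' := by
  obtain ⟨-, -, -, h1, rfl⟩ := lower_eq_some h
  obtain ⟨-, -, -, h2, rfl⟩ := lower_eq_some h'
  rfl

end Link

lemma blockKey_sub_one_eq {v p v' p' : ℤ} (hk : 0 < k) (h : blockKey n k v p = blockKey n k v' p') :
    blockKey n k v (p - 1) = blockKey n k v' (p' - 1) := by
  obtain ⟨t, h1, h2⟩ := (blockKey_eq_iff hk).1 h
  exact (blockKey_eq_iff hk).2 ⟨t, h1, by rw [h2]; ring⟩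

lemma IsPattern.lt_of_nodeKey (hy : IsPattern n N k y) {i j : ℕ} (h : nodeKey n k y j = nodeKey n k y i)
    (hi : i < n) : j = i := by
  rcases lt_trichotomy i j with hij | hij | hij
  · have := hy.not_base_of_nodeKey_eq hij h; omega
  · exact hij.symm
  · have := hy.not_base_of_nodeKey_eq hij h.symm; omega

/-! ### Invariance of the terms of the determinant -/

/-- The nodes that are joined to a base node by a chain of pairs `(b, a)` of the relation `R`. -/
inductive Reach (n : ℕ) (R : ℕ → ℕ → Prop) : ℕ → Prop
  | base (P : ℕ) (h : P < n) : Reach n R P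
  | step (a b : ℕ) (h : Reach n R b) (hab : R b a) : Reach n R a

/-- The pairs of the lower node of a link and the upper node of its image. -/
def linkRel (σ : Equiv.Perm (Link n N y)) (b a : ℕ) : Prop :=
  ∃ l : Link n N y, l.lower = some b ∧ (σ l).upper = some a

/-- A free node is the upper node of one link only and `σ` is injective, so `b` is the only
predecessor of `a`; base nodes are never upper nodes. -/
lemma reach_iff (hy : IsPattern n N k y) {σ : Equiv.Perm (Link n N y)} {b a : ℕ}
    (h : linkRel σ b a) : Reach n (linkRel σ) a ↔ Reach n (linkRel σ) b := by
  refine ⟨fun h' => ?_, fun h' => Reach.step a b h' h⟩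
  obtain ⟨l, h1, h2⟩ := h
  rcases h' with ⟨_, h3⟩ | ⟨_, b', h3, l', h4, h5⟩
  · have := (Link.upper_eq_some hy.two_le h2).2.2; omega
  · have := σ.injective (Link.eq_of_upper hy h2 h5)
    subst this
    rw [h1] at h4
    obtain rfl : b = b' := by simpa using h4
    exact h3

lemma linkRel_key (hy : IsPattern n N k y) {σ : Equiv.Perm (Link n N y)}
    (hσ : ∀ l, (σ l).key k = l.key k) {b a : ℕ} (h : linkRel σ b a) :
    nodeKey n k y b = blockKey n k (y a) ((a : ℤ) - 1) := by
  obtain ⟨l, h1, h2⟩ := h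
  rw [← Link.key_of_lower h1, ← Link.key_of_upper hy h2, hσ]

/-- Predecessors of nodes in one block lie in one block again. Descending simultaneously ends at
base nodes, which are alone in their blocks; going back up is deterministic since a node is the
lower node of one link only. -/
lemma reach_unique (hy : IsPattern n N k y) {σ : Equiv.Perm (Link n N y)}
    (hσ : ∀ l, (σ l).key k = l.key k) {P P' : ℕ} (hP : Reach n (linkRel σ) P)
    (hP' : Reach n (linkRel σ) P') (h : nodeKey n k y P' = nodeKey n k y P) : P' = P := by
  induction hP generalizing P' with
  | base P hP => exact hy.lt_of_nodeKey h hP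
  | step a b hb hab ih =>
    rcases hP' with ⟨_, h3⟩ | ⟨_, b', h3, hab'⟩
    · exact (hy.lt_of_nodeKey h.symm h3).symm
    · have h1 : nodeKey n k y b' = nodeKey n k y b := by
        rw [linkRel_key hy hσ hab, linkRel_key hy hσ hab']
        exact blockKey_sub_one_eq hy.pos h
      have := ih h3 h1
      subst this
      obtain ⟨l, e1, e2⟩ := hab
      obtain ⟨l', e3, e4⟩ := hab'
      rw [Link.eq_of_lower e3 e1, e2] at e4
      simpa using e4.symm

/-- If all nodes were attached to the base, `reach_unique` would make the blocks singletons, and the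
predecessor of each free node, lying in the block preceding it, would provide a lower neighbour by
`exists_lower`: the pattern would be regular. -/
lemma exists_not_reach (hy : IsPattern n N k y) (hreg : ¬ IsRegularPattern n N k y)
    {σ : Equiv.Perm (Link n N y)} (hσ : ∀ l, (σ l).key k = l.key k) :
    ∃ P, n ≤ P ∧ P ≤ N ∧ ¬ Reach n (linkRel σ) P := by
  by_contra! hall
  have hall : ∀ P ≤ N, Reach n (linkRel σ) P := fun P hP =>
    (Nat.lt_or_ge P n).elim (Reach.base P) (fun h => hall P h hP)
  refine hreg ⟨fun i j hij hj h => ?_, fun a ha haN => ?_⟩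
  · exact hij.ne' (reach_unique hy hσ (hall i (by omega)) (hall j hj) h)
  · rcases hall a haN with ⟨_, h3⟩ | ⟨_, b', h3, hab'⟩
    · omega
    · exact hy.exists_lower ha (linkRel_key hy hσ hab')

/-! ### Permutations of the blocks -/

variable {m : ℕ}

/-- The extension by zero to all nodes of a function on the free nodes. -/
def nodeVal (n : ℕ) {m : ℕ} (d : Fin m → ℤ) (P : ℕ) : ℤ :=
  if h : n ≤ P ∧ P < n + m then d ⟨P - n, by omega⟩ else 0

/-- The shifted coordinates. -/
def shiftVal (n : ℕ) (k : ℤ) (y : ℕ → ℤ) {m : ℕ} (d : Fin m → ℤ) (P : ℕ) : ℤ :=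
  nodeVal n d P - y P / k

/-- The tangent cone of a pattern. -/
def patternCone (n N : ℕ) (k : ℤ) (y : ℕ → ℤ) (m : ℕ) : Set (Fin m → ℤ) :=
  {d | IsInterlacing n N k y (shiftVal n k y d)}

lemma nodeVal_add_fin (d : Fin m → ℤ) (j : Fin m) : nodeVal n d (n + j) = d j := by
  unfold nodeVal
  rw [dif_pos (by omega)]
  congr 1
  exact Fin.ext (by simp)

lemma nodeVal_of_lt (d : Fin m → ℤ) {P : ℕ} (h : P < n) : nodeVal n d P = 0 :=
  dif_neg (by omega)

/-- The free nodes. -/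
def freeNode (n m : ℕ) : Fin m ↪ ℕ := ⟨fun j => n + j, fun i j h => Fin.ext (by simpa using h)⟩

/-- The action on nodes of a permutation of the free nodes. -/
def nodePerm (n : ℕ) (g : Equiv.Perm (Fin m)) : Equiv.Perm ℕ := g.viaEmbedding (freeNode n m)

lemma nodePerm_add (g : Equiv.Perm (Fin m)) (j : Fin m) : nodePerm n g (n + j) = n + g j :=
  g.viaEmbedding_apply (freeNode n m) j

lemma nodePerm_of_notMem (g : Equiv.Perm (Fin m)) {P : ℕ} (h : ¬ (n ≤ P ∧ P < n + m)) :
    nodePerm n g P = P := by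
  apply g.viaEmbedding_apply_of_notMem
  rintro ⟨j, rfl⟩
  exact h ⟨Nat.le_add_right _ _, Nat.add_lt_add_left j.2 n⟩

lemma free_or_not (n m P : ℕ) : (∃ j : Fin m, P = n + j) ∨ ¬ (n ≤ P ∧ P < n + m) := by
  by_cases h : n ≤ P ∧ P < n + m
  · exact Or.inl ⟨⟨P - n, by omega⟩, by simp; omega⟩
  · exact Or.inr h

/-- The permutations of the free nodes that preserve the blocks. -/
def IsBlockPerm (n : ℕ) (k : ℤ) (y : ℕ → ℤ) (g : Equiv.Perm (Fin m)) : Prop :=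
  ∀ j, nodeKey n k y (n + g j) = nodeKey n k y (n + j)

lemma IsBlockPerm.mul {g g' : Equiv.Perm (Fin m)} (hg : IsBlockPerm n k y g)
    (hg' : IsBlockPerm n k y g') : IsBlockPerm n k y (g * g') := fun j => by
  rw [Equiv.Perm.mul_apply, hg, hg']

lemma IsBlockPerm.inv {g : Equiv.Perm (Fin m)} (hg : IsBlockPerm n k y g) :
    IsBlockPerm n k y g⁻¹ := fun j => by
  rw [← hg (g⁻¹ j), ← Equiv.Perm.mul_apply, mul_inv_cancel, Equiv.Perm.one_apply]

/-- The shift by `y / k` is not invariant under permutations of a block; permuting shifted values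
amounts to permuting `d` and translating it by the differences of the shifts. -/
lemma shiftVal_nodePerm (d : Fin m → ℤ) (g : Equiv.Perm (Fin m)) (P : ℕ) :
    shiftVal n k y d (nodePerm n g P) =
      shiftVal n k y (fun j => d (g j) + (y (n + j) / k - y (n + g j) / k)) P := by
  rcases free_or_not n m P with ⟨j, rfl⟩ | h
  · rw [nodePerm_add, shiftVal, shiftVal, nodeVal_add_fin, nodeVal_add_fin]
    ring
  · rw [nodePerm_of_notMem _ h, shiftVal, shiftVal, nodeVal, nodeVal, dif_neg h, dif_neg h]

/-- The link with a given free lower node. -/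
def lowerLink (hN : N + 1 = n + m) : Fin m ↪ Link n N y :=
  ⟨fun j => Sum.inl ⟨n + j, by omega⟩, fun i j h => by
    have := Fin.val_eq_of_eq (Sum.inl_injective h)
    exact Fin.ext (by simpa using this)⟩

/-- The link with a given free upper node. -/
def upperLink (hy : IsPattern n N k y) (hN : N + 1 = n + m) : Fin m ↪ Link n N y :=
  ⟨fun j => (Link.exists_upper hy (Nat.le_add_right n j) (by omega)).choose, fun i j h => by
    have h1 := (Link.exists_upper hy (Nat.le_add_right n i) (by omega)).choose_spec
    have h2 := (Link.exists_upper hy (Nat.le_add_right n j) (by omega)).choose_spec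
    simp only at h
    rw [h, h2] at h1
    exact Fin.ext (by simpa using h1.symm)⟩

lemma upperLink_upper (hy : IsPattern n N k y) (hN : N + 1 = n + m) (j : Fin m) :
    (upperLink hy hN j).upper = some (n + j) :=
  (Link.exists_upper hy (Nat.le_add_right n j) (by omega)).choose_spec

-- Permuting values by `g` permutes the rows through the upper nodes and the columns through the
-- lower nodes. Both permutations have the sign of `g`, so the signs cancel.
open Classical in
lemma det_linkMatrix_perm (hy : IsPattern n N k y) (hN : N + 1 = n + m) {g : Equiv.Perm (Fin m)}
    (hg : IsBlockPerm n k y g) (z : ℕ → ℤ) :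
    (linkMatrix n N k y (fun P => z (nodePerm n g P))).det = (linkMatrix n N k y z).det := by
  set σ := g.viaFintypeEmbedding (upperLink hy hN) with hσ
  set π := g.viaFintypeEmbedding (lowerLink (y := y) hN) with hπ
  have hσu : ∀ l : Link n N y, (σ l).key k = l.key k ∧
      (σ l).upper = l.upper.map (nodePerm n g) := by
    intro l
    by_cases h : l ∈ Set.range (upperLink hy hN)
    · obtain ⟨j, rfl⟩ := h
      rw [hσ, Equiv.Perm.viaFintypeEmbedding_apply_image,
        Link.key_of_upper hy (upperLink_upper hy hN (g j)),
        Link.key_of_upper hy (upperLink_upper hy hN j), upperLink_upper, upperLink_upper]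
      refine ⟨blockKey_sub_one_eq hy.pos (hg j), ?_⟩
      rw [Option.map_some, nodePerm_add]
    · rw [hσ, Equiv.Perm.viaFintypeEmbedding_apply_notMem_range _ _ h]
      refine ⟨rfl, ?_⟩
      rcases ho : l.upper with _ | a
      · rfl
      · exfalso
        obtain ⟨-, -, h1, h2⟩ := Link.upper_eq_some hy.two_le ho
        refine h ⟨⟨a - n, by omega⟩, Link.eq_of_upper hy (upperLink_upper hy hN _) ?_⟩
        rw [ho]; simp only [Option.some.injEq]; omega
  have hπl : ∀ l : Link n N y, (π l).key k = l.key k ∧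
      (π l).lower = l.lower.map (nodePerm n g) := by
    intro l
    by_cases h : l ∈ Set.range (lowerLink (y := y) hN)
    · obtain ⟨j, rfl⟩ := h
      rw [hπ, Equiv.Perm.viaFintypeEmbedding_apply_image]
      refine ⟨hg j, ?_⟩
      change some (n + (g j : ℕ)) = some (nodePerm n g (n + j))
      rw [nodePerm_add]
    · rw [hπ, Equiv.Perm.viaFintypeEmbedding_apply_notMem_range _ _ h]
      refine ⟨rfl, ?_⟩
      rcases l with P | a
      · change some (P : ℕ) = some (nodePerm n g P)
        rw [nodePerm_of_notMem]
        rintro ⟨h1, h2⟩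
        refine h ⟨⟨P - n, by omega⟩, ?_⟩
        change Sum.inl _ = _
        congr 1
        apply Fin.ext
        simp only
        omega
      · rfl
  have : linkMatrix n N k y (fun P => z (nodePerm n g P)) =
      ((linkMatrix n N k y z).submatrix σ id).submatrix id π := by
    ext l l'
    simp only [Matrix.submatrix_apply, id]
    unfold linkMatrix
    rw [(hσu l).1, (hπl l').1, (hσu l).2, (hπl l').2]
    refine if_congr (and_congr Iff.rfl ?_) rfl rfl
    simp
  rw [this, Matrix.det_permute', Matrix.det_permute, hσ, hπ,
    Equiv.Perm.viaFintypeEmbedding_sign, Equiv.Perm.viaFintypeEmbedding_sign, ← mul_assoc]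
  rw [← Int.cast_mul, ← Units.val_mul, Int.units_mul_self]
  simp

lemma IsPattern.exists_fin_of_nodeKey_eq (hy : IsPattern n N k y) (hN : N + 1 = n + m) {i j : ℕ}
    (hij : i < j) (hj : j ≤ N) (h : nodeKey n k y j = nodeKey n k y i) :
    ∃ i' j' : Fin m, i = n + i' ∧ j = n + j' := by
  have := hy.not_base_of_nodeKey_eq hij h
  exact ⟨⟨i - n, by omega⟩, ⟨j - n, by omega⟩, by simp; omega, by simp; omega⟩

/-- Rearrangement: a block permutation minimising `∑ j * z (n + g j)` sorts every block
decreasingly, since exchanging a pair in the wrong order would lower the sum. -/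
lemma exists_blockSorted (hy : IsPattern n N k y) (hN : N + 1 = n + m) (z : ℕ → ℤ)
    (hz : ∀ i j, i < j → j ≤ N → nodeKey n k y j = nodeKey n k y i → z i ≠ z j) :
    ∃ g : Equiv.Perm (Fin m), IsBlockPerm n k y g ∧
      IsBlockSorted n N k y (fun P => z (nodePerm n g P)) := by
  classical
  obtain ⟨g, hg, hmin⟩ := (Finset.univ.filter fun g : Equiv.Perm (Fin m) =>
    IsBlockPerm n k y g).exists_min_image (fun g => ∑ j : Fin m, (j : ℤ) * z (n + g j))
    ⟨1, by simp only [Finset.mem_filter, Finset.mem_univ, true_and]; exact fun j => rfl⟩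
  simp only [Finset.mem_filter, Finset.mem_univ, true_and] at hg hmin
  refine ⟨g, hg, fun i j hij hj h => ?_⟩
  obtain ⟨i, j, rfl, rfl⟩ := hy.exists_fin_of_nodeKey_eq hN hij hj h
  have hij' : i < j := by rw [Fin.lt_def]; omega
  simp only [nodePerm_add]
  by_contra! hle
  have hne : z (n + g i) ≠ z (n + g j) := by
    have hk : nodeKey n k y (n + g j) = nodeKey n k y (n + g i) := by rw [hg, hg, h]
    have h1 := (g i).2
    have h2 := (g j).2
    rcases lt_trichotomy (g i) (g j) with h3 | h3 | h3
    · exact hz _ _ (by omega) (by omega) hk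
    · exact absurd (g.injective h3) hij'.ne
    · exact (hz _ _ (by omega) (by omega) hk.symm).symm
  have hsw : IsBlockPerm n k y (Equiv.swap i j) := fun l => by
    by_cases h1 : l = i
    · rw [h1, Equiv.swap_apply_left, h]
    · by_cases h2 : l = j
      · rw [h2, Equiv.swap_apply_right, h]
      · rw [Equiv.swap_apply_of_ne_of_ne h1 h2]
  have h1 := hmin _ (hg.mul hsw)
  have h2 : ∑ l : Fin m, (l : ℤ) * z (n + (g * Equiv.swap i j) l) =
      ∑ l : Fin m, (Equiv.swap i j l : ℤ) * z (n + g l) := by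
    rw [← Equiv.sum_comp (Equiv.swap i j)]
    simp
  rw [h2, ← sub_nonneg, ← Finset.sum_sub_distrib,
    Fintype.sum_eq_add i j hij'.ne (fun l hl => by
      rw [Equiv.swap_apply_of_ne_of_ne hl.1 hl.2, sub_self]),
    Equiv.swap_apply_left, Equiv.swap_apply_right] at h1
  have h3 : z (n + g i) < z (n + g j) := lt_of_le_of_ne hle hne
  have h4 : (i : ℤ) < j := by exact_mod_cast hij'
  nlinarith

lemma blockSorted_unique (hN : N + 1 = n + m) {z : ℕ → ℤ}
    {g g' : Equiv.Perm (Fin m)} (hg : IsBlockPerm n k y g) (hg' : IsBlockPerm n k y g')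
    (h : IsBlockSorted n N k y (fun P => z (nodePerm n g P)))
    (h' : IsBlockSorted n N k y (fun P => z (nodePerm n g' P))) : g' = g := by
  have hgi : IsBlockPerm n k y (g⁻¹ * g') := hg.inv.mul hg'
  have := pos_eq_of_mono (fun j : Fin m => (j : ℕ)) (fun j => nodeKey n k y (n + j)) (fun j => (g⁻¹ * g') j) m
    (fun j => j.2.le) hgi (fun i j hk hij => ?_)
  · have h1 : g⁻¹ * g' = 1 := Equiv.ext fun j => Fin.ext (this j)
    exact (inv_mul_eq_one.1 h1).symm
  · have h1 := h' (n + i) (n + j) (by omega) (by omega) hk.symm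
    simp only [nodePerm_add] at h1
    by_contra! hle
    have h2 := h.le (i := n + (g⁻¹ * g') j) (j := n + (g⁻¹ * g') i) (by omega) (by omega)
      (by rw [hgi, hgi, hk])
    simp only [nodePerm_add, ← Equiv.Perm.mul_apply, mul_inv_cancel_left] at h2
    omega

open Classical in
/-- The determinant is the sum of the indicators of the images of the tangent cone. -/
lemma sum_interlacing (hy : IsPattern n N k y) (hN : N + 1 = n + m) (z : ℕ → ℤ) :
    ∑ g ∈ Finset.univ.filter (fun g : Equiv.Perm (Fin m) => IsBlockPerm n k y g),
      (if IsInterlacing n N k y (fun P => z (nodePerm n g P)) then (1 : ℂ) else 0) =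
    (linkMatrix n N k y z).det := by
  by_cases hz : ∀ i j, i < j → j ≤ N → nodeKey n k y j = nodeKey n k y i → z i ≠ z j
  · obtain ⟨g, hg, hs⟩ := exists_blockSorted hy hN z hz
    -- Interlacing implies sortedness, so only the unique sorting permutation can contribute.
    rw [Finset.sum_eq_single g]
    · rw [← det_linkMatrix_perm hy hN hg]
      split_ifs with h
      · exact (det_linkMatrix_of_interlacing hy h).symm
      · by_contra h'
        exact h (interlacing_of_det_ne_zero hy hs (Ne.symm h'))
    · intro g' hg' hne
      simp only [Finset.mem_filter, Finset.mem_univ, true_and] at hg'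
      rw [if_neg]
      intro h
      exact hne (blockSorted_unique hN hg hg' hs (h.sorted hy))
    · intro h
      simp [hg] at h
  -- With a tie both sides vanish: the determinant has two equal columns, and no permutation makes
  -- the values strictly sorted.
  · push Not at hz
    obtain ⟨i, j, hij, hj, hk, hz⟩ := hz
    rw [det_linkMatrix_of_tie hij hj hk hz]
    refine Finset.sum_eq_zero fun g hg => ?_
    simp only [Finset.mem_filter, Finset.mem_univ, true_and] at hg
    rw [if_neg]
    intro h
    have h := h.sorted hy
    have key : ∀ i j : Fin m, i ≠ j → nodeKey n k y (n + j) = nodeKey n k y (n + i) →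
        z (n + g i) ≠ z (n + g j) := by
      intro i j hne hk hz
      rcases lt_or_gt_of_ne hne with h1 | h1
      · have := h (n + i) (n + j) (by omega) (by omega) hk
        simp only [nodePerm_add] at this
        omega
      · have := h (n + j) (n + i) (by omega) (by omega) hk.symm
        simp only [nodePerm_add] at this
        omega
    obtain ⟨i, j, rfl, rfl⟩ := hy.exists_fin_of_nodeKey_eq hN hij hj hk
    refine key (g⁻¹ i) (g⁻¹ j) (fun h => ?_) (by rw [hg.inv, hg.inv, hk]) (by simpa using hz)
    have := g⁻¹.injective h
    omega

/-! ### Vanishing -/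

/-- In the Leibniz formula the term of `σ` is zero unless `σ` preserves blocks, and otherwise it is
the indicator of the inequalities `z b ≤ z a` over the pairs of `linkRel σ`. Such a pair is either
wholly attached to the base or wholly detached. Moving all detached nodes together preserves the
term, and this translation has nonzero weight. -/
lemma HasPhi.det_linkMatrix (hy : IsPattern n N k y) (hN : N + 1 = n + m)
    (hreg : ¬ IsRegularPattern n N k y) (st : (Fin m → ℤ) →+ Weight n)
    (hst : ∀ x : Fin m → ℤ, 0 ≤ x → x ≠ 0 → st x ≠ 0) :
    HasPhi st (fun d => (linkMatrix n N k y (shiftVal n k y d)).det) 0 := by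
  classical
  have hterm : ∀ σ : Equiv.Perm (Link n N y), HasPhi st (fun d =>
      ∏ l, linkMatrix n N k y (shiftVal n k y d) (σ l) l) 0 := by
    intro σ
    by_cases hσ : ∀ l : Link n N y, (σ l).key k = l.key k
    · set ε : Fin m → ℤ := fun j => if Reach n (linkRel σ) (n + j) then 0 else 1 with hε
      refine HasPhi.of_periodic (ε := ε) (hst ε ?_ ?_) fun d => ?_
      · intro j
        simp only [hε, Pi.zero_apply]
        split_ifs <;> norm_num
      · obtain ⟨P, h1, h2, h3⟩ := exists_not_reach hy hreg hσ
        intro h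
        have := congrFun h ⟨P - n, by omega⟩
        simp only [hε] at this
        rw [show n + (P - n) = P by omega, if_neg h3] at this
        norm_num at this
      · have hv : ∀ P ≤ N, shiftVal n k y (d - ε) P =
            shiftVal n k y d P - if Reach n (linkRel σ) P then 0 else 1 := by
          intro P hPN
          rcases free_or_not n m P with ⟨j, rfl⟩ | h
          · rw [shiftVal, shiftVal, nodeVal_add_fin, nodeVal_add_fin, Pi.sub_apply]
            ring
          · rw [shiftVal, shiftVal, nodeVal_of_lt _ (by omega), nodeVal_of_lt _ (by omega),
              if_pos (Reach.base P (by omega)), sub_zero]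
        refine Finset.prod_congr rfl fun l _ => linkMatrix_eq_of_iff ?_
        rw [linkMatrix_ne_zero, linkMatrix_ne_zero]
        refine and_congr Iff.rfl (forall₂_congr fun a ha => forall₂_congr fun b hb => ?_)
        have h1 := reach_iff hy (σ := σ) ⟨l, hb, ha⟩
        have h2 := (Link.upper_eq_some hy.two_le ha).2.2.2
        have h3 := (Link.lower_eq_some hb).2.2.1
        rw [hv a h2, hv b h3]
        by_cases h4 : Reach n (linkRel σ) b
        · rw [if_pos h4, if_pos (h1.2 h4)]; omega
        · rw [if_neg h4, if_neg (fun h => h4 (h1.1 h))]; omega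
    · push Not at hσ
      obtain ⟨l, hl⟩ := hσ
      convert HasPhi.zero (st := st) using 1
      ext d
      refine Finset.prod_eq_zero (Finset.mem_univ l) (linkMatrix_eq_zero fun h => hl h.1)
  have := HasPhi.sum (st := st) Finset.univ (fun σ _ => (hterm σ).smul
    (((Equiv.Perm.sign σ : ℤˣ) : ℤ) : ℂ))
  simp only [mul_zero, Finset.sum_const_zero] at this
  convert this using 1
  ext d
  rw [Matrix.det_apply']
  simp [Finset.sum_apply]

/-- The generating function of the tangent cone of a pattern that is not regular vanishes. -/
theorem HasPhi.eq_zero_of_not_regular (hy : IsPattern n N k y) (hN : N + 1 = n + m)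
    (hreg : ¬ IsRegularPattern n N k y) (st : (Fin m → ℤ) →+ Weight n)
    (hst : ∀ x : Fin m → ℤ, 0 ≤ x → x ≠ 0 → st x ≠ 0)
    (hkey : ∀ i j : Fin m, nodeKey n k y (n + i) = nodeKey n k y (n + j) →
      ∀ c, st (Pi.single i c) = st (Pi.single j c)) {f : RatZ n}
    (h : HasPhi st ((patternCone n N k y m).indicator 1) f) : f = 0 := by
  classical
  have hinv : ∀ g : Equiv.Perm (Fin m), IsBlockPerm n k y g → ∀ d : Fin m → ℤ,
      st (fun j => d (g j)) = st d := by
    intro g hg d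
    have hsum : ∀ e : Fin m → ℤ, st e = ∑ j, st (Pi.single j (e j)) := fun e => by
      rw [← map_sum, Finset.univ_sum_single]
    rw [hsum, hsum d, ← Equiv.sum_comp g fun j => st (Pi.single j (d j))]
    exact Finset.sum_congr rfl fun j _ => (hkey _ _ (hg j) _).symm
  -- Weights are constant on blocks, so each of the permuted cones has the same sum `f`; their
  -- indicators add up to the determinant, whose sum is 0.
  have h1 : HasPhi st (∑ g ∈ Finset.univ.filter (fun g : Equiv.Perm (Fin m) => IsBlockPerm n k y g),
      fun d => (patternCone n N k y m).indicator 1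
        ((LinearEquiv.funCongrLeft ℤ ℤ g).toAddEquiv d +
          fun j : Fin m => (y (n + j) / k - y (n + g j) / k)))
      (∑ g ∈ Finset.univ.filter (fun g : Equiv.Perm (Fin m) => IsBlockPerm n k y g), f) := by
    refine HasPhi.sum _ fun g hg => ?_
    simp only [Finset.mem_filter, Finset.mem_univ, true_and] at hg
    have := h.comp_equiv (LinearEquiv.funCongrLeft ℤ ℤ g).toAddEquiv
      (fun d => hinv g hg d) (fun j : Fin m => (y (n + j) / k - y (n + g j) / k))
    -- The translation is the difference of a vector and its block permutation, so it has weight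
    -- zero.
    have hw : st (fun j : Fin m => (y (n + j) / k - y (n + g j) / k)) = 0 := by
      have := hinv g hg fun j => y (n + j) / k
      rw [← sub_eq_zero, ← map_sub, ← neg_eq_zero, ← map_neg, neg_sub] at this
      exact this
    rwa [hw, neg_zero, ex_zero, one_mul] at this
  have h2 := HasPhi.det_linkMatrix hy hN hreg st hst
  have h3 := h1.unique (by
    convert h2 using 1
    ext d
    rw [Finset.sum_apply, ← sum_interlacing hy hN]
    refine Finset.sum_congr rfl fun g _ => ?_
    rw [Set.indicator_apply]
    refine if_congr ?_ rfl rfl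
    unfold patternCone
    rw [Set.mem_ofPred_eq]
    rw [show (fun P => shiftVal n k y d (nodePerm n g P)) = _ from
      funext fun P => shiftVal_nodePerm d g P]
    rfl)
  rw [Finset.sum_const, nsmul_eq_mul] at h3
  rcases mul_eq_zero.1 h3 with h4 | h4
  · exfalso
    have h5 : toRat n ((Finset.univ.filter (fun g : Equiv.Perm (Fin m) =>
      IsBlockPerm n k y g)).card : LaurentZ n) = 0 := by rw [map_natCast]; exact h4
    rw [← map_zero (toRat n)] at h5
    have h6 := toRat_injective h5
    have h7 : ((Finset.univ.filter (fun g : Equiv.Perm (Fin m) =>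
      IsBlockPerm n k y g)).card : ℂ) = 0 := by
      apply (algebraMap ℂ (LaurentZ n)).injective
      rw [map_natCast, h6, map_zero]
    rw [Nat.cast_eq_zero, Finset.card_eq_zero] at h7
    exact Finset.notMem_empty (1 : Equiv.Perm (Fin m)) (h7 ▸ (by
      simp only [Finset.mem_filter, Finset.mem_univ, true_and]; exact fun j => rfl))
  · exact h4

end Pattern

end InfBrion

end

noncomputable section

namespace InfBrion

/-! ### The weights of the variables and the roots -/

section Weights

variable {n : ℕ}

lemma Weight.ext {v w : Weight n} (h1 : ∀ r, v.1 r = w.1 r) (h2 : v.2 = w.2) : v = w :=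
  Prod.ext (funext h1) h2

@[simp] lemma Weight.zero_fst (r : Fin (n - 1)) : (0 : Weight n).1 r = 0 := rfl
@[simp] lemma Weight.zero_snd : (0 : Weight n).2 = 0 := rfl
@[simp] lemma Weight.add_fst (v w : Weight n) (r : Fin (n - 1)) : (v + w).1 r = v.1 r + w.1 r := rfl
@[simp] lemma Weight.add_snd (v w : Weight n) : (v + w).2 = v.2 + w.2 := rfl
@[simp] lemma Weight.sub_fst (v w : Weight n) (r : Fin (n - 1)) : (v - w).1 r = v.1 r - w.1 r := rfl
@[simp] lemma Weight.sub_snd (v w : Weight n) : (v - w).2 = v.2 - w.2 := rfl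
@[simp] lemma Weight.neg_fst (v : Weight n) (r : Fin (n - 1)) : (-v).1 r = -v.1 r := rfl
@[simp] lemma Weight.neg_snd (v : Weight n) : (-v).2 = -v.2 := rfl

@[simp] lemma Weight.zsmul_fst (c : ℤ) (v : Weight n) (r : Fin (n - 1)) : (c • v).1 r = c * v.1 r :=
  map_zsmul (⟨⟨fun w : Weight n => w.1 r, rfl⟩, fun _ _ => rfl⟩ : Weight n →+ ℤ) c v

@[simp] lemma Weight.zsmul_snd (c : ℤ) (v : Weight n) : (c • v).2 = c * v.2 :=
  map_zsmul (⟨⟨fun w : Weight n => w.2, rfl⟩, fun _ _ => rfl⟩ : Weight n →+ ℤ) c v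

@[simp] lemma gam_fst (i : ℕ) (r : Fin (n - 1)) :
    (gam n i).1 r = if (r : ℕ) + 1 = i then 1 else 0 := rfl
@[simp] lemma gam_snd (i : ℕ) : (gam n i).2 = 0 := rfl
@[simp] lemma delta_fst (r : Fin (n - 1)) : (delta n).1 r = 0 := rfl
@[simp] lemma delta_snd : (delta n).2 = -1 := rfl
@[simp] lemma varWeight_fst (i : ℕ) (r : Fin (n - 1)) :
    (varWeight n i).1 r = if (r : ℕ) = i % (n - 1) then 1 else 0 := rfl
@[simp] lemma varWeight_snd (i : ℕ) : (varWeight n i).2 = ((i / (n - 1) : ℕ) : ℤ) := rfl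

lemma gam_zero : gam n 0 = 0 := Weight.ext (fun r => by simp) (by simp)

lemma varWeight_eq (n i : ℕ) :
    varWeight n i = gam n (i % (n - 1) + 1) + (-((i / (n - 1) : ℕ) : ℤ)) • delta n := by
  refine Weight.ext (fun r => ?_) ?_
  · simp
  · simp

lemma varWeight_add_mul (hn : 2 ≤ n) (i t : ℕ) :
    varWeight n (i + (n - 1) * t) = varWeight n i - (t : ℤ) • delta n := by
  rw [varWeight_eq, varWeight_eq, Nat.add_mul_mod_self_left, Nat.add_mul_div_left _ _ (by omega)]
  push_cast
  module

/-- The weights `γ_r + j δ`. -/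
def levelWeights (n : ℕ) : Set (Weight n) := {w | ∃ r < n, ∃ j : ℤ, w = gam n r + j • delta n}

lemma varWeight_mem (hn : 2 ≤ n) (i : ℕ) : varWeight n i ∈ levelWeights n :=
  ⟨_, by have := Nat.mod_lt i (show 0 < n - 1 by omega); omega, _, varWeight_eq n i⟩

lemma zero_mem_levelWeights (hn : 2 ≤ n) : (0 : Weight n) ∈ levelWeights n :=
  ⟨0, by omega, 0, by rw [gam_zero, zero_smul, add_zero]⟩

lemma add_delta_mem {w : Weight n} (hw : w ∈ levelWeights n) (c : ℤ) :
    w + c • delta n ∈ levelWeights n := by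
  obtain ⟨r, hr, j, rfl⟩ := hw
  exact ⟨r, hr, j + c, by module⟩

lemma isRoot_sub {v w : Weight n} (hv : v ∈ levelWeights n) (hw : w ∈ levelWeights n)
    (h : v - w ≠ 0) : IsRoot n (v - w) := by
  obtain ⟨r, hr, j, rfl⟩ := hv
  obtain ⟨s, hs, l, rfl⟩ := hw
  by_cases hrs : r = s
  · subst hrs
    right
    refine ⟨j - l, fun h0 => h ?_, by module⟩
    obtain rfl : j = l := by omega
    exact sub_self _
  · left
    exact ⟨r, s, j - l, hr, hs, hrs, by module⟩

lemma IsRoot.neg {α : Weight n} (h : IsRoot n α) : IsRoot n (-α) := by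
  rcases h with ⟨i, j, m, hi, hj, hij, rfl⟩ | ⟨m, hm, rfl⟩
  · exact Or.inl ⟨j, i, -m, hj, hi, hij.symm, by module⟩
  · exact Or.inr ⟨-m, by omega, by module⟩

lemma IsRoot.ne_zero {α : Weight n} (h : IsRoot n α) : α ≠ 0 := by
  rcases h with ⟨i, j, l, hi, hj, hij, rfl⟩ | ⟨l, hl, rfl⟩
  · intro h
    rcases lt_or_gt_of_ne hij with hlt | hlt
    · have := congrArg (fun w : Weight n => w.1 ⟨j - 1, by omega⟩) h
      simp only [Weight.add_fst, Weight.sub_fst, gam_fst, Weight.zsmul_fst, delta_fst,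
        Weight.zero_fst] at this
      rw [if_neg (by omega), if_pos (by omega)] at this
      omega
    · have := congrArg (fun w : Weight n => w.1 ⟨i - 1, by omega⟩) h
      simp only [Weight.add_fst, Weight.sub_fst, gam_fst, Weight.zsmul_fst, delta_fst,
        Weight.zero_fst] at this
      rw [if_pos (by omega), if_neg (by omega)] at this
      omega
  · intro h
    have := congrArg (fun w : Weight n => w.2) h
    simp only [Weight.zsmul_snd, delta_snd, Weight.zero_snd] at this
    omega

lemma isRoot_varWeight (hn : 2 ≤ n) (i : ℕ) : IsRoot n (varWeight n i) :=
  Or.inl ⟨i % (n - 1) + 1, 0, -((i / (n - 1) : ℕ) : ℤ),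
    by have := Nat.mod_lt i (show 0 < n - 1 by omega); omega, by omega, by omega,
    (varWeight_eq n i).trans (by rw [gam_zero, sub_zero])⟩

/-! ### Partial sums as coordinates -/

section PartialSums

variable {R : Type*} [AddCommGroup R]

/-- The partial sums of a sequence. -/
def psum (x : ℕ →₀ R) (q : ℕ) : R := ∑ p ∈ Finset.range q, x p

lemma psum_succ (x : ℕ →₀ R) (q : ℕ) : psum x (q + 1) = psum x q + x q := Finset.sum_range_succ _ _

lemma psum_zero (x : ℕ →₀ R) : psum x 0 = 0 := rfl

lemma psum_add (x y : ℕ →₀ R) (q : ℕ) : psum (x + y) q = psum x q + psum y q :=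
  Finset.sum_add_distrib

lemma psum_sub (x y : ℕ →₀ R) (q : ℕ) : psum (x - y) q = psum x q - psum y q :=
  Finset.sum_sub_distrib _ _

lemma ext_psum {x y : ℕ →₀ R} (h : ∀ q, psum x q = psum y q) : x = y := by
  ext q
  have h1 := h (q + 1)
  rwa [psum_succ, psum_succ, h q, add_right_inj] at h1

lemma psum_of_le {x : ℕ →₀ R} {m : ℕ} (hx : ∀ i, m ≤ i → x i = 0) {q : ℕ} (hq : m ≤ q) :
    psum x q = psum x m := by
  induction q, hq using Nat.le_induction with
  | base => rfl
  | succ q hq ih => rw [psum_succ, ih, hx q hq, add_zero]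

end PartialSums

/-- The sequence whose `j`-th partial sum is `1` and whose other partial sums up to the `m`-th one
vanish. -/
def stepVec (m j : ℕ) : ℕ →₀ ℤ :=
  Finsupp.single j 1 - if j + 1 < m then Finsupp.single (j + 1) 1 else 0

lemma psum_single (i q : ℕ) : psum (Finsupp.single i (1 : ℤ)) q = if i < q then 1 else 0 := by
  unfold psum
  simp [Finsupp.single_apply]

lemma psum_stepVec (m j q : ℕ) (hj : j < m) :
    psum (stepVec m j) q = if min q m = j + 1 then 1 else 0 := by
  unfold stepVec
  rw [psum_sub, psum_single]
  by_cases h : j + 1 < m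
  · rw [if_pos h, psum_single]
    split_ifs <;> omega
  · rw [if_neg h, show psum (0 : ℕ →₀ ℤ) q = 0 by simp [psum]]
    split_ifs <;> omega

/-- Sequences supported on the first `m` terms, in the coordinates given by their partial sums. -/
def latHom (m : ℕ) : (Fin m → ℤ) →+ (ℕ →₀ ℤ) :=
  ∑ j : Fin m, (zmultiplesHom (ℕ →₀ ℤ) (stepVec m j)).comp (Pi.evalAddMonoidHom _ j)

lemma latHom_apply (m : ℕ) (d : Fin m → ℤ) : latHom m d = ∑ j : Fin m, d j • stepVec m j := by
  simp [latHom, AddMonoidHom.finsetSum_apply]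

lemma psum_sum_smul {κ : Type*} (s : Finset κ) (c : κ → ℤ) (v : κ → ℕ →₀ ℤ) (q : ℕ) :
    psum (∑ j ∈ s, c j • v j) q = ∑ j ∈ s, c j * psum (v j) q := by
  unfold psum
  simp only [Finsupp.coe_finsetSum, Finset.sum_apply, Finsupp.coe_smul, Pi.smul_apply, smul_eq_mul,
    Finset.mul_sum]
  exact Finset.sum_comm

lemma psum_latHom (m : ℕ) (d : Fin m → ℤ) (q : ℕ) :
    psum (latHom m d) q = if h : 0 < min q m then d ⟨min q m - 1, by omega⟩ else 0 := by
  rw [latHom_apply, psum_sum_smul]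
  split_ifs with h
  · rw [Finset.sum_eq_single ⟨min q m - 1, by omega⟩]
    · rw [psum_stepVec _ _ _ (by simp only; omega), if_pos (by simp only; omega), mul_one]
    · intro j _ hj
      rw [psum_stepVec _ _ _ j.2, if_neg, mul_zero]
      intro h'
      exact hj (Fin.ext (by simp only; omega))
    · simp
  · refine Finset.sum_eq_zero fun j _ => ?_
    rw [psum_stepVec _ _ _ j.2, if_neg (by omega), mul_zero]

lemma psum_latHom_succ (m : ℕ) (d : Fin m → ℤ) (j : Fin m) :
    psum (latHom m d) (j + 1) = d j := by
  rw [psum_latHom, dif_pos (by omega)]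
  congr 1
  exact Fin.ext (by simp only; omega)

lemma latHom_injective (m : ℕ) : Function.Injective (latHom m) := fun d e h => by
  ext j
  rw [← psum_latHom_succ m d, h, psum_latHom_succ]

lemma latHom_of_le (m : ℕ) (d : Fin m → ℤ) {i : ℕ} (hi : m ≤ i) : latHom m d i = 0 := by
  have h := psum_succ (latHom m d) i
  have e : min (i + 1) m = min i m := by omega
  have : psum (latHom m d) (i + 1) = psum (latHom m d) i := by
    rw [psum_latHom, psum_latHom]
    simp only [e]
  omega

lemma latHom_psum {m : ℕ} {x : ℕ →₀ ℤ} (hx : ∀ i, m ≤ i → x i = 0) :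
    latHom m (fun j => psum x (j + 1)) = x := by
  refine ext_psum fun q => ?_
  rw [psum_latHom]
  split_ifs with h
  · simp only
    rw [Nat.sub_add_cancel h]
    rcases le_total q m with h1 | h1
    · rw [min_eq_left h1]
    · rw [min_eq_right h1, psum_of_le hx h1]
  · rcases Nat.eq_zero_or_pos q with rfl | hq
    · rfl
    · have hm : m = 0 := by omega
      subst hm
      rw [psum_of_le hx (Nat.zero_le q), psum_zero]

/-- The weight of a sequence in terms of its partial sums. -/
def latWeight (n m : ℕ) : (Fin m → ℤ) →+ Weight n := (starWeight n).comp (latHom m)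

/-- The weight of a vector `stepVec m j`. -/
def stepWeight (n m j : ℕ) : Weight n :=
  varWeight n j - if j + 1 < m then varWeight n (j + 1) else 0

lemma starWeight_single (i : ℕ) (c : ℤ) : starWeight n (Finsupp.single i c) = c • varWeight n i := by
  simp [starWeight]

lemma starWeight_stepVec (m j : ℕ) : starWeight n (stepVec m j) = stepWeight n m j := by
  unfold stepVec stepWeight
  rw [map_sub, starWeight_single, one_smul]
  split_ifs
  · rw [starWeight_single, one_smul]
  · rw [map_zero]

lemma latWeight_apply (m : ℕ) (d : Fin m → ℤ) :
    latWeight n m d = ∑ j : Fin m, d j • stepWeight n m j := by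
  rw [latWeight, AddMonoidHom.comp_apply, latHom_apply, map_sum]
  refine Finset.sum_congr rfl fun j _ => ?_
  rw [map_zsmul, starWeight_stepVec]

lemma latWeight_single (m : ℕ) (j : Fin m) (c : ℤ) :
    latWeight n m (Pi.single j c) = c • stepWeight n m j := by
  rw [latWeight_apply, Finset.sum_eq_single j]
  · rw [Pi.single_eq_same]
  · intro i _ hi
    rw [Pi.single_eq_of_ne hi, zero_smul]
  · simp

/-- A functional that is positive on the weights of the vectors `stepVec m j`. -/
def posForm (n m : ℕ) : Weight n →+ ℤ where
  toFun w := ∑ r : Fin (n - 1), (((n * m + n : ℕ) : ℤ) - (((r : ℕ) : ℤ) + 1)) * w.1 r - n * w.2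
  map_zero' := by simp
  map_add' x y := by
    simp only [Weight.add_fst, Weight.add_snd, mul_add, Finset.sum_add_distrib]
    ring

lemma posForm_varWeight (hn : 2 ≤ n) (m i : ℕ) : posForm n m (varWeight n i) =
    ((n * m + n : ℕ) : ℤ) - ((i % (n - 1) : ℕ) + 1) - n * ((i / (n - 1) : ℕ) : ℤ) := by
  have hlt := Nat.mod_lt i (show 0 < n - 1 by omega)
  change ∑ r : Fin (n - 1), (((n * m + n : ℕ) : ℤ) - (((r : ℕ) : ℤ) + 1)) *
    (if (r : ℕ) = i % (n - 1) then 1 else 0) - n * ((i / (n - 1) : ℕ) : ℤ) = _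
  rw [Finset.sum_eq_single (⟨i % (n - 1), hlt⟩ : Fin (n - 1))]
  · simp
  · intro r _ hr
    rw [if_neg (fun h => hr (Fin.ext h)), mul_zero]
  · simp

/-- Along the sequence `varWeight n i` the functional drops by 1 inside a row of `n - 1` variables
and by 2 when `q` appears anew, and it is still positive at `i = m - 1`. This is why nonzero
nonnegative vectors of partial sums have nonzero weight. -/
lemma posForm_stepWeight (hn : 2 ≤ n) {m j : ℕ} (hj : j < m) : 0 < posForm n m (stepWeight n m j) := by
  unfold stepWeight
  have hlt := Nat.mod_lt j (show 0 < n - 1 by omega)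
  have hdm := Nat.div_add_mod j (n - 1)
  split_ifs with h
  · rw [map_sub, posForm_varWeight hn, posForm_varWeight hn]
    set q := j / (n - 1)
    set r := j % (n - 1)
    rw [show j + 1 = r + 1 + (n - 1) * q by omega, Nat.add_mul_mod_self_left,
      Nat.add_mul_div_left _ _ (by omega : 0 < n - 1)]
    rcases Nat.lt_or_ge (r + 1) (n - 1) with h1 | h1
    · rw [Nat.mod_eq_of_lt h1, Nat.div_eq_of_lt h1]
      push_cast
      linarith
    · rw [show r + 1 = n - 1 by omega, Nat.mod_self, Nat.div_self (by omega)]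
      push_cast
      have : (n : ℤ) = r + 2 := by omega
      linarith
  · rw [sub_zero, posForm_varWeight hn]
    have h1 : n * (j / (n - 1)) ≤ n * j := Nat.mul_le_mul_left n (Nat.div_le_self _ _)
    have h2 : n * j + n ≤ n * m := by
      rw [← Nat.mul_succ]; exact Nat.mul_le_mul_left n hj
    have h3 : ((n * (j / (n - 1)) : ℕ) : ℤ) ≤ (n * j : ℕ) := by exact_mod_cast h1
    push_cast at h3
    have h4 : ((n * j + n : ℕ) : ℤ) ≤ (n * m : ℕ) := by exact_mod_cast h2
    push_cast at h4 ⊢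
    have h5 : ((j % (n - 1) : ℕ) : ℤ) < n := by omega
    push_cast at h5
    linarith

lemma latWeight_ne_zero (hn : 2 ≤ n) {m : ℕ} (x : Fin m → ℤ) (hx : 0 ≤ x) (hx0 : x ≠ 0) :
    latWeight n m x ≠ 0 := by
  intro h
  have h1 := congrArg (posForm n m) h
  rw [latWeight_apply, map_sum, map_zero] at h1
  simp only [map_zsmul, smul_eq_mul] at h1
  rw [Finset.sum_eq_zero_iff_of_nonneg (fun j _ =>
    mul_nonneg (hx j) (posForm_stepWeight hn j.2).le)] at h1
  apply hx0
  ext j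
  have := h1 j (Finset.mem_univ j)
  rcases mul_eq_zero.1 this with h2 | h2
  · exact h2
  · exact absurd h2 (posForm_stepWeight hn j.2).ne'

/-- Positions in a block differ by `(n - 1) t`, which changes both terms of the step weight by the
same multiple of `δ`. The last coordinate, whose second term is missing, shares its block with no
earlier node. -/
lemma latWeight_key {N m : ℕ} {k : ℤ} {y : ℕ → ℤ} (hy : IsPattern n N k y) (hN : N + 1 = n + m)
    (i j : Fin m) (h : nodeKey n k y (n + i) = nodeKey n k y (n + j)) (c : ℤ) :
    latWeight n m (Pi.single i c) = latWeight n m (Pi.single j c) := by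
  have key : ∀ i j : Fin m, i < j → nodeKey n k y (n + j) = nodeKey n k y (n + i) →
      stepWeight n m j = stepWeight n m i := by
    intro i j hij h
    have hij' : (i : ℕ) < j := hij
    obtain ⟨t, -, -, h1⟩ := hy.exists_mul_of_blockKey_eq (by omega) h
    have h2 := hy.lt_of_nodeKey_eq (by omega) (by omega) h
    have h3 : (j : ℕ) = i + (n - 1) * t := by omega
    unfold stepWeight
    rw [if_pos (by omega), if_pos (by omega), h3, varWeight_add_mul hy.two_le,
      show (i : ℕ) + (n - 1) * t + 1 = i + 1 + (n - 1) * t by ring, varWeight_add_mul hy.two_le]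
    abel
  rw [latWeight_single, latWeight_single]
  rcases lt_trichotomy i j with h1 | h1 | h1
  · rw [key i j h1 h.symm]
  · rw [h1]
  · rw [key j i h1 h]

end Weights

/-! ### The tangent cone of a regular pattern -/

section Dual

variable {H κ : Type*} [AddCommGroup H] [Fintype κ] [DecidableEq κ] {n : ℕ}

/-- A cone given by inequalities that admit a dual basis. -/
lemma HasPhi.dual_cone (st : H →+ Weight n) (e : κ → H →+ ℤ) (ε : κ → H)
    (hd : ∀ i j, e i (ε j) = if i = j then 1 else 0) (he : ∀ x, (∀ i, e i x = 0) → x = 0)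
    (hst : ∀ i, st (ε i) ≠ 0) :
    HasPhi st ({x | ∀ i, 0 ≤ e i x}.indicator 1) (∏ i, (1 - ex (st (ε i)))⁻¹) := by
  have hsum : ∀ (c : κ → ℤ) i, e i (∑ j, c j • ε j) = c i := fun c i => by
    rw [map_sum, Finset.sum_eq_single i]
    · rw [map_zsmul, hd, if_pos rfl, smul_eq_mul, mul_one]
    · intro j _ hj
      rw [map_zsmul, hd, if_neg hj.symm, smul_zero]
    · simp
  have h := HasPhi.cone (st := st) Finset.univ ε 0 (fun i _ => hst i) (fun c hc i _ => by
    rw [← hsum c i, hc, map_zero])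
  rw [map_zero, ex_zero, one_mul] at h
  convert h using 2
  ext x
  simp only [Set.mem_ofPred_eq, zero_add]
  constructor
  · intro hx
    refine ⟨fun i => (e i x).toNat, ?_⟩
    rw [← sub_eq_zero]
    refine he _ fun i => ?_
    have := hsum (fun i => ((e i x).toNat : ℤ)) i
    simp only [natCast_zsmul] at this
    rw [map_sub, this, Int.toNat_of_nonneg (hx i), sub_self]
  · rintro ⟨c, rfl⟩ i
    have := hsum (fun i => (c i : ℤ)) i
    simp only [natCast_zsmul] at this
    rw [this]
    exact Int.natCast_nonneg _

end Dual

section Regular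

variable {n N : ℕ} {k : ℤ} {y : ℕ → ℤ}

/-- The lower neighbour of a node of a regular pattern. -/
def lowerNode (n : ℕ) (y : ℕ → ℤ) (P : ℕ) : ℕ := if y (P - 1) = y P then P - 1 else P - n

/-- The sign of the inequality between a node and its lower neighbour. -/
def lowerSign (y : ℕ → ℤ) (P : ℕ) : ℤ := if y (P - 1) = y P then 1 else -1

lemma lowerSign_mul_self (P : ℕ) : lowerSign y P * lowerSign y P = 1 := by
  unfold lowerSign; split_ifs <;> rfl

lemma lowerNode_lt (hn : 2 ≤ n) {P : ℕ} (hP : n ≤ P) : lowerNode n y P < P := by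
  unfold lowerNode; split_ifs <;> omega

/-- The indicator of the nodes above `P`. -/
def above (n : ℕ) (y : ℕ → ℤ) (P : ℕ) (Q : ℕ) : ℤ :=
  if Q = P then 1 else if h : n ≤ Q ∧ 2 ≤ n then above n y P (lowerNode n y Q) else 0
termination_by Q
decreasing_by exact lowerNode_lt h.2 h.1

lemma above_self (P : ℕ) : above n y P P = 1 := by
  unfold above; rw [if_pos rfl]

lemma above_of_ne (hn : 2 ≤ n) {P Q : ℕ} (hQ : n ≤ Q) (h : Q ≠ P) :
    above n y P Q = above n y P (lowerNode n y Q) := by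
  rw [above, if_neg h, dif_pos ⟨hQ, hn⟩]

lemma above_of_lt (hn : 2 ≤ n) {P Q : ℕ} (h : Q < P) : above n y P Q = 0 := by
  induction Q using Nat.strong_induction_on with
  | _ Q ih =>
  by_cases hQ : n ≤ Q
  · rw [above_of_ne hn hQ h.ne]
    have := lowerNode_lt (y := y) hn hQ
    exact ih _ this (by omega)
  · rw [above, if_neg h.ne, dif_neg (by tauto)]

lemma above_base {P Q : ℕ} (hP : n ≤ P) (hQ : Q < n) : above n y P Q = 0 := by
  rw [above, if_neg (by omega), dif_neg (by omega)]

lemma above_child (hn : 2 ≤ n) {P c : ℕ} (hP : n ≤ P) (hc : n ≤ c) (hcl : lowerNode n y c = P)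
    (huniq : ∀ Q, n ≤ Q → Q ≤ N → lowerNode n y Q = P → Q = c) {Q : ℕ} (hQ : Q ≤ N) :
    above n y P Q = (if Q = P then 1 else 0) + above n y c Q := by
  have hPc : P < c := hcl ▸ lowerNode_lt hn hc
  induction Q using Nat.strong_induction_on with
  | _ Q ih =>
  by_cases h1 : Q = P
  · rw [h1, above_self, above_of_lt hn hPc, if_pos rfl, add_zero]
  rw [if_neg h1, zero_add]
  rcases Nat.lt_or_ge Q n with h2 | h2
  · rw [above_base hP h2, above_base hc h2]
  have hlt := lowerNode_lt (y := y) hn h2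
  rw [above_of_ne hn h2 h1, ih _ hlt (by omega)]
  by_cases h3 : Q = c
  · rw [h3, hcl, if_pos rfl, above_of_lt hn hPc, above_self, add_zero]
  · rw [above_of_ne hn h2 h3, if_neg (fun h => h3 (huniq Q h2 hQ h)), zero_add]

lemma above_leaf (hn : 2 ≤ n) {P : ℕ} (hP : n ≤ P)
    (hleaf : ∀ Q, n ≤ Q → Q ≤ N → lowerNode n y Q ≠ P) {Q : ℕ} (hQ : Q ≤ N) :
    above n y P Q = if Q = P then 1 else 0 := by
  induction Q using Nat.strong_induction_on with
  | _ Q ih =>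
  by_cases h1 : Q = P
  · rw [h1, above_self, if_pos rfl]
  rcases Nat.lt_or_ge Q n with h2 | h2
  · rw [above_base hP h2, if_neg h1]
  have hlt := lowerNode_lt (y := y) hn h2
  rw [above_of_ne hn h2 h1, ih _ hlt (by omega), if_neg (hleaf Q h2 hQ), if_neg h1]

lemma IsRegularPattern.lower (hreg : IsRegularPattern n N k y) {P : ℕ} (hP : n ≤ P) (hPN : P ≤ N) :
    (y (P - 1) = y P ∧ lowerNode n y P = P - 1) ∨
      (y P = y (P - n) + k ∧ lowerNode n y P = P - n ∧ y (P - 1) ≠ y P) := by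
  unfold lowerNode
  by_cases h : y (P - 1) = y P
  · exact Or.inl ⟨h, if_pos h⟩
  · exact Or.inr ⟨(hreg.2 P hP hPN).resolve_left h, if_neg h, h⟩

/-- Otherwise `P - n` and `P - 1` would lie in one block. -/
lemma IsRegularPattern.not_both (hy : IsPattern n N k y) (hreg : IsRegularPattern n N k y) {P : ℕ}
    (hP : n ≤ P) (hPN : P ≤ N) (h1 : y (P - 1) = y P) (h2 : y P = y (P - n) + k) : False := by
  have hn := hy.two_le
  refine hreg.1 (P - n) (P - 1) (by omega) (by omega) ?_
  refine (blockKey_eq_iff hy.pos).2 ⟨1, by linarith, ?_⟩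
  omega

/-- All nodes with lower neighbour `P` lie in the block of level `y P` and position `P + 1`, which
has at most one node. So the nodes above `P` form a chain. -/
lemma IsRegularPattern.child_unique (hy : IsPattern n N k y) (hreg : IsRegularPattern n N k y)
    {P Q Q' : ℕ} (hQ : n ≤ Q) (hQN : Q ≤ N) (hQ' : n ≤ Q') (hQN' : Q' ≤ N)
    (h : lowerNode n y Q = P) (h' : lowerNode n y Q' = P) : Q = Q' := by
  have hn := hy.two_le
  have key : ∀ Q, n ≤ Q → Q ≤ N → lowerNode n y Q = P →
      nodeKey n k y Q = blockKey n k (y P) ((P : ℤ) + 1) := by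
    intro Q hQ hQN h
    rcases hreg.lower hQ hQN with ⟨h1, h2⟩ | ⟨h1, h2, -⟩
    · rw [h2] at h
      subst h
      refine (blockKey_eq_iff hy.pos).2 ⟨0, by linarith, by omega⟩
    · rw [h2] at h
      subst h
      refine (blockKey_eq_iff hy.pos).2 ⟨1, by linarith, by omega⟩
  have e := (key Q hQ hQN h).trans (key Q' hQ' hQN' h').symm
  rcases lt_trichotomy Q Q' with h1 | h1 | h1
  · exact absurd e.symm (hreg.1 Q Q' h1 hQN')
  · exact h1
  · exact absurd e (hreg.1 Q' Q h1 hQN)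

variable {m : ℕ}

/-- The indicator of the nodes above a free node, in the coordinates of the free nodes. -/
def aboveVec (n : ℕ) (y : ℕ → ℤ) (m P : ℕ) : Fin m → ℤ := fun j => above n y P (n + j)

lemma nodeVal_aboveVec (hN : N + 1 = n + m) {P Q : ℕ} (hP : n ≤ P) (hQ : Q ≤ N) :
    nodeVal n (aboveVec n y m P) Q = above n y P Q := by
  rcases free_or_not n m Q with ⟨j, rfl⟩ | h
  · rw [nodeVal_add_fin]; rfl
  · rw [nodeVal_of_lt _ (by omega), above_base hP (by omega)]

/-- The nodes above `P` form a chain whose steps go up by 1 or `n` positions. Each contributes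
`varWeight` at its own position minus `varWeight` at the next one, and the latter agrees with the
first term of the next node up to `δ`, as `n` and 1 differ by `n - 1`. The sum telescopes, and this
makes the weight a root. -/
lemma latWeight_aboveVec (hy : IsPattern n N k y) (hN : N + 1 = n + m)
    (hreg : IsRegularPattern n N k y) {P : ℕ} (hP : n ≤ P) (hPN : P ≤ N) :
    ∃ X ∈ levelWeights n, latWeight n m (aboveVec n y m P) = varWeight n (P - n) - X := by
  have hn := hy.two_le
  have hsingle : latWeight n m (fun j : Fin m => if n + (j : ℕ) = P then (1 : ℤ) else 0) =
      stepWeight n m (P - n) := by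
    rw [← one_smul ℤ (stepWeight n m (P - n)), ← latWeight_single m ⟨P - n, by omega⟩]
    congr 1
    ext j
    rw [Pi.single_apply]
    refine if_congr ?_ rfl rfl
    rw [Fin.ext_iff]
    simp only
    omega
  induction hd : N - P using Nat.strong_induction_on generalizing P with
  | _ d ih =>
  by_cases hleaf : ∃ c, n ≤ c ∧ c ≤ N ∧ lowerNode n y c = P
  · obtain ⟨c, hc, hcN, hcl⟩ := hleaf
    have hPc : P < c := hcl ▸ lowerNode_lt hn hc
    obtain ⟨X, hX, h1⟩ := ih (N - c) (by omega) hc hcN (by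
      rw [← one_smul ℤ (stepWeight n m (c - n)), ← latWeight_single m ⟨c - n, by omega⟩]
      congr 1
      ext j
      rw [Pi.single_apply]
      refine if_congr ?_ rfl rfl
      rw [Fin.ext_iff]
      simp only
      omega) rfl
    have h2 : aboveVec n y m P = (fun j : Fin m => if n + (j : ℕ) = P then (1 : ℤ) else 0) + aboveVec n y m c := by
      ext j
      exact above_child hn hP hc hcl (fun Q hQ hQN h =>
        hreg.child_unique hy hQ hQN hc hcN h hcl) (by omega)
    rw [h2, map_add, hsingle, h1, stepWeight, if_pos (by omega)]
    rcases hreg.lower hc hcN with ⟨-, h3⟩ | ⟨-, h3, -⟩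
    · refine ⟨X, hX, ?_⟩
      rw [show c - n = P - n + 1 by omega]
      abel
    · refine ⟨X + (1 : ℤ) • delta n, add_delta_mem hX 1, ?_⟩
      have := varWeight_add_mul hn (P - n + 1) 1
      rw [show P - n + 1 + (n - 1) * 1 = c - n by omega] at this
      rw [this]
      push_cast
      module
  · push Not at hleaf
    have h2 : aboveVec n y m P = (fun j : Fin m => if n + (j : ℕ) = P then (1 : ℤ) else 0) := by
      ext j
      exact above_leaf hn hP hleaf (by omega)
    rw [h2, hsingle, stepWeight]
    exact ⟨_, by split_ifs; exacts [varWeight_mem hn _, zero_mem_levelWeights hn], rfl⟩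

lemma mem_patternCone_iff (hy : IsPattern n N k y) (d : Fin m → ℤ) :
    d ∈ patternCone n N k y m ↔ ∀ P, n ≤ P → P ≤ N →
      (y (P - 1) = y P → nodeVal n d (P - 1) ≤ nodeVal n d P) ∧
      (y P = y (P - n) + k → nodeVal n d P ≤ nodeVal n d (P - n)) := by
  unfold patternCone IsInterlacing
  rw [Set.mem_ofPred_eq]
  refine forall_congr' fun P => forall₂_congr fun hP hPN => and_congr ?_ ?_
  · refine forall_congr' fun h => ?_
    rw [shiftVal, shiftVal, h]
    omega
  · refine forall_congr' fun h => ?_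
    rw [shiftVal, shiftVal, h, show y (P - n) + k = y (P - n) + 1 * k by ring,
      Int.add_mul_ediv_right _ _ hy.pos.ne']
    omega

/-- The generating function of the tangent cone of a regular pattern. -/
theorem IsRegularPattern.hasPhi (hy : IsPattern n N k y) (hN : N + 1 = n + m)
    (hreg : IsRegularPattern n N k y) : ∃ β : Fin m → Weight n, (∀ j, IsRoot n (β j)) ∧
      HasPhi (latWeight n m) ((patternCone n N k y m).indicator 1) (∏ j, (1 - ex (β j))⁻¹) := by
  have hn := hy.two_le
  -- Moving all nodes above a node changes, among the chosen inequalities, only the one between that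
  -- node and its lower neighbour; this gives the dual basis up to sign.
  set ε : Fin m → Fin m → ℤ := fun j => lowerSign y (n + j) • aboveVec n y m (n + j) with hε
  have hnv : ∀ P, ∃ φ : (Fin m → ℤ) →+ ℤ, ∀ d, φ d = nodeVal n d P := fun P =>
    ⟨⟨⟨fun d => nodeVal n d P, by unfold nodeVal; split_ifs <;> rfl⟩, fun d e => by
      simp only [nodeVal]; split_ifs
      · rfl
      · rfl⟩, fun d => rfl⟩
  choose φ hφ using hnv
  set e : Fin m → (Fin m → ℤ) →+ ℤ := fun j =>
    lowerSign y (n + j) • (φ (n + j) - φ (lowerNode n y (n + j))) with he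
  have he' : ∀ j d, e j d = lowerSign y (n + j) *
      (nodeVal n d (n + j) - nodeVal n d (lowerNode n y (n + j))) := fun j d => by
    simp only [he, AddMonoidHom.coe_smul, Pi.smul_apply, AddMonoidHom.sub_apply, hφ, smul_eq_mul]
  have hst : ∀ j, IsRoot n (latWeight n m (ε j)) := fun j => by
    obtain ⟨X, hX, h1⟩ := latWeight_aboveVec (P := n + j) hy hN hreg (by omega) (by omega)
    have h2 : latWeight n m (aboveVec n y m (n + j)) ≠ 0 := by
      refine latWeight_ne_zero hn _ (fun i => ?_) fun h => ?_
      · have hnn : ∀ P Q, 0 ≤ above n y P Q := by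
          intro P Q
          induction Q using Nat.strong_induction_on with
          | _ Q ih =>
          unfold above
          split_ifs with h1 h2
          · norm_num
          · exact ih _ (lowerNode_lt h2.2 h2.1)
          · norm_num
        exact hnn _ _
      · have := congrFun h j
        unfold aboveVec at this
        rw [above_self] at this
        exact one_ne_zero this
    have h3 : IsRoot n (latWeight n m (aboveVec n y m (n + j))) := by
      rw [h1] at h2 ⊢
      exact isRoot_sub (varWeight_mem hn _) hX h2
    simp only [hε, map_zsmul]
    unfold lowerSign
    split_ifs
    · rwa [one_smul]
    · rw [neg_smul, one_smul]; exact h3.neg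
  refine ⟨fun j => latWeight n m (ε j), hst, ?_⟩
  convert HasPhi.dual_cone (latWeight n m) e ε ?_ ?_ (fun j => (hst j).ne_zero) using 2
  · ext d
    rw [mem_patternCone_iff hy, Set.mem_ofPred_eq]
    constructor
    · intro h j
      rw [he']
      have h1 := h (n + j) (by omega) (by omega)
      unfold lowerSign
      rcases hreg.lower (P := n + j) (by omega) (by omega) with ⟨h2, h3⟩ | ⟨h2, h3, h4⟩
      · have := h1.1 h2
        rw [if_pos h2, h3]; linarith
      · have := h1.2 h2
        rw [if_neg h4, h3]; linarith
    · intro h P hP hPN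
      have h1 := h ⟨P - n, by omega⟩
      rw [he'] at h1
      simp only [show n + (P - n) = P by omega] at h1
      unfold lowerSign at h1
      refine ⟨fun h2 => ?_, fun h2 => ?_⟩
      · rw [if_pos h2, lowerNode, if_pos h2] at h1
        linarith
      · have h3 : y (P - 1) ≠ y P := fun h3 => hreg.not_both hy hP hPN h3 h2
        rw [if_neg h3, lowerNode, if_neg h3] at h1
        linarith
  · intro i j
    have hl := lowerNode_lt (y := y) (P := n + i) hn (by omega)
    have h0 : ∀ Q, nodeVal n (ε j) Q = lowerSign y (n + j) * nodeVal n (aboveVec n y m (n + j)) Q := by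
      intro Q
      unfold nodeVal
      split_ifs
      · rfl
      · rw [mul_zero]
    rw [he', h0, h0, nodeVal_aboveVec hN (by omega) (by omega),
      nodeVal_aboveVec hN (by omega) (by omega)]
    split_ifs with h
    · subst h
      rw [above_self, above_of_lt hn hl]
      linear_combination lowerSign_mul_self (y := y) (n + i)
    · rw [above_of_ne hn (by omega) (fun h' => h (Fin.ext (by omega)))]
      ring
  · intro d hd
    have h1 : ∀ P ≤ N, nodeVal n d P = 0 := by
      intro P
      induction P using Nat.strong_induction_on with
      | _ P ih =>
      intro hPN
      rcases free_or_not n m P with ⟨j, rfl⟩ | h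
      · have h2 := hd j
        have h3 := lowerNode_lt (y := y) (P := n + j) hn (by omega)
        rw [he', ih _ h3 (by omega), sub_zero] at h2
        rcases mul_eq_zero.1 h2 with h4 | h4
        · have := lowerSign_mul_self (y := y) (n + j)
          rw [h4] at this
          norm_num at this
        · exact h4
      · exact nodeVal_of_lt _ (by omega)
    ext j
    rw [← nodeVal_add_fin (n := n) d j, h1 _ (by omega)]
    rfl

end Regular

end InfBrion

end

noncomputable section

namespace InfBrion

/-! ### Nodes and slacks -/

section Nodes

variable {R : Type*} [AddCommGroup R]

/-- The partial sums of a sequence, as a function on the nodes. -/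
def nod (n : ℕ) (x : ℕ →₀ R) (P : ℕ) : R := psum x (P + 1 - n)

variable {n : ℕ}

lemma nod_of_lt (x : ℕ →₀ R) {P : ℕ} (h : P < n) : nod n x P = 0 := by
  rw [nod, show P + 1 - n = 0 by omega, psum_zero]

lemma nod_add (x y : ℕ →₀ R) (P : ℕ) : nod n (x + y) P = nod n x P + nod n y P := psum_add _ _ _

lemma nod_sub (x y : ℕ →₀ R) (P : ℕ) : nod n (x - y) P = nod n x P - nod n y P := psum_sub _ _ _

lemma ext_nod (hn : 1 ≤ n) {x y : ℕ →₀ R} (h : ∀ P, nod n x P = nod n y P) : x = y := by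
  refine ext_psum fun q => ?_
  have := h (q + n - 1)
  rwa [nod, nod, show q + n - 1 + 1 - n = q by omega] at this

lemma nod_zero (P : ℕ) : nod n (0 : ℕ →₀ R) P = 0 := by simp [nod, psum]

lemma exists_nod_const (x : ℕ →₀ R) : ∃ M, ∀ P, M ≤ P → nod n x P = nod n x M := by
  obtain ⟨B, hB⟩ : ∃ B, ∀ i, B ≤ i → x i = 0 :=
    ⟨x.support.sup id + 1, fun i hi => by
      by_contra h
      have := Finset.le_sup (f := id) (Finsupp.mem_support_iff.2 h)
      simp only [id] at this
      omega⟩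
  refine ⟨B + n, fun P hP => ?_⟩
  rw [nod, nod, psum_of_le hB (by omega), psum_of_le hB (q := B + n + 1 - n) (by omega)]

lemma exists_of_nod (hn : 1 ≤ n) (θ : ℕ → R) (h0 : ∀ P, P < n → θ P = 0) (M : ℕ)
    (hM : ∀ P, M ≤ P → θ P = θ M) : ∃ x : ℕ →₀ R, ∀ P, nod n x P = θ P := by
  refine ⟨Finsupp.onFinset (Finset.range M) (fun i => θ (i + 1 + (n - 1)) - θ (i + (n - 1)))
    (fun i h => ?_), fun P => ?_⟩
  · by_contra hi
    simp only [Finset.mem_range, not_lt] at hi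
    exact h (by rw [hM _ (by omega), hM (i + (n - 1)) (by omega), sub_self])
  · unfold nod psum
    simp only [Finsupp.onFinset_apply]
    rw [Finset.sum_range_sub fun i => θ (i + (n - 1)), zero_add, h0 (n - 1) (by omega), sub_zero]
    rcases Nat.lt_or_ge P n with h | h
    · rw [show P + 1 - n + (n - 1) = n - 1 by omega, h0 P h, h0 _ (by omega)]
    · congr 1; omega

lemma exists_nod_comp (hn : 1 ≤ n) (x : ℕ →₀ R) (φ : R → R) (hφ : φ 0 = 0) :
    ∃ x' : ℕ →₀ R, ∀ P, nod n x' P = φ (nod n x P) := by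
  obtain ⟨M, hM⟩ := exists_nod_const (n := n) x
  exact exists_of_nod hn _ (fun P hP => by rw [nod_of_lt x hP, hφ]) M fun P hP => by rw [hM P hP]

/-- The lower node of an inequality of the polytope. -/
def lo (n : ℕ) : ℕ ⊕ ℕ → ℕ
  | Sum.inl i => i + n - 1
  | Sum.inr i => i + n

/-- The upper node of an inequality of the polytope. -/
def hi (n : ℕ) : ℕ ⊕ ℕ → ℕ
  | Sum.inl i => i + n
  | Sum.inr i => i

lemma nod_row (hn : 1 ≤ n) (x : ℕ →₀ R) (i : ℕ) : x i = nod n x (i + n) - nod n x (i + n - 1) := by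
  rw [nod, nod, show i + n + 1 - n = i + 1 by omega, show i + n - 1 + 1 - n = i by omega, psum_succ,
    add_sub_cancel_left]

end Nodes

lemma psum_toReal (x : ℕ →₀ ℤ) (q : ℕ) : psum (toReal x) q = psum x q := by
  unfold psum toReal
  push_cast
  rfl

lemma nod_toReal (n : ℕ) (x : ℕ →₀ ℤ) (P : ℕ) : nod n (toReal x) P = nod n x P := psum_toReal _ _

lemma toReal_injective : Function.Injective toReal :=
  Finsupp.mapRange_injective _ Int.cast_zero Int.cast_injective

lemma toReal_add (x y : ℕ →₀ ℤ) : toReal (x + y) = toReal x + toReal y := by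
  ext i; simp [toReal]

lemma toReal_sub (x y : ℕ →₀ ℤ) : toReal (x - y) = toReal x - toReal y := by
  ext i; simp [toReal]

lemma nod_smul {n : ℕ} (t : ℝ) (x : ℕ →₀ ℝ) (P : ℕ) : nod n (t • x) P = t * nod n x P := by
  unfold nod psum
  rw [Finset.mul_sum]
  rfl

lemma psi_eq {n : ℕ} (x : ℕ →₀ ℝ) (i : ℕ) : psi n i x = nod n x (i + n) - nod n x i := by
  unfold psi nod psum
  rw [show i + n + 1 - n = i + 1 by omega, Finset.sum_range_sub_sum_range (by omega)]
  refine Finset.sum_congr ?_ fun _ _ => rfl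
  ext j
  simp only [Finset.mem_Icc, Finset.mem_filter, Finset.mem_range]
  omega

/-! ### Vertices, edges and vertex cones of Π through rigidity. -/

section Polytope

variable {n : ℕ} (a : Fin n → ℕ)

/-- The difference of the two sides of an inequality of the polytope. -/
def slack : ℕ ⊕ ℕ → (ℕ →₀ ℝ) → ℝ
  | Sum.inl i, x => x i
  | Sum.inr i, x => bound a i - psi n i x

lemma slack_add (hn : 1 ≤ n) (c : ℕ ⊕ ℕ) (x y : ℕ →₀ ℝ) :
    slack a c (x + y) = slack a c x + (nod n y (hi n c) - nod n y (lo n c)) := by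
  rcases c with i | i
  · simp only [slack, hi, lo, Finsupp.add_apply]
    rw [← nod_row hn]
  · simp only [slack, hi, lo, psi_eq, nod_add]
    ring

lemma mem_polytope_iff {x : ℕ →₀ ℝ} : x ∈ polytope a ↔ ∀ c, 0 ≤ slack a c x := by
  unfold polytope
  rw [Set.mem_ofPred_eq, Sum.forall]
  simp only [slack, sub_nonneg]

/-- The facets. -/
def facet (c : ℕ ⊕ ℕ) : Set (ℕ →₀ ℝ) := {x ∈ polytope a | slack a c x = 0}

lemma facet_inl (i : ℕ) : facet a (Sum.inl i) = facetD a i := rfl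

lemma facet_inr (i : ℕ) : facet a (Sum.inr i) = facetG a i := by
  ext x
  simp only [facet, facetG, slack, Set.mem_ofPred_eq, sub_eq_zero]
  exact and_congr Iff.rfl eq_comm

lemma mem_facetsThrough {A X : Set (ℕ →₀ ℝ)} :
    X ∈ facetsThrough a A ↔ (∃ c, X = facet a c) ∧ A ⊆ X := by
  unfold facetsThrough
  simp only [Set.mem_ofPred_eq, Set.mem_union, Set.mem_range, Sum.exists, facet_inl, facet_inr]
  constructor
  · rintro ⟨⟨i, rfl⟩ | ⟨i, rfl⟩, h⟩
    exacts [⟨Or.inr ⟨i, rfl⟩, h⟩, ⟨Or.inl ⟨i, rfl⟩, h⟩]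
  · rintro ⟨⟨i, rfl⟩ | ⟨i, rfl⟩, h⟩
    exacts [⟨Or.inr ⟨i, rfl⟩, h⟩, ⟨Or.inl ⟨i, rfl⟩, h⟩]

lemma facetsThrough_subset_iff {A B : Set (ℕ →₀ ℝ)} (hB : B ⊆ polytope a) (hA : A ⊆ polytope a) :
    facetsThrough a A ⊆ facetsThrough a B ↔
      ∀ c, (∀ x ∈ A, slack a c x = 0) → ∀ x ∈ B, slack a c x = 0 := by
  constructor
  · intro h c hc x hx
    have := (mem_facetsThrough a).1 (h ((mem_facetsThrough a).2 ⟨⟨c, rfl⟩, fun x hx => ⟨hA hx, hc x hx⟩⟩))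
    exact (this.2 hx).2
  · intro h X hX
    obtain ⟨⟨c, rfl⟩, hc⟩ := (mem_facetsThrough a).1 hX
    exact (mem_facetsThrough a).2 ⟨⟨c, rfl⟩, fun x hx =>
      ⟨hB hx, h c (fun x hx => (hc hx).2) x hx⟩⟩

lemma isVertex_iff {u : ℕ →₀ ℝ} : IsVertex a u ↔ u ∈ polytope a ∧ ∀ v ∈ polytope a,
    (∀ c, slack a c u = 0 → slack a c v = 0) → ∀ c, slack a c v = 0 → slack a c u = 0 := by
  unfold IsVertex
  refine and_congr_right fun hu => forall₂_congr fun v hv => ?_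
  rw [facetsThrough_subset_iff a (by simpa using hv) (by simpa using hu),
    facetsThrough_subset_iff a (by simpa using hu) (by simpa using hv)]
  simp

/-- No nonempty set of free nodes is separated from its complement by inequalities that are strict
at `u`. -/
def IsRigid (u : ℕ →₀ ℝ) : Prop := ∀ (S : Set ℕ) (M : ℕ), (∀ P ∈ S, n ≤ P) →
  (∀ P, M ≤ P → (P ∈ S ↔ M ∈ S)) → (∀ c, slack a c u = 0 → (lo n c ∈ S ↔ hi n c ∈ S)) → S = ∅

variable {a}

/-- If `v` lies on all facets through `u`, the partial sums of `v - u` agree at the two ends of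
every inequality tight at `u`; by rigidity they all vanish, so `v = u`. -/
lemma IsRigid.isVertex (hn : 1 ≤ n) {u : ℕ →₀ ℝ} (hu : u ∈ polytope a) (h : IsRigid a u) :
    IsVertex a u := by
  refine (isVertex_iff a).2 ⟨hu, fun v hv huv c hc => ?_⟩
  obtain ⟨M, hM⟩ := exists_nod_const (n := n) (v - u)
  have := h {P | nod n (v - u) P ≠ 0} M (fun P hP => by
    by_contra hlt
    exact hP (nod_of_lt _ (by omega))) (fun P hP => by
    rw [Set.mem_ofPred_eq, Set.mem_ofPred_eq, hM P hP]) (fun c hc => by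
    have h1 := slack_add a hn c u (v - u)
    rw [add_sub_cancel, huv c hc, hc, zero_add] at h1
    rw [Set.mem_ofPred_eq, Set.mem_ofPred_eq, sub_eq_zero.1 h1.symm])
  have h2 : v - u = 0 := ext_nod hn fun P => by
    rw [nod_zero]
    by_contra h3
    have : P ∈ {P | nod n (v - u) P ≠ 0} := h3
    simp_all
  rwa [← sub_eq_zero.1 h2]

/-- If `S` is not separated from its complement by tight inequalities, all partial sums over `S` can
be lowered by `t` without leaving the facets through `u`. The largest `t` that stays in Π reaches a
new facet, against maximality. -/
lemma IsVertex.rigid (hn : 1 ≤ n) {u : ℕ →₀ ℝ} (hu : IsVertex a u) : IsRigid a u := by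
  classical
  intro S M hS hM hE
  by_contra hne
  obtain ⟨hu, hmax⟩ := (isVertex_iff a).1 hu
  have hex : ∃ P, P ∈ S := Set.nonempty_iff_ne_empty.2 hne
  obtain ⟨ε, hε⟩ := exists_of_nod hn (fun P => if P ∈ S then (-1 : ℝ) else 0)
    (fun P hP => if_neg fun h => by have := hS P h; omega) M
    (fun P hP => by simp only [hM P hP])
  set dl : ℕ ⊕ ℕ → ℝ := fun c => nod n ε (hi n c) - nod n ε (lo n c) with hdl
  set D := ((Finset.range M).disjSum (Finset.range M)).filter fun c => dl c < 0 with hD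
  have hDmem : ∀ c, dl c < 0 → c ∈ D ∧ dl c = -1 ∧ 0 < slack a c u := by
    intro c hc
    refine ⟨?_, ?_, ?_⟩
    · rw [hD, Finset.mem_filter]
      refine ⟨?_, hc⟩
      by_contra h
      have h1 : M ≤ lo n c ∧ M ≤ hi n c := by
        rcases c with i | i <;>
          simp only [Finset.inl_mem_disjSum, Finset.inr_mem_disjSum, Finset.mem_range] at h <;>
          simp only [lo, hi] <;> omega
      simp only [hdl, hε, hM _ h1.1, hM _ h1.2, sub_self, lt_irrefl] at hc
    · simp only [hdl, hε] at hc ⊢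
      split_ifs at hc ⊢ <;> first | (norm_num at hc; done) | norm_num
    · refine lt_of_le_of_ne ((mem_polytope_iff a).1 hu c) fun h => ?_
      have := hE c h.symm
      simp only [hdl, hε, this, sub_self, lt_irrefl] at hc
  -- At the first node of `S` the inequality with the preceding node gets tighter, so the largest
  -- `t` is finite; only finitely many inequalities are affected, so it is attained.
  obtain ⟨P, hP, hPmin⟩ : ∃ P ∈ S, ∀ Q, Q < P → Q ∉ S :=
    ⟨Nat.find hex, Nat.find_spec hex, fun Q hQ => Nat.find_min hex hQ⟩
  have hPn := hS P hP
  have hPD : Sum.inl (P - n) ∈ D := by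
    refine (hDmem _ ?_).1
    have e1 : hi n (Sum.inl (P - n)) = P := Nat.sub_add_cancel hPn
    have e2 : lo n (Sum.inl (P - n)) = P - 1 := by simp only [lo]; omega
    simp only [hdl, hε]
    rw [e1, e2, if_pos hP, if_neg (hPmin _ (by omega))]
    norm_num
  obtain ⟨c₀, hc₀, hmin⟩ := D.exists_min_image (fun c => slack a c u) ⟨_, hPD⟩
  have hc₀' : dl c₀ < 0 := (Finset.mem_filter.1 hc₀).2
  obtain ⟨-, h1, h2⟩ := hDmem c₀ hc₀'
  set t := slack a c₀ u with ht
  have hs : ∀ c, slack a c (u + t • ε) = slack a c u + t * dl c := fun c => by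
    rw [slack_add a hn, nod_smul, nod_smul, hdl]
    ring
  refine h2.ne' (hmax (u + t • ε) ((mem_polytope_iff a).2 fun c => ?_) (fun c hc => ?_) c₀ ?_)
  · rw [hs]
    rcases lt_or_ge (dl c) 0 with h3 | h3
    · rw [(hDmem c h3).2.1]
      have := hmin c (hDmem c h3).1
      linarith
    · have := (mem_polytope_iff a).1 hu c
      positivity
  · have h3 := hE c hc
    rw [hs, hc]
    simp only [hdl, hε, h3, sub_self, mul_zero, add_zero]
  · rw [hs, h1, ← ht]; ring

lemma exists_slack_int (c : ℕ ⊕ ℕ) (v : ℕ →₀ ℤ) : ∃ z : ℤ, slack a c (toReal v) = z := by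
  rcases c with i | i
  · exact ⟨v i, by simp [slack, toReal]⟩
  · refine ⟨bound a i - (nod n v (i + n) - nod n v i), ?_⟩
    simp only [slack, psi_eq, nod_toReal]
    push_cast
    ring

/-- Tight inequalities have integral constants, so they do not separate the nodes with non-integral
partial sums from the others; rigidity makes that set empty. -/
lemma IsVertex.exists_int (hn : 1 ≤ n) {u : ℕ →₀ ℝ} (hu : IsVertex a u) :
    ∃ v : ℕ →₀ ℤ, u = toReal v := by
  obtain ⟨M, hM⟩ := exists_nod_const (n := n) u
  have h := hu.rigid hn {P | ¬ ∃ z : ℤ, nod n u P = z} M (fun P hP => by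
    by_contra hlt
    exact hP ⟨0, by rw [nod_of_lt _ (by omega), Int.cast_zero]⟩) (fun P hP => by
    rw [Set.mem_ofPred_eq, Set.mem_ofPred_eq, hM P hP]) (fun c hc => by
    have h1 : ∃ z : ℤ, nod n u (hi n c) = nod n u (lo n c) + z := by
      have := slack_add a hn c 0 u
      rw [zero_add, hc] at this
      obtain ⟨z, hz⟩ := exists_slack_int (a := a) c 0
      have h0 : toReal 0 = 0 := by ext; simp [toReal]
      rw [h0] at hz
      exact ⟨-z, by push_cast; linarith⟩
    obtain ⟨z, hz⟩ := h1
    rw [Set.mem_ofPred_eq, Set.mem_ofPred_eq, not_iff_not]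
    constructor
    · rintro ⟨w, hw⟩
      exact ⟨w + z, by rw [hz, hw]; push_cast; ring⟩
    · rintro ⟨w, hw⟩
      exact ⟨w - z, by push_cast; linarith⟩)
  have h' : ∀ P, ∃ z : ℤ, nod n u P = z := fun P => by
    by_contra h1
    have : P ∈ {P | ¬ ∃ z : ℤ, nod n u P = z} := h1
    simp_all
  refine ⟨u.mapRange (fun r => ⌊r⌋) (by simp), ?_⟩
  ext i
  obtain ⟨z, hz⟩ := h' (i + n)
  obtain ⟨w, hw⟩ := h' (i + n - 1)
  have : u i = (z - w : ℤ) := by rw [nod_row hn, hz, hw]; push_cast; ring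
  simp [toReal, this]

/-! ### Integral points of the vertex cones -/

variable (a) in
/-- The integral directions that satisfy the inequalities which are equalities at `u`. -/
def IsTangent (u : ℕ →₀ ℝ) (ε : ℕ →₀ ℤ) : Prop :=
  ∀ c, slack a c u = 0 → nod n ε (lo n c) ≤ nod n ε (hi n c)

variable (a) in
/-- The indecomposable tangent directions. -/
def IsAtomic (u : ℕ →₀ ℝ) (ε : ℕ →₀ ℤ) : Prop :=
  ε ≠ 0 ∧ IsTangent a u ε ∧ ∀ ε₁ ε₂, IsTangent a u ε₁ → IsTangent a u ε₂ → ε = ε₁ + ε₂ →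
    ε₁ = 0 ∨ ε₂ = 0

open Classical in
variable (a) in
/-- The sum of the values of the inequalities which are equalities at `u`. -/
def tanMeasure (u : ℕ →₀ ℝ) (ε : ℕ →₀ ℤ) : ℤ :=
  ∑ᶠ c, if slack a c u = 0 then nod n ε (hi n c) - nod n ε (lo n c) else 0

lemma tanMeasure_finite (hn : 1 ≤ n) (ε : ℕ →₀ ℤ) :
    {c : ℕ ⊕ ℕ | nod n ε (hi n c) - nod n ε (lo n c) ≠ 0}.Finite := by
  obtain ⟨M, hM⟩ := exists_nod_const (n := n) ε
  refine ((Finset.range M).disjSum (Finset.range M)).finite_toSet.subset fun c hc => ?_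
  by_contra h
  have h1 : M ≤ lo n c ∧ M ≤ hi n c := by
    rcases c with i | i <;>
      simp only [Finset.mem_coe, Finset.inl_mem_disjSum, Finset.inr_mem_disjSum,
        Finset.mem_range] at h <;>
      simp only [lo, hi] <;> omega
  exact hc (by rw [hM _ h1.1, hM _ h1.2, sub_self])

lemma tanMeasure_support (hn : 1 ≤ n) (u : ℕ →₀ ℝ) (ε : ℕ →₀ ℤ) [∀ c, Decidable (slack a c u = 0)] :
    (Function.support fun c => if slack a c u = 0 then nod n ε (hi n c) - nod n ε (lo n c)
      else 0).Finite :=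
  (tanMeasure_finite hn ε).subset fun c hc => by
    rw [Function.mem_support] at hc
    rw [Set.mem_ofPred_eq]
    split_ifs at hc
    · exact hc
    · exact absurd rfl hc

lemma tanMeasure_add (hn : 1 ≤ n) (u : ℕ →₀ ℝ) (ε₁ ε₂ : ℕ →₀ ℤ) :
    tanMeasure a u (ε₁ + ε₂) = tanMeasure a u ε₁ + tanMeasure a u ε₂ := by
  classical
  unfold tanMeasure
  rw [← finsum_add_distrib (tanMeasure_support hn u ε₁) (tanMeasure_support hn u ε₂)]
  refine finsum_congr fun c => ?_
  split_ifs
  · rw [nod_add, nod_add]; ring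
  · rfl

lemma IsTangent.exists_lt (hn : 1 ≤ n) {u : ℕ →₀ ℝ} (hu : IsVertex a u) {ε : ℕ →₀ ℤ}
    (h : IsTangent a u ε) (hε : ε ≠ 0) : ∃ c, slack a c u = 0 ∧ nod n ε (lo n c) < nod n ε (hi n c) := by
  by_contra! hle
  apply hε
  obtain ⟨M, hM⟩ := exists_nod_const (n := n) ε
  have := hu.rigid hn {P | nod n ε P ≠ 0} M (fun P hP => by
    by_contra hlt
    exact hP (nod_of_lt _ (by omega))) (fun P hP => by
    rw [Set.mem_ofPred_eq, Set.mem_ofPred_eq, hM P hP]) (fun c hc => by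
    rw [Set.mem_ofPred_eq, Set.mem_ofPred_eq, le_antisymm (h c hc) (hle c hc)])
  refine ext_nod hn fun P => ?_
  rw [nod_zero]
  by_contra h3
  have : P ∈ {P | nod n ε P ≠ 0} := h3
  simp_all

lemma IsTangent.measure_pos (hn : 1 ≤ n) {u : ℕ →₀ ℝ} (hu : IsVertex a u) {ε : ℕ →₀ ℤ}
    (h : IsTangent a u ε) (hε : ε ≠ 0) : 0 < tanMeasure a u ε := by
  classical
  obtain ⟨c, hc, hlt⟩ := h.exists_lt hn hu hε
  refine finsum_pos (fun c => ?_) ⟨c, ?_⟩ (tanMeasure_support hn u ε)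
  · split_ifs with hc
    · have := h c hc; omega
    · exact le_refl _
  · rw [if_pos hc]; omega

/-- When `φ` and `z - φ z` are both monotone, applying them to the partial sums splits `ε` into two
tangent directions, and one of them must vanish. Truncations of the values are used below. -/
lemma IsAtomic.eq_zero_of_comp (hn : 1 ≤ n) {u : ℕ →₀ ℝ} {ε : ℕ →₀ ℤ} (h : IsAtomic a u ε)
    (φ : ℤ → ℤ) (h0 : φ 0 = 0) (hφ : Monotone φ) (hφ' : Monotone fun z => z - φ z) :
    (∀ P, φ (nod n ε P) = 0) ∨ ∀ P, φ (nod n ε P) = nod n ε P := by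
  obtain ⟨ε', hε'⟩ := exists_nod_comp hn ε φ h0
  have := h.2.2 ε' (ε - ε') (fun c hc => by
    rw [hε', hε']; exact hφ (h.2.1 c hc)) (fun c hc => by
    rw [nod_sub, nod_sub, hε', hε']; exact hφ' (h.2.1 c hc)) (by abel)
  rcases this with h1 | h1
  · left; intro P; rw [← hε', h1, nod_zero]
  · right; intro P; rw [← hε', ← sub_eq_zero.1 h1]

lemma IsAtomic.exists_sign (hn : 1 ≤ n) {u : ℕ →₀ ℝ} {ε : ℕ →₀ ℤ} (h : IsAtomic a u ε) :
    ∃ s : ℤ, (s = 1 ∨ s = -1) ∧ ∀ P, nod n ε P = 0 ∨ nod n ε P = s := by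
  rcases h.eq_zero_of_comp hn (fun z => max 0 (min z 1)) (by norm_num)
    (fun x y h => by simp only; omega) (fun x y h => by simp only; omega) with h1 | h1
  · rcases h.eq_zero_of_comp hn (fun z => min 0 (max z (-1))) (by norm_num)
      (fun x y h => by simp only; omega) (fun x y h => by simp only; omega) with h2 | h2
    · exact ⟨1, Or.inl rfl, fun P => by have := h1 P; have := h2 P; omega⟩
    · exact ⟨-1, Or.inr rfl, fun P => by have := h2 P; omega⟩
  · exact ⟨1, Or.inl rfl, fun P => by have := h1 P; omega⟩

/-- If `η` were nonzero somewhere on the zero set of `ε`, or not constant where `ε` has the value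
`s`, a multiple of the indicator of the corresponding set of nodes would split `ε` into two tangent
directions. So the equalities satisfied by `ε` cut out a line. -/
lemma IsAtomic.exists_smul (hn : 1 ≤ n) {u : ℕ →₀ ℝ} {ε : ℕ →₀ ℤ} (h : IsAtomic a u ε)
    {η : ℕ →₀ ℝ} (hη : ∀ c, slack a c u = 0 → nod n ε (lo n c) = nod n ε (hi n c) →
      nod n η (lo n c) = nod n η (hi n c)) :
    ∃ (t : ℝ) (P : ℕ) (s : ℤ), (s = 1 ∨ s = -1) ∧ t = s * nod n η P ∧ η = t • toReal ε := by
  classical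
  obtain ⟨s, hs, hv⟩ := h.exists_sign hn
  obtain ⟨M₁, hM₁⟩ := exists_nod_const (n := n) ε
  obtain ⟨M₂, hM₂⟩ := exists_nod_const (n := n) η
  have hM : ∀ P, max M₁ M₂ ≤ P → nod n ε P = nod n ε (max M₁ M₂) ∧
      nod n η P = nod n η (max M₁ M₂) := fun P hP =>
    ⟨by rw [hM₁ P (by omega), hM₁ _ (le_max_left _ _)],
      by rw [hM₂ P (by omega), hM₂ _ (le_max_right _ _)]⟩
  obtain ⟨P₀, hP₀⟩ : ∃ P, nod n ε P = s := by
    by_contra! hne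
    exact h.1 (ext_nod hn fun P => by rw [nod_zero]; exact (hv P).resolve_right (hne P))
  have hs0 : s ≠ 0 := by omega
  have hout : ∀ P, nod n ε P = 0 → nod n η P = 0 := by
    -- The sign `-s` makes both `ε₂` and `ε - ε₂` respect the tight inequalities that are strict for
    -- `ε`.
    obtain ⟨ε₂, hε₂⟩ := exists_of_nod hn (fun P => if nod n ε P = 0 ∧ nod n η P ≠ 0 then -s else 0)
      (fun P hP => if_neg fun h => h.2 (nod_of_lt _ hP)) (max M₁ M₂)
      (fun P hP => by rw [(hM P hP).1, (hM P hP).2])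
    have key : ∀ c, slack a c u = 0 → nod n ε₂ (lo n c) ≤ nod n ε₂ (hi n c) ∧
        nod n (ε - ε₂) (lo n c) ≤ nod n (ε - ε₂) (hi n c) := by
      intro c hc
      have h1 := h.2.1 c hc
      have h2 := hη c hc
      rw [nod_sub, nod_sub, hε₂, hε₂]
      rcases hv (lo n c) with h3 | h3 <;> rcases hv (hi n c) with h4 | h4
      · rw [h2 (by omega), h3, h4]; omega
      · rw [h3, h4] at h1
        rw [h3, h4]
        split_ifs <;> omega
      · rw [h3, h4] at h1
        rw [h3, h4]
        split_ifs <;> omega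
      · rw [h2 (by omega), h3, h4]; omega
    rcases h.2.2 (ε - ε₂) ε₂ (fun c hc => (key c hc).2) (fun c hc => (key c hc).1)
      (by abel) with h1 | h1
    · have := congrArg (fun x => nod n x P₀) h1
      simp only [nod_sub, nod_zero, hε₂, hP₀] at this
      rw [if_neg (by simp [hs0])] at this
      omega
    · intro P hP
      by_contra hne
      have := hε₂ P
      rw [h1, nod_zero, if_pos ⟨hP, hne⟩] at this
      omega
  have hin : ∀ P, nod n ε P = s → nod n η P = nod n η P₀ := by
    obtain ⟨ε₂, hε₂⟩ := exists_of_nod hn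
      (fun P => if nod n ε P = s ∧ nod n η P ≠ nod n η P₀ then s else 0)
      (fun P hP => if_neg fun h => by rw [nod_of_lt _ hP] at h; omega) (max M₁ M₂)
      (fun P hP => by rw [(hM P hP).1, (hM P hP).2])
    have key : ∀ c, slack a c u = 0 → nod n ε₂ (lo n c) ≤ nod n ε₂ (hi n c) ∧
        nod n (ε - ε₂) (lo n c) ≤ nod n (ε - ε₂) (hi n c) := by
      intro c hc
      have h1 := h.2.1 c hc
      have h2 := hη c hc
      rw [nod_sub, nod_sub, hε₂, hε₂]
      rcases hv (lo n c) with h3 | h3 <;> rcases hv (hi n c) with h4 | h4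
      · rw [h2 (by omega), h3, h4]; omega
      · rw [h3, h4] at h1
        rw [h3, h4]
        split_ifs <;> omega
      · rw [h3, h4] at h1
        rw [h3, h4]
        split_ifs <;> omega
      · rw [h2 (by omega), h3, h4]; omega
    rcases h.2.2 (ε - ε₂) ε₂ (fun c hc => (key c hc).2) (fun c hc => (key c hc).1)
      (by abel) with h1 | h1
    · have := congrArg (fun x => nod n x P₀) h1
      simp only [nod_sub, nod_zero, hε₂, hP₀] at this
      rw [if_neg (by simp)] at this
      omega
    · intro P hP
      by_contra hne
      have := hε₂ P
      rw [h1, nod_zero, if_pos ⟨hP, hne⟩] at this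
      omega
  refine ⟨s * nod n η P₀, P₀, s, hs, rfl, ext_nod hn fun P => ?_⟩
  rw [nod_smul, nod_toReal]
  rcases hv P with h1 | h1
  · rw [hout P h1, h1]; simp
  · rw [hin P h1, h1]
    rcases hs with rfl | rfl <;> push_cast <;> ring

/-- An inequality that is not tight at the integral point has slack at least 1, and a direction with
values 0 and `s` only changes it by at most 1. -/
lemma IsAtomic.add_mem (hn : 1 ≤ n) {v : ℕ →₀ ℤ} (hv : toReal v ∈ polytope a) {ε : ℕ →₀ ℤ}
    (h : IsAtomic a (toReal v) ε) : toReal v + toReal ε ∈ polytope a := by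
  rw [mem_polytope_iff] at hv ⊢
  intro c
  rw [slack_add a hn, nod_toReal, nod_toReal]
  have h1 := hv c
  obtain ⟨z, hz⟩ := exists_slack_int (a := a) c v
  by_cases h2 : slack a c (toReal v) = 0
  · rw [h2, zero_add, sub_nonneg]
    exact_mod_cast h.2.1 c h2
  · rw [hz] at h1 h2 ⊢
    obtain ⟨s, hs, hval⟩ := h.exists_sign hn
    have h3 : 0 ≤ z := by exact_mod_cast h1
    have h4 : z ≠ 0 := by exact_mod_cast h2
    have h5 : 0 ≤ z + (nod n ε (hi n c) - nod n ε (lo n c)) := by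
      have := hval (hi n c); have := hval (lo n c); omega
    exact_mod_cast h5

/-- The edge is the intersection of the facets through both `u` and `u + ε`. It lies on a line by
`exists_smul`, and any set with two points on it has no further facets. Integral vectors on the line
are integral multiples of `ε`, because some partial sum of `ε` is 1 or -1. -/
lemma IsAtomic.isDirection (hn : 1 ≤ n) {v : ℕ →₀ ℤ} (hv : IsVertex a (toReal v)) {ε : ℕ →₀ ℤ}
    (h : IsAtomic a (toReal v) ε) : IsDirection a (toReal v) ε := by
  set u := toReal v with hu
  have hu1 : u + toReal ε ∈ polytope a := h.add_mem hn hv.1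
  set A : Set (ℕ →₀ ℝ) := {u, u + toReal ε} with hA
  set e : Set (ℕ →₀ ℝ) := polytope a ∩ ⋂₀ facetsThrough a A with he
  have hAP : A ⊆ polytope a := by
    rintro x (rfl | rfl)
    exacts [hv.1, hu1]
  have hAe : A ⊆ e := fun x hx => ⟨hAP hx, fun X hX => ((mem_facetsThrough a).1 hX).2 hx⟩
  have heP : e ⊆ polytope a := Set.inter_subset_left
  have hune : u ≠ u + toReal ε := fun h' => h.1 (toReal_injective (by
    rw [left_eq_add.1 h']; ext; simp [toReal]))
  have heA : facetsThrough a e = facetsThrough a A := by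
    ext X
    rw [mem_facetsThrough, mem_facetsThrough]
    constructor
    · rintro ⟨h1, h2⟩; exact ⟨h1, hAe.trans h2⟩
    · rintro ⟨h1, h2⟩
      exact ⟨h1, fun x hx => hx.2 X ((mem_facetsThrough a).2 ⟨h1, h2⟩)⟩
  have hline : ∀ x ∈ e, ∃ (t : ℝ) (P : ℕ) (s : ℤ), (s = 1 ∨ s = -1) ∧ t = s * nod n (x - u) P ∧
      x - u = t • toReal ε := by
    intro x hx
    refine h.exists_smul hn fun c hc hc' => ?_
    have h1 : slack a c x = 0 := by
      refine (hx.2 (facet a c) ((mem_facetsThrough a).2 ⟨⟨c, rfl⟩, ?_⟩)).2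
      rintro y (rfl | rfl)
      · exact ⟨hv.1, hc⟩
      · refine ⟨hu1, ?_⟩
        rw [slack_add a hn, hc, nod_toReal, nod_toReal, hc', sub_self, add_zero]
    have h2 := slack_add a hn c u (x - u)
    rw [add_sub_cancel, h1, hc] at h2
    linarith
  have hedge : IsEdge a e := by
    refine ⟨⟨u, hAe (Or.inl rfl), u + toReal ε, hAe (Or.inr rfl), hune⟩, by rw [heA], ?_⟩
    rintro e' he' ⟨x, hx, y, hy, hxy⟩ hsub
    have hsub' : e' ⊆ e := fun z hz => ⟨he' hz, fun X hX => by
      rw [← heA] at hX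
      exact ((mem_facetsThrough a).1 (hsub hX)).2 hz⟩
    rw [heA, facetsThrough_subset_iff a hAP he']
    intro c hc
    obtain ⟨t, -, -, -, -, ht⟩ := hline x (hsub' hx)
    obtain ⟨t', -, -, -, -, ht'⟩ := hline y (hsub' hy)
    have hne : t ≠ t' := by
      rintro rfl
      exact hxy (sub_left_injective (ht.trans ht'.symm))
    have h1 := slack_add a hn c u (x - u)
    have h2 := slack_add a hn c u (y - u)
    rw [add_sub_cancel, ht, nod_smul, nod_smul, hc x hx] at h1
    rw [add_sub_cancel, ht', nod_smul, nod_smul, hc y hy] at h2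
    set w := nod n (toReal ε) (hi n c) - nod n (toReal ε) (lo n c) with hw
    have h3 : (t - t') * w = 0 := by rw [hw]; linarith
    have h4 := (mul_eq_zero.1 h3).resolve_left (sub_ne_zero.2 hne)
    have h5 : slack a c u = 0 := by
      have : t * w = 0 := by rw [h4, mul_zero]
      rw [hw] at this; linarith
    rintro z (rfl | rfl)
    · exact h5
    · rw [slack_add a hn, h5, ← hw, h4, add_zero]
  refine ⟨e, hedge, hAe (Or.inl rfl), h.1, hAe (Or.inr rfl), fun η hη => ?_⟩
  obtain ⟨t, P, s, hs, ht, hη'⟩ := hline _ hη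
  rw [add_sub_cancel_left] at hη' ht
  rw [nod_toReal] at ht
  set z : ℤ := s * nod n η P with hz
  have htz : t = z := by rw [ht, hz]; push_cast; rfl
  have hηz : η = z • ε := by
    apply toReal_injective
    rw [hη', htz]
    ext i
    simp [toReal]
  -- A tight inequality that is strict for `ε` excludes negative multiples.
  have hz0 : 0 ≤ z := by
    obtain ⟨c, hc, hlt⟩ := h.2.1.exists_lt hn hv h.1
    have h1 := (mem_polytope_iff a).1 (heP hη) c
    rw [slack_add a hn, hc, hη', nod_smul, nod_smul, nod_toReal, nod_toReal, htz, zero_add,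
      ← mul_sub] at h1
    by_contra! hneg
    have h2 : (z : ℝ) < 0 := by exact_mod_cast hneg
    have h3 : (0 : ℝ) < nod n ε (hi n c) - nod n ε (lo n c) := by
      rw [sub_pos]; exact_mod_cast hlt
    nlinarith
  refine ⟨z.toNat, ?_⟩
  rw [hηz, ← natCast_zsmul, Int.toNat_of_nonneg hz0]

/-- The integral points of the vertex cone. -/
theorem toReal_mem_vertexCone_iff (hn : 1 ≤ n) {v : ℕ →₀ ℤ} (hv : IsVertex a (toReal v))
    (x : ℕ →₀ ℤ) : toReal x ∈ vertexCone a (toReal v) ↔ IsTangent a (toReal v) (x - v) := by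
  unfold vertexCone
  rw [Set.mem_ofPred_eq, ← toReal_sub]
  constructor
  · intro h
    have key : ∀ y ∈ PointedCone.hull ℝ (toReal '' {ε | IsDirection a (toReal v) ε}), ∀ c,
        slack a c (toReal v) = 0 → nod n y (lo n c) ≤ nod n y (hi n c) := by
      intro y hy c hc
      induction hy using Submodule.span_induction with
      | mem y hy =>
        obtain ⟨ε, ⟨e, he, -, -, hε, -⟩, rfl⟩ := hy
        have h1 : toReal v + toReal ε ∈ polytope a := by
          rw [he.2.1] at hε; exact hε.1
        have h2 := (mem_polytope_iff a).1 h1 c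
        rw [slack_add a hn, hc] at h2
        linarith
      | zero => rw [nod_zero, nod_zero]
      | add y z _ _ hy hz => rw [nod_add, nod_add]; exact add_le_add hy hz
      | smul t y _ hy =>
        change nod n ((t : ℝ) • y) _ ≤ nod n ((t : ℝ) • y) _
        rw [nod_smul, nod_smul]
        exact mul_le_mul_of_nonneg_left hy t.2
    intro c hc
    have := key _ h c hc
    rw [nod_toReal, nod_toReal] at this
    exact_mod_cast this
  -- Induction on `tanMeasure`: it is additive, and positive on nonzero tangent directions by
  -- rigidity, so a decomposable direction splits into two of smaller measure.
  · generalize x - v = ε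
    intro h
    induction hd : (tanMeasure a (toReal v) ε).toNat using Nat.strong_induction_on generalizing ε with
    | _ d ih =>
    by_cases h0 : ε = 0
    · subst h0
      have : toReal 0 = 0 := by ext; simp [toReal]
      rw [this]
      exact Submodule.zero_mem _
    by_cases hat : IsAtomic a (toReal v) ε
    · exact Submodule.subset_span ⟨ε, hat.isDirection hn hv, rfl⟩
    · unfold IsAtomic at hat
      push Not at hat
      obtain ⟨ε₁, ε₂, h1, h2, rfl, h3, h4⟩ := hat h0 h
      have e := tanMeasure_add (a := a) hn (toReal v) ε₁ ε₂
      have p1 := h1.measure_pos hn hv h3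
      have p2 := h2.measure_pos hn hv h4
      rw [toReal_add]
      exact Submodule.add_mem _ (ih _ (by omega) ε₁ h1 rfl) (ih _ (by omega) ε₂ h2 rfl)

end Polytope

end InfBrion

end

noncomputable section

namespace InfBrion

/-! ### Patterns of integral points and finite-dimensional sections. -/

section Window

variable {n : ℕ} (a : Fin n → ℕ)

/-- The level `k`. -/
def lev : ℤ := ∑ j, (a j : ℤ)

variable {a}

lemma bound_of_le {i : ℕ} (h : n ≤ i + 1) : (bound a i : ℤ) = lev a := by
  rw [bound, if_neg (by omega), lev]
  push_cast
  rfl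

lemma bound_lt (hn : 2 ≤ n) (ha : ∀ i, 0 < a i) {i : ℕ} (h : i + 1 < n) :
    bound a i < bound a (i + 1) := by
  have key : ∀ t : Finset (Fin n),
      (Finset.univ.filter fun j : Fin n => 1 ≤ (j : ℕ) ∧ (j : ℕ) ≤ i + 1) ⊆ t →
      ∀ j ∈ t, ¬ (1 ≤ (j : ℕ) ∧ (j : ℕ) ≤ i + 1) →
      ∑ j ∈ Finset.univ.filter (fun j : Fin n => 1 ≤ (j : ℕ) ∧ (j : ℕ) ≤ i + 1), a j < ∑ j ∈ t, a j :=
    fun t hs j hj hj' => Finset.sum_lt_sum_of_subset hs hj (by simpa using hj') (ha j)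
      fun _ _ _ => Nat.zero_le _
  rw [bound, if_pos h, bound]
  split_ifs with h1
  · refine key _ (fun j hj => ?_) ⟨i + 2, h1⟩ (by simp) (by simp)
    simp only [Finset.mem_filter, Finset.mem_univ, true_and] at hj ⊢
    omega
  · exact key _ (Finset.subset_univ _) ⟨0, by omega⟩ (Finset.mem_univ _) (by simp)

lemma bound_mono (hn : 2 ≤ n) (ha : ∀ i, 0 < a i) {i j : ℕ} (hij : i ≤ j) : bound a i ≤ bound a j := by
  refine monotone_nat_of_le_succ (f := bound a) (fun i => ?_) hij
  rcases Nat.lt_or_ge (i + 1) n with h | h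
  · exact (bound_lt hn ha h).le
  · have h1 := bound_of_le (a := a) h
    have h2 := bound_of_le (a := a) (i := i + 1) (by omega)
    omega

lemma bound_pos (hn : 2 ≤ n) (ha : ∀ i, 0 < a i) (i : ℕ) : 0 < bound a i := by
  refine lt_of_lt_of_le ?_ (bound_mono hn ha (Nat.zero_le i))
  rw [bound, if_pos (by omega)]
  exact Finset.sum_pos (fun j _ => ha j) ⟨⟨1, by omega⟩, by simp⟩

lemma lev_pos (hn : 2 ≤ n) (ha : ∀ i, 0 < a i) : 0 < lev a := by
  rw [← bound_of_le (i := n) (by omega)]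
  exact_mod_cast bound_pos hn ha n

lemma bound_le_lev (hn : 2 ≤ n) (ha : ∀ i, 0 < a i) (i : ℕ) : (bound a i : ℤ) ≤ lev a := by
  rw [← bound_of_le (i := max i n) (by omega)]
  exact_mod_cast bound_mono hn ha (le_max_left _ _)

lemma nod_mono {x : ℕ →₀ ℤ} (h : ∀ i, 0 ≤ x i) {p q : ℕ} (hpq : p ≤ q) : nod n x p ≤ nod n x q := by
  unfold nod psum
  refine Finset.sum_le_sum_of_subset_of_nonneg (fun i => ?_) fun i _ _ => h i
  simp only [Finset.mem_range]
  omega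

variable (a) in
/-- The difference of the two sides of an inequality of the polytope at an integral point. -/
def intSlack (c : ℕ ⊕ ℕ) (v : ℕ →₀ ℤ) : ℤ :=
  (match c with
    | Sum.inl _ => 0
    | Sum.inr i => bound a i) + (nod n v (hi n c) - nod n v (lo n c))

lemma slack_toReal (hn : 1 ≤ n) (c : ℕ ⊕ ℕ) (v : ℕ →₀ ℤ) :
    slack a c (toReal v) = intSlack a c v := by
  rcases c with i | i
  · simp only [slack, intSlack, hi, lo]
    rw [nod_row hn, nod_toReal, nod_toReal]
    push_cast
    ring
  · simp only [slack, intSlack, hi, lo, psi_eq, nod_toReal]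
    push_cast
    ring

lemma slack_toReal_eq_zero (hn : 1 ≤ n) (c : ℕ ⊕ ℕ) (v : ℕ →₀ ℤ) :
    slack a c (toReal v) = 0 ↔ intSlack a c v = 0 := by
  rw [slack_toReal hn]; exact_mod_cast Iff.rfl

lemma mem_polytope_int (hn : 1 ≤ n) {v : ℕ →₀ ℤ} : toReal v ∈ polytope a ↔ ∀ c, 0 ≤ intSlack a c v := by
  rw [mem_polytope_iff]
  refine forall_congr' fun c => ?_
  rw [slack_toReal hn]; exact_mod_cast Iff.rfl

lemma intSlack_inl (hn : 1 ≤ n) (i : ℕ) (v : ℕ →₀ ℤ) : intSlack a (Sum.inl i) v = v i := by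
  rw [nod_row hn v i]
  simp only [intSlack, hi, lo, zero_add]

variable (a) in
/-- The pattern of an integral point. -/
def hatPat (v : ℕ →₀ ℤ) (P : ℕ) : ℤ := (if P < n then (bound a P : ℤ) - lev a else 0) + nod n v P

lemma hatPat_row (hn : 1 ≤ n) (v : ℕ →₀ ℤ) (i : ℕ) :
    hatPat a v (i + n) - hatPat a v (i + n - 1) = v i := by
  rw [nod_row hn v i]
  unfold hatPat
  rw [if_neg (by omega)]
  split_ifs
  · rw [bound_of_le (by omega)]; ring
  · ring

/-- The base values `bound a P - lev a` absorb the exceptional constants of the first windows, so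
that all windows have the same constant `k`. -/
lemma hatPat_win (v : ℕ →₀ ℤ) (i : ℕ) :
    hatPat a v i + lev a - hatPat a v (i + n) = intSlack a (Sum.inr i) v := by
  unfold hatPat
  simp only [intSlack, hi, lo]
  rw [if_neg (by omega : ¬ i + n < n)]
  split_ifs with h
  · ring
  · rw [bound_of_le (by omega)]; ring

variable (a) in
/-- The integral point `v` is supported on the first `m` terms and lies on no facet `Γ` beyond. -/
structure IsWindow (m : ℕ) (v : ℕ →₀ ℤ) : Prop where
  mem : toReal v ∈ polytope a
  supp : ∀ i, m ≤ i → v i = 0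
  strict : ∀ i, m ≤ i → intSlack a (Sum.inr i) v ≠ 0

/-- Positivity of the `a i` makes the base strictly increasing and `wrap` strict; the window at
index `m`, which is not tight, gives `slack`. -/
lemma IsWindow.isPattern (hn : 2 ≤ n) (ha : ∀ i, 0 < a i) {m : ℕ} {v : ℕ →₀ ℤ} (h : IsWindow a m v) :
    IsPattern n (m + n - 1) (lev a) (hatPat a v) := by
  have hmem := (mem_polytope_int (by omega)).1 h.mem
  have hbase : ∀ P, P < n → hatPat a v P = bound a P - lev a := fun P hP => by
    rw [hatPat, if_pos hP, nod_of_lt _ hP, add_zero]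
  have hwin : ∀ P, hatPat a v (P + n) ≤ hatPat a v P + lev a := fun P => by
    have := hmem (Sum.inr P)
    rw [← hatPat_win] at this
    linarith
  refine ⟨hn, lev_pos hn ha, fun P hP => ?_, ?_, fun P hP => ?_, hwin, ?_⟩
  · rw [hbase P (by omega), hbase _ hP]
    have := bound_lt hn ha hP
    omega
  · rw [hbase 0 (by omega), hbase (n - 1) (by omega), bound_of_le (by omega)]
    have := bound_pos hn ha 0
    omega
  · have h1 := hatPat_row (a := a) (by omega) v (P + 1 - n)
    rw [show P + 1 - n + n = P + 1 by omega, Nat.add_sub_cancel] at h1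
    have h2 := hmem (Sum.inl (P + 1 - n))
    rw [intSlack_inl (by omega)] at h2
    omega
  · have h1 := h.strict m le_rfl
    have h2 := hmem (Sum.inr m)
    rw [← hatPat_win] at h1 h2
    rw [show m + n - 1 + 1 = m + n by omega, Nat.add_sub_cancel]
    omega

variable (a) in
/-- The integral points of the cone at `v` that are supported on the first `m` terms. -/
def secSet (m : ℕ) (v : ℕ →₀ ℤ) : Set (ℕ →₀ ℤ) :=
  {x | (∀ i, m ≤ i → x i = 0) ∧ IsTangent a (toReal v) (x - v)}

variable (a) in
/-- The set `secSet` in the coordinates given by the partial sums. -/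
def latSet (m : ℕ) (v : ℕ →₀ ℤ) : Set (Fin m → ℤ) := {d | latHom m d ∈ secSet a m v}

lemma image_latSet (m : ℕ) (v : ℕ →₀ ℤ) : latHom m '' latSet a m v = secSet a m v := by
  ext x
  constructor
  · rintro ⟨d, hd, rfl⟩; exact hd
  · intro hx
    refine ⟨fun j => psum x (j + 1), ?_, latHom_psum hx.1⟩
    unfold latSet
    rw [Set.mem_ofPred_eq, latHom_psum hx.1]
    exact hx

lemma nodeVal_eq_nod {m : ℕ} (d : Fin m → ℤ) {P : ℕ} (hP : P < n + m) :
    nodeVal n d P = nod n (latHom m d) P := by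
  rcases free_or_not n m P with ⟨j, rfl⟩ | h
  · rw [nodeVal_add_fin, nod, show n + (j : ℕ) + 1 - n = j + 1 by omega, psum_latHom_succ]
  · rw [nodeVal_of_lt _ (by omega), nod_of_lt _ (by omega)]

/-- Beyond the first `m` indices nothing is imposed: the coordinates vanish there, and the windows
are not tight. -/
lemma isTangent_latHom_iff (hn : 2 ≤ n) (ha : ∀ i, 0 < a i) {m : ℕ} {v : ℕ →₀ ℤ}
    (h : IsWindow a m v) (d : Fin m → ℤ) : IsTangent a (toReal v) (latHom m d) ↔
      d ∈ patternCone n (m + n - 1) (lev a) (hatPat a v) m := by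
  rw [mem_patternCone_iff (h.isPattern hn ha)]
  unfold IsTangent
  constructor
  · intro ht P hP hPN
    have h1 := hatPat_row (a := a) (by omega) v (P - n)
    have h2 := hatPat_win (a := a) v (P - n)
    rw [Nat.sub_add_cancel hP] at h1 h2
    rw [nodeVal_eq_nod d (by omega), nodeVal_eq_nod d (by omega), nodeVal_eq_nod d (by omega)]
    constructor
    · intro he
      have := ht (Sum.inl (P - n)) (by
        rw [slack_toReal_eq_zero (by omega), intSlack_inl (by omega)]; omega)
      simpa only [lo, hi, Nat.sub_add_cancel hP] using this
    · intro he
      have := ht (Sum.inr (P - n)) (by rw [slack_toReal_eq_zero (by omega)]; omega)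
      simpa only [lo, hi, Nat.sub_add_cancel hP] using this
  · intro hd c hc
    rw [slack_toReal_eq_zero (by omega)] at hc
    rcases c with i | i
    · rcases Nat.lt_or_ge i m with hi' | hi'
      · have h1 := (hd (i + n) (by omega) (by omega)).1
        have h2 := hatPat_row (a := a) (by omega) v i
        rw [intSlack_inl (by omega)] at hc
        rw [nodeVal_eq_nod d (by omega), nodeVal_eq_nod d (by omega)] at h1
        exact h1 (by omega)
      · have := nod_row (n := n) (by omega) (latHom m d) i
        rw [latHom_of_le m d hi'] at this
        simp only [lo, hi]
        omega
    · have hi' : i < m := by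
        by_contra hlt
        exact h.strict i (by omega) hc
      have h1 := (hd (i + n) (by omega) (by omega)).2
      have h2 := hatPat_win (a := a) v i
      rw [Nat.add_sub_cancel, nodeVal_eq_nod d (by omega), nodeVal_eq_nod d (by omega)] at h1
      exact h1 (by omega)

lemma latSet_eq (hn : 2 ≤ n) (ha : ∀ i, 0 < a i) {m : ℕ} {v : ℕ →₀ ℤ}
    (h : IsWindow a m v) : latSet a m v = {d | d - (fun j : Fin m => psum v (j + 1)) ∈
      patternCone n (m + n - 1) (lev a) (hatPat a v) m} := by
  ext d
  rw [Set.mem_ofPred_eq, ← isTangent_latHom_iff hn ha h, map_sub, latHom_psum h.supp]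
  unfold latSet secSet
  rw [Set.mem_ofPred_eq, Set.mem_ofPred_eq]
  exact ⟨fun h => h.2, fun h => ⟨fun i hi => latHom_of_le m d hi, h⟩⟩

lemma HasPhi.translate {H : Type*} [AddCommGroup H] {st : H →+ Weight n} {A : Set H} {f : RatZ n}
    (h : HasPhi st (A.indicator 1) f) (w : H) :
    HasPhi st ({x | x - w ∈ A}.indicator 1) (ex (st w) * f) := by
  have := h.comp_equiv (AddEquiv.refl H) (fun _ => rfl) (-w)
  rw [map_neg, neg_neg] at this
  convert this using 1
  ext x
  simp only [AddEquiv.refl_apply, sub_eq_add_neg]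
  rfl

variable (a) in
/-- Regularity of the pattern of an integral point. -/
def IsRegularAt (m : ℕ) (v : ℕ →₀ ℤ) : Prop := IsRegularPattern n (m + n - 1) (lev a) (hatPat a v)

lemma IsWindow.weight (m : ℕ) {v : ℕ →₀ ℤ} (h : IsWindow a m v) :
    latWeight n m (fun j => psum v (j + 1)) = starWeight n v := by
  rw [latWeight, AddMonoidHom.comp_apply, latHom_psum h.supp]

lemma IsWindow.regular_hasPhi (hn : 2 ≤ n) (ha : ∀ i, 0 < a i) {m : ℕ} {v : ℕ →₀ ℤ}
    (h : IsWindow a m v) (hreg : IsRegularAt a m v) : ∃ β : Fin m → Weight n,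
      (∀ j, IsRoot n (β j)) ∧ HasPhi (latWeight n m) ((latSet a m v).indicator 1)
        (ex (starWeight n v) * ∏ j, (1 - ex (β j))⁻¹) := by
  obtain ⟨β, hβ, h1⟩ := IsRegularPattern.hasPhi (m := m) (h.isPattern hn ha) (by omega) hreg
  refine ⟨β, hβ, ?_⟩
  rw [latSet_eq hn ha h, ← h.weight]
  exact h1.translate _

lemma IsWindow.eq_zero_of_not_regular (hn : 2 ≤ n) (ha : ∀ i, 0 < a i) {m : ℕ} {v : ℕ →₀ ℤ}
    (h : IsWindow a m v) (hreg : ¬ IsRegularAt a m v) {f : RatZ n}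
    (hf : HasPhi (latWeight n m) ((latSet a m v).indicator 1) f) : f = 0 := by
  have hp := h.isPattern hn ha
  rw [latSet_eq hn ha h] at hf
  have h1 := hf.translate (-fun j : Fin m => psum v (j + 1))
  rw [map_neg, h.weight] at h1
  have h2 := HasPhi.eq_zero_of_not_regular hp (by omega) hreg (latWeight n m)
    (fun x => latWeight_ne_zero hn x) (fun i j => latWeight_key hp (by omega) i j)
    (f := ex (-starWeight n v) * f) (by
      convert h1 using 2
      ext d
      simp)
  exact (mul_eq_zero.1 h2).resolve_left (ex_ne_zero _)

lemma HasPhi.of_latSet {m : ℕ} {v : ℕ →₀ ℤ} {f : RatZ n}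
    (hf : HasPhi (latWeight n m) ((latSet a m v).indicator 1) f) :
    HasPhi (starWeight n) ((secSet a m v).indicator 1) f := by
  rw [← image_latSet]
  exact hf.map (latHom m) (latHom_injective m) (fun _ => rfl) _

/-- The lowest node of a set is joined to a lower node by a tight inequality: inside the window by
regularity, beyond it because the coordinates of `v` vanish. So the set is separated from its
complement. -/
lemma IsWindow.isRigid (hn : 2 ≤ n) {m : ℕ} {v : ℕ →₀ ℤ}
    (h : IsWindow a m v) (hreg : IsRegularAt a m v) : IsRigid a (toReal v) := by
  intro S M hS _ hE
  by_contra hne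
  have hex : ∃ P, P ∈ S := Set.nonempty_iff_ne_empty.2 hne
  classical
  obtain ⟨P, hP, hmin⟩ : ∃ P ∈ S, ∀ Q, Q < P → Q ∉ S :=
    ⟨Nat.find hex, Nat.find_spec hex, fun Q hQ => Nat.find_min hex hQ⟩
  have hPn := hS P hP
  have h1 := hatPat_row (a := a) (by omega) v (P - n)
  have h2 := hatPat_win (a := a) v (P - n)
  rw [Nat.sub_add_cancel hPn] at h1 h2
  have hrow : hatPat a v (P - 1) = hatPat a v P → False := fun he => by
    have := hE (Sum.inl (P - n)) (by
      rw [slack_toReal_eq_zero (by omega), intSlack_inl (by omega)]; omega)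
    simp only [lo, hi, Nat.sub_add_cancel hPn] at this
    exact hmin _ (by omega) (this.2 hP)
  rcases Nat.lt_or_ge P (m + n) with h3 | h3
  · rcases hreg.2 P hPn (by omega) with h4 | h4
    · exact hrow h4
    · have := hE (Sum.inr (P - n)) (by rw [slack_toReal_eq_zero (by omega)]; omega)
      simp only [lo, hi, Nat.sub_add_cancel hPn] at this
      exact hmin _ (by omega) (this.1 hP)
  · rw [h.supp _ (by omega)] at h1
    exact hrow (by omega)

lemma IsWindow.isVertex (hn : 2 ≤ n) {m : ℕ} {v : ℕ →₀ ℤ}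
    (h : IsWindow a m v) (hreg : IsRegularAt a m v) : IsVertex a (toReal v) :=
  (h.isRigid hn hreg).isVertex (by omega) h.mem

/-! ### The index of the last facet `Γ` through a point -/

lemma mem_facetG_iff (hn : 1 ≤ n) {v : ℕ →₀ ℤ} (hv : toReal v ∈ polytope a) (i : ℕ) :
    toReal v ∈ facetG a i ↔ intSlack a (Sum.inr i) v = 0 := by
  rw [← facet_inr, ← slack_toReal_eq_zero hn]
  exact ⟨fun h => h.2, fun h => ⟨hv, h⟩⟩

lemma intSlack_inr_of_le (v : ℕ →₀ ℤ) {m i : ℕ} (hv : ∀ i, m ≤ i → v i = 0)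
    (hi' : m + n ≤ i + 1) : intSlack a (Sum.inr i) v = bound a i := by
  simp only [intSlack, hi, lo, nod]
  rw [psum_of_le hv (by omega), psum_of_le hv (q := i + n + 1 - n) (by omega), sub_self, add_zero]

lemma exists_supp_bound (v : ℕ →₀ ℤ) : ∃ B, ∀ i, B ≤ i → v i = 0 :=
  ⟨v.support.sup id + 1, fun i hi => by
    by_contra h
    have := Finset.le_sup (f := id) (Finsupp.mem_support_iff.2 h)
    simp only [id] at this
    omega⟩

lemma lastG_le_iff (hn : 2 ≤ n) (ha : ∀ i, 0 < a i) {v : ℕ →₀ ℤ} (hv : toReal v ∈ polytope a) {m : ℕ} :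
    lastG a (toReal v) ≤ m ↔ ∀ i, m ≤ i → intSlack a (Sum.inr i) v ≠ 0 := by
  -- Needed because the supremum of an unbounded set of naturals is 0. Far beyond the support the
  -- slack is the full positive bound.
  have hb : BddAbove {l | ∃ i, l = i + 1 ∧ toReal v ∈ facetG a i} := by
    obtain ⟨B, hB⟩ := exists_supp_bound v
    refine ⟨B + n, ?_⟩
    rintro l ⟨i, rfl, hi'⟩
    by_contra hlt
    rw [mem_facetG_iff (by omega) hv, intSlack_inr_of_le v hB (by omega)] at hi'
    have := bound_pos hn ha i
    omega
  unfold lastG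
  constructor
  · intro h i hi' h0
    have := le_csSup hb (show i + 1 ∈ {l | ∃ i, l = i + 1 ∧ toReal v ∈ facetG a i} from
      ⟨i, rfl, (mem_facetG_iff (by omega) hv i).2 h0⟩)
    omega
  · intro h
    by_cases hne : {l | ∃ i, l = i + 1 ∧ toReal v ∈ facetG a i}.Nonempty
    · refine csSup_le hne ?_
      rintro l ⟨i, rfl, hi'⟩
      by_contra hlt
      exact h i (by omega) ((mem_facetG_iff (by omega) hv i).1 hi')
    · rw [Set.not_nonempty_iff_eq_empty.1 hne]
      simp

/-- If `v i ≠ 0` with `i ≥ m`, the nodes from `i + n` on are not separated by any tight inequality: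
the one for `v i` is strict, tight windows have index below `m`, and those end before `i + n`.
Rigidity forbids this. -/
lemma IsVertex.isWindow (hn : 2 ≤ n) (ha : ∀ i, 0 < a i) {v : ℕ →₀ ℤ} (hv : IsVertex a (toReal v))
    {m : ℕ} (hm : lastG a (toReal v) ≤ m) : IsWindow a m v := by
  have hs := (lastG_le_iff hn ha hv.1).1 hm
  refine ⟨hv.1, fun i hi' => ?_, hs⟩
  by_contra h0
  have := hv.rigid (by omega) {P | i + n ≤ P} (i + n) (fun P hP => by
    rw [Set.mem_ofPred_eq] at hP; omega) (fun P hP => by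
    rw [Set.mem_ofPred_eq, Set.mem_ofPred_eq]; omega) (fun c hc => by
    rw [slack_toReal_eq_zero (by omega)] at hc
    rw [Set.mem_ofPred_eq, Set.mem_ofPred_eq]
    rcases c with j | j
    · rw [intSlack_inl (by omega)] at hc
      have : j ≠ i := by rintro rfl; exact h0 hc
      simp only [lo, hi]; omega
    · have : ¬ m ≤ j := fun h => hs j h hc
      simp only [lo, hi]; omega)
  have h1 : i + n ∈ {P | i + n ≤ P} := le_refl (i + n)
  rw [this] at h1
  exact h1

lemma genSeries_coneSection (hn : 2 ≤ n) {v : ℕ →₀ ℤ} (hv : IsVertex a (toReal v)) (m : ℕ) :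
    genSeries (coneSection a (toReal v) m) = (secSet a m v).indicator 1 := by
  classical
  ext x
  unfold genSeries
  rw [Set.indicator_apply, Set.indicator_apply]
  refine if_congr ?_ rfl rfl
  unfold coneSection secSet
  rw [Set.mem_ofPred_eq, Set.mem_ofPred_eq, toReal_mem_vertexCone_iff (by omega) hv, and_comm]
  refine and_congr (forall₂_congr fun i _ => ?_) Iff.rfl
  simp [toReal]

/-! ### Enlarging the window -/

lemma nod_single (m P : ℕ) : nod n (Finsupp.single m (1 : ℤ)) P = if m + n ≤ P then 1 else 0 := by
  rw [nod, psum_single]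
  refine if_congr ?_ rfl rfl
  omega

/-- The new coordinate is constrained only by being nonnegative, since no other inequality tight at
`v` separates the node `m + n` and the later ones from the earlier ones. So the larger section is
the smaller one times a ray. -/
lemma IsWindow.indicator_succ (hn : 2 ≤ n) {m : ℕ} {v : ℕ →₀ ℤ} (h : IsWindow a m v)
    (x : ℕ →₀ ℤ) : (secSet a (m + 1) v).indicator (1 : (ℕ →₀ ℤ) → ℂ) x -
      (secSet a (m + 1) v).indicator 1 (x - Finsupp.single m 1) = (secSet a m v).indicator 1 x := by
  classical
  set T : (ℕ →₀ ℤ) → Prop := fun x => (∀ i, m + 1 ≤ i → x i = 0) ∧ ∀ c, c ≠ Sum.inl m →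
    slack a c (toReal v) = 0 → nod n (x - v) (lo n c) ≤ nod n (x - v) (hi n c) with hT
  have hvm : v m = 0 := h.supp m le_rfl
  have h0 : ∀ x, x ∈ secSet a (m + 1) v ↔ T x ∧ 0 ≤ x m := by
    intro x
    have hrow := nod_row (n := n) (by omega) (x - v) m
    rw [Finsupp.sub_apply, hvm, sub_zero] at hrow
    constructor
    · rintro ⟨h1, h2⟩
      refine ⟨⟨h1, fun c _ hc => h2 c hc⟩, ?_⟩
      have := h2 (Sum.inl m) (by rw [slack_toReal_eq_zero (by omega), intSlack_inl (by omega), hvm])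
      simp only [lo, hi] at this
      omega
    · rintro ⟨⟨h1, h2⟩, h3⟩
      refine ⟨h1, fun c hc => ?_⟩
      by_cases hcm : c = Sum.inl m
      · subst hcm
        simp only [lo, hi]
        omega
      · exact h2 c hcm hc
  have hshift : T (x - Finsupp.single m 1) ↔ T x := by
    refine and_congr (forall₂_congr fun i hi' => ?_) (forall₃_congr fun c hc hc' => ?_)
    · rw [Finsupp.sub_apply, Finsupp.single_eq_of_ne (by omega), sub_zero]
    · rw [slack_toReal_eq_zero (by omega)] at hc'
      have he : nod n (Finsupp.single m (1 : ℤ)) (lo n c) = nod n (Finsupp.single m (1 : ℤ)) (hi n c) := by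
        rw [nod_single, nod_single]
        refine if_congr ?_ rfl rfl
        rcases c with j | j
        · have : j ≠ m := fun hj => hc (by rw [hj])
          simp only [lo, hi]; omega
        · have : ¬ m ≤ j := fun hj => h.strict j hj hc'
          simp only [lo, hi]; omega
      rw [nod_sub, nod_sub, nod_sub, nod_sub, nod_sub, nod_sub, he]
      omega
  have hsec : x ∈ secSet a m v ↔ T x ∧ x m = 0 := by
    constructor
    · rintro ⟨h1, h2⟩
      exact ⟨⟨fun i hi' => h1 i (by omega), fun c _ hc => h2 c hc⟩, h1 m le_rfl⟩
    · rintro ⟨h1, h2⟩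
      refine ⟨fun i hi' => ?_, ((h0 x).2 ⟨h1, h2.ge⟩).2⟩
      rcases hi'.eq_or_lt with rfl | hi'
      · exact h2
      · exact h1.1 i hi'
  rw [Set.indicator_apply, Set.indicator_apply, Set.indicator_apply]
  simp only [h0, hsec, hshift, Finsupp.sub_apply, Finsupp.single_eq_same, Pi.one_apply]
  by_cases hTx : T x
  · simp only [hTx, true_and]
    rcases lt_trichotomy (x m) 0 with h1 | h1 | h1
    · rw [if_neg (by omega), if_neg (by omega), if_neg (by omega), sub_zero]
    · rw [if_pos (by omega), if_neg (by omega), if_pos h1, sub_zero]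
    · rw [if_pos (by omega), if_pos (by omega), if_neg (by omega), sub_self]
  · simp [hTx]

lemma IsWindow.hasPhi_succ (hn : 2 ≤ n) {m : ℕ} {v : ℕ →₀ ℤ} (h : IsWindow a m v) {f : RatZ n}
    (hf : HasPhi (starWeight n) ((secSet a m v).indicator 1) f) :
    HasPhi (starWeight n) ((secSet a (m + 1) v).indicator 1) (f * (1 - ex (varWeight n m))⁻¹) := by
  have hst : starWeight n (Finsupp.single m 1) = varWeight n m := by
    rw [starWeight_single, one_smul]
  rw [← hst]
  refine hf.div_one_sub (by rw [hst]; exact (isRoot_varWeight hn m).ne_zero) (h.indicator_succ hn)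

/-! ### The lattice points of the sections of the polytope -/

/-- The free node at a position. -/
def nodeOpt (n m P : ℕ) : Option (Fin m) := if h : n ≤ P ∧ P < n + m then some ⟨P - n, by omega⟩ else none

lemma coord_nodeOpt {m : ℕ} (d : Fin m → ℤ) (P : ℕ) : coord (nodeOpt n m P) d = nodeVal n d P := by
  unfold nodeOpt nodeVal coord
  split_ifs <;> rfl

/-- The lower node of an inequality of a section of the polytope. -/
def optLo (n m : ℕ) : Fin m ⊕ Fin m → Option (Fin m)
  | Sum.inl j => nodeOpt n m (j + n - 1)
  | Sum.inr j => some j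

/-- The upper node of an inequality of a section of the polytope. -/
def optHi (n m : ℕ) : Fin m ⊕ Fin m → Option (Fin m)
  | Sum.inl j => some j
  | Sum.inr j => nodeOpt n m j

variable (a) in
/-- The constant of an inequality of a section of the polytope. -/
def optBound (m : ℕ) : Fin m ⊕ Fin m → ℤ
  | Sum.inl _ => 0
  | Sum.inr j => bound a j

/-- An inequality of a section, as an inequality of the polytope. -/
def toCon {m : ℕ} (c : Fin m ⊕ Fin m) : ℕ ⊕ ℕ := Sum.map Fin.val Fin.val c

lemma coord_sub_coord {m : ℕ} (d : Fin m → ℤ) (c : Fin m ⊕ Fin m) :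
    coord (optLo n m c) d - coord (optHi n m c) d =
      nod n (latHom m d) (lo n (toCon c)) - nod n (latHom m d) (hi n (toCon c)) := by
  have h : ∀ j : Fin m, coord (some j) d = nod n (latHom m d) (j + n) := fun j => by
    rw [← nodeVal_eq_nod d (by omega), add_comm, nodeVal_add_fin]; rfl
  rcases c with j | j
  · simp only [optLo, optHi, toCon, Sum.map_inl, lo, hi]
    rw [h, coord_nodeOpt, nodeVal_eq_nod d (by omega)]
  · simp only [optLo, optHi, toCon, Sum.map_inr, lo, hi]
    rw [h, coord_nodeOpt, nodeVal_eq_nod d (by omega)]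

lemma intSlack_toCon {m : ℕ} (d : Fin m → ℤ) (c : Fin m ⊕ Fin m) :
    intSlack a (toCon c) (latHom m d) =
      optBound a m c - (coord (optLo n m c) d - coord (optHi n m c) d) := by
  rw [coord_sub_coord]
  rcases c with j | j
  · simp only [intSlack, toCon, optBound, Sum.map_inl]; ring
  · simp only [intSlack, toCon, optBound, Sum.map_inr]; ring

lemma mem_polytope_latHom (hn : 2 ≤ n) (ha : ∀ i, 0 < a i) {m : ℕ} (d : Fin m → ℤ) :
    toReal (latHom m d) ∈ polytope a ↔
      ∀ c, coord (optLo n m c) d - coord (optHi n m c) d ≤ optBound a m c := by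
  rw [mem_polytope_int (by omega)]
  constructor
  · intro h c
    have := h (toCon c)
    rw [intSlack_toCon] at this
    omega
  · intro h
    have hfin : ∀ c : Fin m ⊕ Fin m, 0 ≤ intSlack a (toCon c) (latHom m d) := fun c => by
      rw [intSlack_toCon]; have := h c; omega
    have hrow : ∀ i, 0 ≤ (latHom m d) i := fun i => by
      rcases Nat.lt_or_ge i m with hi' | hi'
      · have := hfin (Sum.inl ⟨i, hi'⟩)
        rwa [show toCon (Sum.inl (⟨i, hi'⟩ : Fin m)) = Sum.inl i from rfl,
          intSlack_inl (by omega)] at this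
      · rw [latHom_of_le m d hi']
    rintro (i | i)
    · rw [intSlack_inl (by omega)]; exact hrow i
    · rcases Nat.lt_or_ge i m with hi' | hi'
      · exact hfin (Sum.inr ⟨i, hi'⟩)
      · rcases Nat.eq_zero_or_pos m with rfl | hm
        · have h0 : latHom 0 d = 0 := by
            ext i; rw [latHom_of_le 0 d (Nat.zero_le i)]; rfl
          simp only [intSlack, h0, nod_zero]
          omega
        -- A window of index at least `m` follows from the one of index `m - 1`: its sum is no
        -- larger and its bound no smaller.
        · have h1 := hfin (Sum.inr ⟨m - 1, by omega⟩)
          rw [show toCon (Sum.inr (⟨m - 1, by omega⟩ : Fin m)) = Sum.inr (m - 1) from rfl] at h1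
          simp only [intSlack, hi, lo] at h1 ⊢
          have h2 := nod_mono (n := n) hrow (show m - 1 ≤ i by omega)
          have h3 : nod n (latHom m d) (i + n) = nod n (latHom m d) (m - 1 + n) := by
            rw [nod, nod, psum_of_le (fun i => latHom_of_le m d) (by omega),
              psum_of_le (fun i => latHom_of_le m d) (q := m - 1 + n + 1 - n) (by omega)]
          have h4 := bound_mono hn ha (show m - 1 ≤ i by omega)
          rw [h3]
          omega

lemma le_lev_of_mem (hn : 2 ≤ n) (ha : ∀ i, 0 < a i) {v : ℕ →₀ ℤ} (hv : toReal v ∈ polytope a) (i : ℕ) :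
    0 ≤ v i ∧ v i ≤ lev a := by
  have h := (mem_polytope_int (by omega)).1 hv
  have h0 : ∀ i, 0 ≤ v i := fun i => by
    have := h (Sum.inl i)
    rwa [intSlack_inl (by omega)] at this
  refine ⟨h0 i, ?_⟩
  have h1 := h (Sum.inr i)
  have h2 := nod_mono (n := n) h0 (show i ≤ i + n - 1 by omega)
  have h3 := nod_row (n := n) (by omega) v i
  have h4 := bound_le_lev hn ha i
  simp only [intSlack, hi, lo] at h1
  omega

lemma finite_supp_mem (hn : 2 ≤ n) (ha : ∀ i, 0 < a i) (m : ℕ) :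
    {v : ℕ →₀ ℤ | toReal v ∈ polytope a ∧ ∀ i, m ≤ i → v i = 0}.Finite := by
  refine Set.Finite.of_finite_image (f := fun v : ℕ →₀ ℤ => fun j : Fin m => v j)
    ((Set.finite_Icc (0 : Fin m → ℤ) (fun _ => lev a)).subset ?_) ?_
  · rintro _ ⟨v, hv, rfl⟩
    exact ⟨fun j => (le_lev_of_mem hn ha hv.1 j).1, fun j => (le_lev_of_mem hn ha hv.1 j).2⟩
  · intro v hv w hw h
    ext i
    rcases Nat.lt_or_ge i m with hi' | hi'
    · exact congrFun h ⟨i, hi'⟩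
    · rw [hv.2 i hi', hw.2 i hi']

lemma finite_latPts (hn : 2 ≤ n) (ha : ∀ i, 0 < a i) (m : ℕ) :
    {d : Fin m → ℤ | toReal (latHom m d) ∈ polytope a}.Finite :=
  Set.Finite.of_finite_image (f := latHom m) ((finite_supp_mem hn ha m).subset (by
    rintro _ ⟨d, hd, rfl⟩
    exact ⟨hd, fun i hi' => latHom_of_le m d hi'⟩)) (latHom_injective m).injOn

lemma latSet_eq_tangentSet (hn : 2 ≤ n) {m : ℕ} {v : ℕ →₀ ℤ} (h : IsWindow a m v) :
    latSet a m v = tangentSet (optLo n m) (optHi n m) (optBound a m) (fun j => psum v (j + 1)) := by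
  ext d
  have hv := latHom_psum h.supp
  have htight : ∀ c : Fin m ⊕ Fin m, coord (optLo n m c) (fun j : Fin m => psum v (j + 1)) -
      coord (optHi n m c) (fun j : Fin m => psum v (j + 1)) = optBound a m c ↔
      slack a (toCon c) (toReal v) = 0 := fun c => by
    have := intSlack_toCon (a := a) (fun j : Fin m => psum v (j + 1)) c
    rw [hv] at this
    rw [slack_toReal_eq_zero (by omega), this]
    omega
  have hle : ∀ c : Fin m ⊕ Fin m, slack a (toCon c) (toReal v) = 0 →
      (coord (optLo n m c) d - coord (optHi n m c) d ≤ optBound a m c ↔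
      nod n (latHom m d - v) (lo n (toCon c)) ≤ nod n (latHom m d - v) (hi n (toCon c))) := by
    intro c hc
    have h1 := (htight c).2 hc
    rw [coord_sub_coord, hv] at h1
    rw [coord_sub_coord, ← h1, nod_sub, nod_sub]
    omega
  unfold latSet secSet tangentSet
  rw [Set.mem_ofPred_eq, Set.mem_ofPred_eq, Set.mem_ofPred_eq]
  constructor
  · rintro ⟨-, h1⟩ c hc
    exact (hle c ((htight c).1 hc)).2 (h1 _ ((htight c).1 hc))
  · intro h1
    refine ⟨fun i => latHom_of_le m d, fun c hc => ?_⟩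
    rcases c with i | i
    · rcases Nat.lt_or_ge i m with hi' | hi'
      · exact (hle (Sum.inl ⟨i, hi'⟩) hc).1 (h1 _ ((htight (Sum.inl ⟨i, hi'⟩)).2 hc))
      · have := nod_row (n := n) (by omega) (latHom m d - v) i
        rw [Finsupp.sub_apply, latHom_of_le m d hi', h.supp i hi'] at this
        simp only [lo, hi]
        omega
    · rcases Nat.lt_or_ge i m with hi' | hi'
      · exact (hle (Sum.inr ⟨i, hi'⟩) hc).1 (h1 _ ((htight (Sum.inr ⟨i, hi'⟩)).2 hc))
      · rw [slack_toReal_eq_zero (by omega)] at hc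
        exact absurd hc (h.strict i hi')

variable (a) in
/-- The lattice points of the section of the polytope, in the coordinates given by the partial sums. -/
def latPts (hn : 2 ≤ n) (ha : ∀ i, 0 < a i) (m : ℕ) : Finset (Fin m → ℤ) := (finite_latPts hn ha m).toFinset

lemma mem_latPts (hn : 2 ≤ n) (ha : ∀ i, 0 < a i) {m : ℕ} {d : Fin m → ℤ} :
    d ∈ latPts a hn ha m ↔ toReal (latHom m d) ∈ polytope a := by
  simp [latPts]

lemma IsWindow.tangentSum_hasPhi (hn : 2 ≤ n) (ha : ∀ i, 0 < a i) {m : ℕ} {v : ℕ →₀ ℤ}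
    (h : IsWindow a m v) : HasPhi (latWeight n m) ((latSet a m v).indicator 1)
      (tangentSum (latWeight n m) (latPts a hn ha m) (fun j => psum v (j + 1))) := by
  rw [latSet_eq_tangentSet hn h]
  refine InfBrion.tangentSum_hasPhi (fun d => ?_) (fun x => latWeight_ne_zero hn x) ?_
  · rw [mem_latPts, mem_polytope_latHom hn ha]
  · rw [mem_latPts, latHom_psum h.supp]
    exact h.mem

end Window

end InfBrion

end

noncomputable section

namespace InfBrion

open AddMonoidAlgebra

/-! ### Expansions in `R` and their heights. -/

section Characters

variable {n : ℕ}

/-! ### The order of the weights -/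

lemma height_le_of_le {μ ν : Weight n} (h : μ ≤ ν) : height n μ ≤ height n ν := by
  obtain ⟨c, hc⟩ := h
  have := congrArg (height n) hc
  simp only [map_sub, map_sum, map_nsmul, height_simpleRoot, nsmul_eq_mul, mul_one] at this
  have h0 : (0 : ℤ) ≤ ∑ j, (c j : ℤ) := Finset.sum_nonneg fun _ _ => by positivity
  linarith

lemma finite_height (ν : Weight n) (h : ℤ) : {w : Weight n | w ≤ ν ∧ h ≤ height n w}.Finite := by
  refine ((Set.finite_Icc (0 : Fin n → ℕ) (fun _ => (height n ν - h).toNat)).image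
    fun c => ν - ∑ j, c j • simpleRoot n j).subset ?_
  rintro w ⟨⟨c, hc⟩, hw⟩
  have := congrArg (height n) hc
  simp only [map_sub, map_sum, map_nsmul, height_simpleRoot, nsmul_eq_mul, mul_one] at this
  refine ⟨c, ⟨fun j => Nat.zero_le _, fun j => ?_⟩, by simp only; rw [← hc]; abel⟩
  have h1 : (c j : ℤ) ≤ ∑ j, (c j : ℤ) :=
    Finset.single_le_sum (f := fun j => (c j : ℤ)) (fun _ _ => by positivity) (Finset.mem_univ j)
  simp only
  omega

lemma height_neg_of_le {β : Weight n} (h : β ≤ 0) (h0 : β ≠ 0) : height n β < 0 := by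
  have h1 := height_le_of_le h
  rw [map_zero] at h1
  refine lt_of_le_of_ne h1 fun h2 => h0 ?_
  obtain ⟨c, hc⟩ := h
  have := congrArg (height n) hc
  simp only [map_sub, map_zero, h2, map_sum, map_nsmul, height_simpleRoot, nsmul_eq_mul, mul_one,
    sub_zero] at this
  rw [eq_comm, Finset.sum_eq_zero_iff_of_nonneg (fun _ _ => by positivity)] at this
  rw [zero_sub, Finset.sum_eq_zero (fun j _ => by
    rw [show c j = 0 by exact_mod_cast this j (Finset.mem_univ j), zero_smul])] at hc
  exact neg_eq_zero.1 hc

/-- Dickson's lemma for `ℕ ^ n`, transported by subtracting combinations of simple roots. Any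
coefficients with support below one weight therefore define a Hahn series. -/
lemma isPWO_le (ν : Weight n) : {x : (Weight n)ᵒᵈ | OrderDual.ofDual x ≤ ν}.IsPWO := by
  have h := (Set.isPWO_of_wellQuasiOrderedLE (Set.univ : Set (Fin n → ℕ))).image_of_monotone
    (f := fun c : Fin n → ℕ => OrderDual.toDual (ν - ∑ j, c j • simpleRoot n j)) (by
      intro c d (hcd : ∀ j, c j ≤ d j)
      change ν - ∑ j, d j • simpleRoot n j ≤ ν - ∑ j, c j • simpleRoot n j
      refine ⟨fun j => d j - c j, ?_⟩
      rw [sub_sub_sub_cancel_left, ← Finset.sum_sub_distrib]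
      refine Finset.sum_congr rfl fun j _ => ?_
      rw [sub_nsmul _ (hcd j), sub_eq_add_neg])
  refine h.mono ?_
  rintro x ⟨c, hc⟩
  refine ⟨c, Set.mem_univ _, ?_⟩
  change ν - _ = OrderDual.ofDual x
  rw [← hc]; abel

/-! ### Characters with given coefficients -/

/-- The character with the given coefficients. -/
def mkChar (F : Weight n → ℂ) (ν : Weight n) (h : ∀ w, F w ≠ 0 → w ≤ ν) : CharRing n :=
  ⟨⟨fun x => F (OrderDual.ofDual x), (isPWO_le ν).mono fun _ hx => h _ hx⟩,
    {ν}, fun w hw => ⟨ν, by simp, h w hw⟩⟩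

@[simp] lemma charCoeff_mkChar (F : Weight n → ℂ) (ν : Weight n) (h : ∀ w, F w ≠ 0 → w ≤ ν)
    (w : Weight n) : charCoeff (mkChar F ν h) w = F w := rfl

lemma CharRing.ext {f g : CharRing n} (h : ∀ w, charCoeff f w = charCoeff g w) : f = g :=
  Subtype.ext (HahnSeries.ext (funext fun x => h (OrderDual.ofDual x)))

lemma charCoeff_add (f g : CharRing n) (w : Weight n) :
    charCoeff (f + g) w = charCoeff f w + charCoeff g w := rfl

lemma charCoeff_sub (f g : CharRing n) (w : Weight n) :
    charCoeff (f - g) w = charCoeff f w - charCoeff g w := rfl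

lemma charCoeff_zero (w : Weight n) : charCoeff (0 : CharRing n) w = 0 := rfl

lemma charCoeff_sum {κ : Type*} (s : Finset κ) (f : κ → CharRing n) (w : Weight n) :
    charCoeff (∑ i ∈ s, f i) w = ∑ i ∈ s, charCoeff (f i) w :=
  map_sum (⟨⟨fun g => charCoeff g w, charCoeff_zero w⟩, fun f g => charCoeff_add f g w⟩ :
    CharRing n →+ ℂ) f s

lemma toChar_single (v : Weight n) (c : ℂ) :
    ((toChar n (single v c)).1 : HahnSeries (Weight n)ᵒᵈ ℂ) =
      HahnSeries.single (OrderDual.toDual v) c := by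
  unfold toChar
  rw [lift_single]
  change c • HahnSeries.single (OrderDual.toDual v) (1 : ℂ) = _
  classical
  ext x
  rw [HahnSeries.coeff_smul, HahnSeries.coeff_single, HahnSeries.coeff_single]
  split_ifs <;> simp

lemma charCoeff_mul_single (g : CharRing n) (v w : Weight n) (c : ℂ) :
    charCoeff (g * toChar n (single v c)) w = charCoeff g (w - v) * c := by
  unfold charCoeff
  change (g.1 * (toChar n (single v c)).1).coeff _ = _
  rw [toChar_single]
  exact HahnSeries.coeff_mul_single

lemma charCoeff_mul_one_sub (g : CharRing n) (v w : Weight n) :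
    charCoeff (g * toChar n (1 - single v 1)) w = charCoeff g w - charCoeff g (w - v) := by
  rw [map_sub, map_one, show g * (1 - toChar n (single v 1)) = g - g * toChar n (single v 1) by ring,
    charCoeff_sub, charCoeff_mul_single, mul_one]

lemma charCoeff_toChar (P : LaurentZ n) (w : Weight n) : charCoeff (toChar n P) w = P.coeff w := by
  classical
  induction P using AddMonoidAlgebra.induction_linear with
  | zero => rw [map_zero]; rfl
  | add f g hf hg => rw [map_add, charCoeff_add, hf, hg]; rfl
  | single v c =>
    unfold charCoeff
    rw [toChar_single, coeff_single, Finsupp.single_apply, HahnSeries.coeff_single]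
    refine if_congr ?_ rfl rfl
    exact ⟨fun h => congrArg OrderDual.ofDual h.symm, fun h => congrArg OrderDual.toDual h.symm⟩

/-- The support of a character is bounded by a weight. -/
def SuppLE (g : CharRing n) (ν : Weight n) : Prop := ∀ w, charCoeff g w ≠ 0 → w ≤ ν

lemma SuppLE.mul {f g : CharRing n} {μ ν : Weight n} (hf : SuppLE f μ) (hg : SuppLE g ν) :
    SuppLE (f * g) (μ + ν) := by
  intro w hw
  obtain ⟨x, hx, y, hy, hxy⟩ := HahnSeries.support_mul_subset (x := f.1) (y := g.1) hw
  have : w = OrderDual.ofDual x + OrderDual.ofDual y := (congrArg OrderDual.ofDual hxy).symm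
  rw [this]
  exact add_le_add (hf _ hx) (hg _ hy)

lemma SuppLE.single (v : Weight n) (c : ℂ) : SuppLE (toChar n (single v c)) v := by
  classical
  intro w hw
  rw [charCoeff_toChar, coeff_single, Finsupp.single_apply] at hw
  split_ifs at hw with h
  · exact h.ge
  · exact absurd rfl hw

lemma SuppLE.mono {g : CharRing n} {μ ν : Weight n} (h : SuppLE g μ) (hμ : μ ≤ ν) : SuppLE g ν :=
  fun w hw => (h w hw).trans hμ

lemma SuppLE.prod {κ : Type*} (s : Finset κ) {g : κ → CharRing n} (h : ∀ i ∈ s, SuppLE (g i) 0) :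
    SuppLE (∏ i ∈ s, g i) 0 := by
  classical
  induction s using Finset.induction_on with
  | empty =>
    rw [Finset.prod_empty, ← map_one (toChar n)]
    exact SuppLE.single 0 1
  | insert i s hi ih =>
    rw [Finset.prod_insert hi, ← add_zero (0 : Weight n)]
    exact (h i (Finset.mem_insert_self i s)).mul (ih fun j hj => h j (Finset.mem_insert_of_mem hj))

/-! ### The factors attached to roots are invertible -/

lemma exists_inv_of_le {β : Weight n} (h : β ≤ 0) (h0 : β ≠ 0) :
    ∃ g : CharRing n, SuppLE g 0 ∧ g * toChar n (1 - single β 1) = 1 := by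
  classical
  have hht := height_neg_of_le h h0
  -- The geometric series; the multiples of `β` are distinct because their heights are.
  set F : Weight n → ℂ := fun w => if ∃ j : ℕ, w = j • β then 1 else 0 with hF
  have hle : ∀ w, F w ≠ 0 → w ≤ 0 := by
    intro w hw
    simp only [hF, ne_eq, ite_eq_right_iff, not_forall] at hw
    obtain ⟨⟨j, rfl⟩, -⟩ := hw
    exact nsmul_nonpos h j
  refine ⟨mkChar F 0 hle, hle, CharRing.ext fun w => ?_⟩
  rw [charCoeff_mul_one_sub, charCoeff_mkChar, charCoeff_mkChar, ← map_one (toChar n),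
    charCoeff_toChar, one_def, coeff_single, Finsupp.single_apply]
  have hinj : ∀ j : ℕ, (j + 1) • β ≠ 0 := fun j hj => by
    have := congrArg (height n) hj
    rw [map_nsmul, map_zero, nsmul_eq_mul] at this
    rcases mul_eq_zero.1 this with h1 | h1
    · push_cast at h1; omega
    · omega
  simp only [hF]
  by_cases h1 : ∃ j : ℕ, w = j • β
  · obtain ⟨j, rfl⟩ := h1
    rw [if_pos ⟨j, rfl⟩]
    rcases j with _ | j
    · rw [zero_smul, if_pos rfl, if_neg, sub_zero]
      rintro ⟨j, hj⟩
      apply hinj j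
      rw [succ_nsmul, ← hj]; abel
    · rw [if_neg (hinj j).symm, if_pos ⟨j, by rw [succ_nsmul]; abel⟩, sub_self]
  · rw [if_neg h1, if_neg (by rintro ⟨j, hj⟩; exact h1 ⟨j + 1, by rw [succ_nsmul, ← hj]; abel⟩),
      if_neg (by rintro rfl; exact h1 ⟨0, by rw [zero_smul]⟩), sub_zero]

lemma simpleRoot_nonneg (j : Fin n) : 0 ≤ simpleRoot n j :=
  ⟨Pi.single j 1, by
    rw [sub_zero, Finset.sum_eq_single j]
    · rw [Pi.single_eq_same, one_smul]
    · intro i _ hi; rw [Pi.single_eq_of_ne hi, zero_smul]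
    · simp⟩

lemma gam_mono {i j : ℕ} (hij : i ≤ j) (hj : j < n) : gam n i ≤ gam n j := by
  induction j, hij using Nat.le_induction with
  | base => exact le_refl _
  | succ j hij ih =>
    refine (ih (by omega)).trans ?_
    have := simpleRoot_nonneg (n := n) ⟨j + 1, hj⟩
    rwa [simpleRoot, if_neg (by simp), sub_nonneg, Nat.add_sub_cancel] at this

lemma gam_le_delta {i : ℕ} (hi : i < n) : gam n i ≤ delta n := by
  refine (gam_mono (show i ≤ n - 1 by omega) (by omega)).trans ?_
  have := simpleRoot_nonneg (n := n) ⟨0, by omega⟩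
  rwa [simpleRoot, if_pos rfl, sub_nonneg] at this

lemma gam_nonneg {i : ℕ} (hi : i < n) : 0 ≤ gam n i := by
  rw [← gam_zero]; exact gam_mono (Nat.zero_le i) hi

lemma delta_nonneg (hn : 2 ≤ n) : 0 ≤ delta n :=
  (gam_nonneg (show 0 < n by omega)).trans (gam_le_delta (by omega))

lemma smul_delta_le (hn : 2 ≤ n) {m l : ℤ} (h : m ≤ l) : m • delta n ≤ l • delta n :=
  zsmul_le_zsmul_left (delta_nonneg hn) h

/-- As `0 ≤ γ_i ≤ δ`, the multiple of `δ` decides the sign when it is nonzero, and otherwise the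
order of the `γ_i` does. -/
lemma IsRoot.total (hn : 2 ≤ n) {α : Weight n} (h : IsRoot n α) : α ≤ 0 ∨ 0 ≤ α := by
  rcases h with ⟨i, j, m, hi, hj, hij, rfl⟩ | ⟨m, hm, rfl⟩
  · rcases lt_trichotomy m 0 with h1 | rfl | h1
    · left
      have h2 := smul_delta_le hn (show m ≤ -1 by omega)
      have h3 := gam_le_delta hi
      have h4 := gam_nonneg hj
      calc gam n i - gam n j + m • delta n ≤ delta n - 0 + (-1 : ℤ) • delta n :=
            add_le_add (sub_le_sub h3 h4) h2
        _ = 0 := by module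
    · rcases lt_or_gt_of_ne hij with h1 | h1
      · left
        rw [zero_smul, add_zero, sub_nonpos]
        exact gam_mono h1.le hj
      · right
        rw [zero_smul, add_zero, sub_nonneg]
        exact gam_mono h1.le hi
    · right
      have h2 := smul_delta_le hn (show 1 ≤ m by omega)
      have h3 := gam_le_delta hj
      have h4 := gam_nonneg hi
      calc (0 : Weight n) = 0 - delta n + (1 : ℤ) • delta n := by module
        _ ≤ gam n i - gam n j + m • delta n := add_le_add (sub_le_sub h4 h3) h2
  · rcases le_total m 0 with h1 | h1
    · left; simpa using smul_delta_le hn h1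
    · right; simpa using smul_delta_le hn h1

lemma IsRoot.exists_inv (hn : 2 ≤ n) {α : Weight n} (h : IsRoot n α) :
    ∃ g : CharRing n, SuppLE g 0 ∧ g * toChar n (1 - AddMonoidAlgebra.single α 1) = 1 := by
  rcases h.total hn with h1 | h1
  · exact exists_inv_of_le h1 h.ne_zero
  · obtain ⟨g, hg, hg'⟩ := exists_inv_of_le (β := -α) (neg_nonpos.2 h1) (neg_ne_zero.2 h.ne_zero)
    refine ⟨g * toChar n (single (-α) (-1)), ?_, ?_⟩
    · refine (hg.mul (SuppLE.single (-α) (-1))).mono ?_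
      rw [zero_add]; exact neg_nonpos.2 h1
    · rw [mul_assoc, ← map_mul, mul_sub, mul_one, single_mul_single, neg_add_cancel, mul_one,
        show (AddMonoidAlgebra.single (0 : Weight n) (-1 : ℂ)) = -1 by
          rw [one_def, ← single_neg], show (AddMonoidAlgebra.single (-α) (-1 : ℂ)) =
          -AddMonoidAlgebra.single (-α) 1 by rw [← single_neg], sub_neg_eq_add, neg_add_eq_sub, hg']

/-! ### Rational functions and characters -/

/-- The rational function `f` has the expansion `g`. -/
def HasChar (f : RatZ n) (g : CharRing n) : Prop :=
  ∃ N D : LaurentZ n, D ≠ 0 ∧ IsUnit (toChar n D) ∧ f = toRat n N / toRat n D ∧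
    g * toChar n D = toChar n N

lemma IsCharOf.hasChar {f : RatZ n} {g : CharRing n} (h : IsCharOf f g) : HasChar f g := by
  obtain ⟨N, D, -, hD, hu, hf, hg⟩ := h
  exact ⟨N, D, hD, hu, hf, hg⟩

/-- Here `Q` need not be invertible in `R`. This allows an expansion to be tested against a
representation with unrelated denominators. -/
lemma HasChar.mul_eq {f : RatZ n} {g : CharRing n} (h : HasChar f g) {P Q : LaurentZ n} (hQ : Q ≠ 0)
    (hf : f = toRat n P / toRat n Q) : g * toChar n Q = toChar n P := by
  obtain ⟨N, D, hD, hu, hf', hg⟩ := h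
  have e : N * Q = P * D := by
    apply toRat_injective
    rw [hf, div_eq_div_iff (toRat_ne_zero hQ) (toRat_ne_zero hD)] at hf'
    rw [map_mul, map_mul, ← hf']
  have e' := congrArg (toChar n) e
  rw [map_mul, map_mul, ← hg] at e'
  apply hu.mul_right_cancel
  linear_combination e'

lemma HasChar.unique {f : RatZ n} {g g' : CharRing n} (h : HasChar f g) (h' : HasChar f g') : g = g' := by
  obtain ⟨N, D, hD, hu, hf, hg⟩ := h'
  exact hu.mul_right_cancel ((h.mul_eq hD hf).trans hg.symm)

lemma HasChar.poly (P : LaurentZ n) : HasChar (toRat n P) (toChar n P) :=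
  ⟨P, 1, one_ne_zero, by rw [map_one]; exact isUnit_one, by rw [map_one, div_one], by
    rw [map_one, mul_one]⟩

lemma HasChar.mul {f f' : RatZ n} {g g' : CharRing n} (h : HasChar f g) (h' : HasChar f' g') :
    HasChar (f * f') (g * g') := by
  obtain ⟨N, D, hD, hu, rfl, hg⟩ := h
  obtain ⟨N', D', hD', hu', rfl, hg'⟩ := h'
  refine ⟨N * N', D * D', mul_ne_zero hD hD', by rw [map_mul]; exact hu.mul hu', ?_, ?_⟩
  · rw [map_mul, map_mul, div_mul_div_comm]
  · rw [map_mul, map_mul, ← hg, ← hg']; ring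

lemma HasChar.add {f f' : RatZ n} {g g' : CharRing n} (h : HasChar f g) (h' : HasChar f' g') :
    HasChar (f + f') (g + g') := by
  obtain ⟨N, D, hD, hu, rfl, hg⟩ := h
  obtain ⟨N', D', hD', hu', rfl, hg'⟩ := h'
  refine ⟨N * D' + D * N', D * D', mul_ne_zero hD hD', by rw [map_mul]; exact hu.mul hu', ?_, ?_⟩
  · rw [div_add_div _ _ (toRat_ne_zero hD) (toRat_ne_zero hD'), map_add, map_mul, map_mul, map_mul]
  · rw [map_mul, map_add, map_mul, map_mul, ← hg, ← hg']; ring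

lemma HasChar.neg {f : RatZ n} {g : CharRing n} (h : HasChar f g) : HasChar (-f) (-g) := by
  have := (HasChar.poly (-1 : LaurentZ n)).mul h
  rwa [map_neg, map_one, map_neg, map_one, neg_one_mul, show (-1 : CharRing n) * g = -g by ring] at this

lemma HasChar.zero : HasChar (0 : RatZ n) 0 := by
  have := HasChar.poly (0 : LaurentZ n)
  rwa [map_zero, map_zero] at this

lemma HasChar.sum {κ : Type*} (s : Finset κ) {f : κ → RatZ n} {g : κ → CharRing n}
    (h : ∀ i ∈ s, HasChar (f i) (g i)) : HasChar (∑ i ∈ s, f i) (∑ i ∈ s, g i) := by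
  classical
  induction s using Finset.induction_on with
  | empty => rw [Finset.sum_empty, Finset.sum_empty]; exact HasChar.zero
  | insert i s hi ih =>
    rw [Finset.sum_insert hi, Finset.sum_insert hi]
    exact (h i (Finset.mem_insert_self i s)).add (ih fun j hj => h j (Finset.mem_insert_of_mem hj))

lemma isCharOf_zero : IsCharOf (0 : RatZ n) 0 :=
  ⟨0, 1, one_mem _, one_ne_zero, by rw [map_one]; exact isUnit_one, by simp, by simp⟩

lemma exists_isCharOf (hn : 2 ≤ n) {κ : Type*} (s : Finset κ) (v : Weight n) (β : κ → Weight n)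
    (hβ : ∀ i ∈ s, IsRoot n (β i)) :
    ∃ g : CharRing n, IsCharOf (ex v * ∏ i ∈ s, (1 - ex (β i))⁻¹) g ∧ SuppLE g v := by
  have hinv : ∀ i, ∃ g : CharRing n, i ∈ s → SuppLE g 0 ∧ g * toChar n (1 - single (β i) 1) = 1 :=
    fun i => by
      by_cases hi : i ∈ s
      · obtain ⟨g, hg⟩ := (hβ i hi).exists_inv hn
        exact ⟨g, fun _ => hg⟩
      · exact ⟨0, fun h => absurd h hi⟩
  choose g hg using hinv
  refine ⟨toChar n (AddMonoidAlgebra.single v 1) * ∏ i ∈ s, g i,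
    ⟨AddMonoidAlgebra.single v 1, ∏ i ∈ s, (1 - AddMonoidAlgebra.single (β i) 1), ?_, ?_, ?_, ?_, ?_⟩, ?_⟩
  · exact Submonoid.prod_mem _ fun i hi => Submonoid.subset_closure ⟨β i, hβ i hi, rfl⟩
  · exact Finset.prod_ne_zero_iff.2 fun i hi => one_sub_single_ne_zero (hβ i hi).ne_zero
  · rw [map_prod]
    refine IsUnit.of_mul_eq_one (∏ i ∈ s, g i) ?_
    rw [mul_comm, ← Finset.prod_mul_distrib]
    exact Finset.prod_eq_one fun i hi => (hg i hi).2
  · rw [map_prod, div_eq_mul_inv, ← Finset.prod_inv_distrib]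
    congr 1
    exact Finset.prod_congr rfl fun i _ => by rw [toRat_one_sub]
  · rw [map_prod, mul_assoc, ← Finset.prod_mul_distrib, Finset.prod_eq_one fun i hi => (hg i hi).2,
      mul_one]
  · have := (SuppLE.single v 1).mul (SuppLE.prod s fun i hi => (hg i hi).1)
    rwa [add_zero] at this

/-! ### Rational functions with bounded heights -/

/-- The products of factors `1 - exp x` with `x ≠ 0` of height at most zero. -/
def lowDenominators (n : ℕ) : Submonoid (LaurentZ n) :=
  Submonoid.closure {D | ∃ x : Weight n, x ≠ 0 ∧ height n x ≤ 0 ∧ D = 1 - single x 1}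

/-- The heights of the exponents are bounded. -/
def HeightLE (H : ℤ) (N : LaurentZ n) : Prop := ∀ w, N.coeff w ≠ 0 → height n w ≤ H

lemma HeightLE.mul {H H' : ℤ} {N N' : LaurentZ n} (h : HeightLE H N) (h' : HeightLE H' N') :
    HeightLE (H + H') (N * N') := by
  classical
  intro w hw
  rw [coeff_mul] at hw
  obtain ⟨u, hu, h1⟩ := Finset.exists_ne_zero_of_sum_ne_zero hw
  obtain ⟨v, hv, h2⟩ := Finset.exists_ne_zero_of_sum_ne_zero h1
  simp only at h2
  split_ifs at h2 with h3
  · rw [← h3, map_add]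
    exact add_le_add (h u (Finsupp.mem_support_iff.1 hu)) (h' v (Finsupp.mem_support_iff.1 hv))
  · exact absurd rfl h2

lemma HeightLE.add {H : ℤ} {N N' : LaurentZ n} (h : HeightLE H N) (h' : HeightLE H N') :
    HeightLE H (N + N') := by
  intro w hw
  by_cases h0 : N.coeff w = 0
  · refine h' w fun h1 => hw ?_
    rw [coeff_add, Finsupp.add_apply, h0, h1, add_zero]
  · exact h w h0

lemma HeightLE.single {H : ℤ} {v : Weight n} (hv : height n v ≤ H) (c : ℂ) :
    HeightLE H (single v c : LaurentZ n) := by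
  classical
  intro w hw
  rw [coeff_single, Finsupp.single_apply] at hw
  split_ifs at hw with h
  · rwa [← h]
  · exact absurd rfl hw

lemma HeightLE.of_lowDenominators {E : LaurentZ n} (h : E ∈ lowDenominators n) : HeightLE 0 E := by
  have h1 : HeightLE 0 (1 : LaurentZ n) := HeightLE.single (by rw [map_zero]) 1
  induction h using Submonoid.closure_induction with
  | mem D hD =>
    obtain ⟨x, -, hx, rfl⟩ := hD
    rw [sub_eq_add_neg, ← single_neg]
    exact h1.add (HeightLE.single hx (-1))
  | one => exact h1
  | mul D D' _ _ h h' => exact h.mul h'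

lemma lowDenominators_ne_zero {E : LaurentZ n} (h : E ∈ lowDenominators n) : E ≠ 0 := by
  induction h using Submonoid.closure_induction with
  | mem D hD =>
    obtain ⟨x, hx, -, rfl⟩ := hD
    exact one_sub_single_ne_zero hx
  | one => exact one_ne_zero
  | mul D D' _ _ h h' => exact mul_ne_zero h h'

/-- Quotients of Laurent polynomials of bounded height by products of factors `1 - exp x` with `x` of
height at most zero. -/
def LowRat (H : ℤ) (f : RatZ n) : Prop :=
  ∃ N E : LaurentZ n, E ∈ lowDenominators n ∧ HeightLE H N ∧ f = toRat n N / toRat n E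

lemma LowRat.mul {H H' : ℤ} {f f' : RatZ n} (h : LowRat H f) (h' : LowRat H' f') :
    LowRat (H + H') (f * f') := by
  obtain ⟨N, E, hE, hN, rfl⟩ := h
  obtain ⟨N', E', hE', hN', rfl⟩ := h'
  exact ⟨N * N', E * E', mul_mem hE hE', hN.mul hN', by rw [map_mul, map_mul, div_mul_div_comm]⟩

lemma LowRat.add {H : ℤ} {f f' : RatZ n} (h : LowRat H f) (h' : LowRat H f') : LowRat H (f + f') := by
  obtain ⟨N, E, hE, hN, rfl⟩ := h
  obtain ⟨N', E', hE', hN', rfl⟩ := h'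
  refine ⟨N * E' + E * N', E * E', mul_mem hE hE', ?_, ?_⟩
  · have h1 := hN.mul (HeightLE.of_lowDenominators hE')
    have h2 := (HeightLE.of_lowDenominators hE).mul hN'
    rw [add_zero] at h1
    rw [zero_add] at h2
    exact h1.add h2
  · rw [div_add_div _ _ (toRat_ne_zero (lowDenominators_ne_zero hE))
      (toRat_ne_zero (lowDenominators_ne_zero hE')), map_add, map_mul, map_mul, map_mul]

lemma LowRat.poly {H : ℤ} {N : LaurentZ n} (h : HeightLE H N) : LowRat H (toRat n N) :=
  ⟨N, 1, one_mem _, h, by rw [map_one, div_one]⟩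

lemma LowRat.sum {κ : Type*} (s : Finset κ) {H : ℤ} {f : κ → RatZ n} (h : ∀ i ∈ s, LowRat H (f i)) :
    LowRat H (∑ i ∈ s, f i) := by
  classical
  induction s using Finset.induction_on with
  | empty =>
    rw [Finset.sum_empty, ← map_zero (toRat n)]
    exact LowRat.poly fun w hw => absurd rfl hw
  | insert i s hi ih =>
    rw [Finset.sum_insert hi]
    exact (h i (Finset.mem_insert_self i s)).add (ih fun j hj => h j (Finset.mem_insert_of_mem hj))

lemma LowRat.prod {κ : Type*} (s : Finset κ) {f : κ → RatZ n} (h : ∀ i ∈ s, LowRat 0 (f i)) :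
    LowRat 0 (∏ i ∈ s, f i) := by
  classical
  induction s using Finset.induction_on with
  | empty =>
    rw [Finset.prod_empty, ← map_one (toRat n)]
    exact LowRat.poly (HeightLE.single (by rw [map_zero]) 1)
  | insert i s hi ih =>
    rw [Finset.prod_insert hi]
    exact (h i (Finset.mem_insert_self i s)).mul (ih fun j hj => h j (Finset.mem_insert_of_mem hj))

lemma LowRat.ex_div {x : Weight n} (hx : x ≠ 0) : LowRat 0 (ex x * (1 - ex x)⁻¹) := by
  rcases le_total (height n x) 0 with h | h
  · refine ⟨AddMonoidAlgebra.single x 1, 1 - AddMonoidAlgebra.single x 1,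
      Submonoid.subset_closure ⟨x, hx, h, rfl⟩, HeightLE.single h 1, ?_⟩
    rw [toRat_one_sub, div_eq_mul_inv]; rfl
  -- Rewriting the factor as `-1 / (1 - exp (-x))` covers positive heights.
  · refine ⟨-1, 1 - AddMonoidAlgebra.single (-x) 1,
      Submonoid.subset_closure ⟨-x, neg_ne_zero.2 hx, by rw [map_neg]; omega, rfl⟩, ?_, ?_⟩
    · rw [one_def, ← single_neg]
      exact HeightLE.single (by rw [map_zero]) (-1)
    · have h1 := one_sub_ex_ne_zero hx
      have h2 := one_sub_ex_ne_zero (neg_ne_zero.2 hx)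
      have h3 := ex_neg_mul x
      rw [toRat_one_sub, ← div_eq_mul_inv, div_eq_div_iff h1 h2, map_neg, map_one]
      linear_combination -h3

/-- Above height `H` the coefficients of `g` are constant along `w, w - x, w - 2x, ...`, whose
heights do not decrease. The support of an element of `R` has only finitely many weights of height
at least that of `w`, so the constant is 0. -/
lemma coeff_eq_zero_of_mul_one_sub {g : CharRing n} {H : ℤ} {x : Weight n} (hx : x ≠ 0)
    (hht : height n x ≤ 0)
    (h : ∀ w, H < height n w → charCoeff (g * toChar n (1 - single x 1)) w = 0) :
    ∀ w, H < height n w → charCoeff g w = 0 := by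
  intro w hw
  by_contra hne
  have hshift : ∀ j : ℕ, charCoeff g (w - j • x) = charCoeff g w := by
    intro j
    induction j with
    | zero => rw [zero_smul, sub_zero]
    | succ j ih =>
      have h1 := h (w - j • x) (by
        rw [map_sub, map_nsmul, nsmul_eq_mul]
        have : (j : ℤ) * height n x ≤ 0 :=
          mul_nonpos_of_nonneg_of_nonpos (Int.natCast_nonneg _) hht
        omega)
      rw [charCoeff_mul_one_sub, ih, sub_eq_zero] at h1
      rw [h1, succ_nsmul]
      congr 1
      abel
  obtain ⟨s, hs⟩ := g.2
  have hfin : (⋃ ν ∈ s, {v : Weight n | v ≤ ν ∧ height n w ≤ height n v}).Finite :=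
    s.finite_toSet.biUnion fun ν _ => finite_height ν _
  refine Set.infinite_range_of_injective (f := fun j : ℕ => w - j • x) ?_ (hfin.subset ?_)
  · intro i j hij
    simp only [sub_right_inj] at hij
    have h1 : ((i : ℤ) - j) • x = 0 := by
      rw [sub_smul, natCast_zsmul, natCast_zsmul, hij, sub_self]
    have h2 : (i : ℤ) - j = 0 := by
      by_contra h2
      apply hx
      refine Weight.ext (fun r => ?_) ?_
      · have := congrArg (fun v : Weight n => v.1 r) h1
        simp only [Weight.zsmul_fst, Weight.zero_fst] at this
        exact (mul_eq_zero.1 this).resolve_left h2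
      · have := congrArg (fun v : Weight n => v.2) h1
        simp only [Weight.zsmul_snd, Weight.zero_snd] at this
        exact (mul_eq_zero.1 this).resolve_left h2
    omega
  · rintro _ ⟨j, rfl⟩
    obtain ⟨ν, hν, hle⟩ := hs (w - j • x) (by
      change charCoeff g (w - j • x) ≠ 0
      rwa [hshift])
    refine Set.mem_biUnion hν ⟨hle, ?_⟩
    simp only
    rw [map_sub, map_nsmul, nsmul_eq_mul]
    have : (j : ℤ) * height n x ≤ 0 := mul_nonpos_of_nonneg_of_nonpos (Int.natCast_nonneg _) hht
    omega

/-- The expansion of a quotient of bounded height vanishes at large heights. -/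
theorem HasChar.coeff_eq_zero {f : RatZ n} {g : CharRing n} (h : HasChar f g) {H : ℤ}
    (hf : LowRat H f) {w : Weight n} (hw : H < height n w) : charCoeff g w = 0 := by
  obtain ⟨N, E, hE, hN, hf⟩ := hf
  have h1 := h.mul_eq (lowDenominators_ne_zero hE) hf
  have h2 : ∀ w, H < height n w → charCoeff (g * toChar n E) w = 0 := fun w hw => by
    rw [h1, charCoeff_toChar]
    by_contra h3
    have := hN w h3
    omega
  clear h1 hf h
  revert w
  induction hE using Submonoid.closure_induction generalizing g with
  | mem D hD =>
    obtain ⟨x, hx, hht, rfl⟩ := hD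
    intro w hw
    exact coeff_eq_zero_of_mul_one_sub hx hht h2 w hw
  | one =>
    rw [map_one, mul_one] at h2
    intro w hw
    exact h2 w hw
  | mul D D' _ _ h h' =>
    rw [map_mul, ← mul_assoc] at h2
    intro w hw
    exact h (fun w hw => h' h2 hw) hw

end Characters

end InfBrion

end

noncomputable section

namespace InfBrion

section Final

variable {n : ℕ} {a : Fin n → ℕ}

/-! ### Weights of the integral points of the polytope -/

lemma starWeight_eq_sum {v : ℕ →₀ ℤ} {B : ℕ} (hB : ∀ i, B ≤ i → v i = 0) :
    starWeight n v = ∑ i ∈ Finset.range B, v i • varWeight n i := by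
  unfold starWeight
  rw [Finsupp.liftAddHom_apply, Finsupp.sum_of_support_subset (s := Finset.range B)]
  · rfl
  · intro i hi
    rw [Finset.mem_range]
    by_contra h
    exact Finsupp.mem_support_iff.1 hi (hB i (by omega))
  · simp

lemma varWeight_nonpos (hn : 2 ≤ n) {i : ℕ} (hi : n - 1 ≤ i) : varWeight n i ≤ 0 := by
  have h1 : 1 ≤ i / (n - 1) := (Nat.one_le_div_iff (by omega)).2 hi
  have h2 := Nat.mod_lt i (show 0 < n - 1 by omega)
  rw [varWeight_eq]
  calc gam n (i % (n - 1) + 1) + (-((i / (n - 1) : ℕ) : ℤ)) • delta n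
      ≤ delta n + (-1 : ℤ) • delta n :=
        add_le_add (gam_le_delta (by omega)) (smul_delta_le hn (by omega))
    _ = 0 := by module

lemma varWeight_nonneg (hn : 2 ≤ n) {i : ℕ} (hi : i < n - 1) : 0 ≤ varWeight n i := by
  rw [varWeight_eq, Nat.mod_eq_of_lt hi, Nat.div_eq_of_lt hi]
  simpa using gam_nonneg (n := n) (i := i + 1) (by omega)

lemma height_varWeight_le (hn : 2 ≤ n) {i : ℕ} (hi : n - 1 ≤ i) :
    height n (varWeight n i) ≤ -((i / (n - 1) : ℕ) : ℤ) := by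
  have h1 : 1 ≤ i / (n - 1) := (Nat.one_le_div_iff (by omega)).2 hi
  have h2 := Nat.mod_lt i (show 0 < n - 1 by omega)
  rw [varWeight_eq, map_add, map_zsmul, height_gam _ _ (by omega), height_delta, smul_eq_mul]
  set h := i / (n - 1)
  have h3 : (((i % (n - 1) + 1 : ℕ)) : ℤ) ≤ n - 1 := by omega
  have h4 : ((n : ℤ) - 1) * 1 ≤ (n - 1) * h :=
    mul_le_mul_of_nonneg_left (by exact_mod_cast h1) (by omega)
  linarith

variable (a) in
/-- An upper bound for the weights of the integral points of the polytope. -/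
def topWeight : Weight n := ∑ i ∈ Finset.range (n - 1), lev a • varWeight n i

lemma starWeight_head_le (hn : 2 ≤ n) (ha : ∀ i, 0 < a i) {v : ℕ →₀ ℤ} (hv : toReal v ∈ polytope a) :
    ∑ i ∈ Finset.range (n - 1), v i • varWeight n i ≤ topWeight a :=
  Finset.sum_le_sum fun i hi => zsmul_le_zsmul_left
    (varWeight_nonneg hn (Finset.mem_range.1 hi)) (le_lev_of_mem hn ha hv i).2

lemma exists_tail (v : ℕ →₀ ℤ) : ∃ B, (∀ i, n - 1 + B ≤ i → v i = 0) ∧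
    starWeight n v = ∑ i ∈ Finset.range (n - 1), v i • varWeight n i +
      ∑ i ∈ Finset.range B, v (n - 1 + i) • varWeight n (n - 1 + i) := by
  obtain ⟨B, hB⟩ := exists_supp_bound v
  have hB' : ∀ i, n - 1 + B ≤ i → v i = 0 := fun i hi => hB i (by omega)
  exact ⟨B, hB', by rw [starWeight_eq_sum hB', Finset.sum_range_add]⟩

lemma zsmul_nonpos_of_nonneg_of_nonpos {c : ℤ} {w : Weight n} (hc : 0 ≤ c) (hw : w ≤ 0) :
    c • w ≤ 0 := by
  have := zsmul_nonneg (neg_nonneg.2 hw) hc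
  rwa [smul_neg, neg_nonneg] at this

lemma starWeight_le (hn : 2 ≤ n) (ha : ∀ i, 0 < a i) {v : ℕ →₀ ℤ} (hv : toReal v ∈ polytope a) :
    starWeight n v ≤ topWeight a := by
  obtain ⟨B, -, h⟩ := exists_tail (n := n) v
  rw [h, ← add_zero (topWeight a)]
  refine add_le_add (starWeight_head_le hn ha hv) (Finset.sum_nonpos fun i _ => ?_)
  exact zsmul_nonpos_of_nonneg_of_nonpos (le_lev_of_mem hn ha hv _).1
    (varWeight_nonpos hn (by omega))

/-- Past the first `n - 1` variables each unit of `v i` lowers the height by at least `i / (n - 1)`,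
while the first variables contribute at most `topWeight a`. -/
lemma height_starWeight_le (hn : 2 ≤ n) (ha : ∀ i, 0 < a i) {v : ℕ →₀ ℤ} (hv : toReal v ∈ polytope a)
    {i : ℕ} (hi : n - 1 ≤ i) (hvi : v i ≠ 0) :
    ((i / (n - 1) : ℕ) : ℤ) ≤ height n (topWeight a) - height n (starWeight n v) := by
  obtain ⟨B, hB, h⟩ := exists_tail (n := n) v
  have h1 := height_le_of_le (starWeight_head_le hn ha hv)
  have h2 : ((i / (n - 1) : ℕ) : ℤ) ≤
      ∑ j ∈ Finset.range B, -(v (n - 1 + j) * height n (varWeight n (n - 1 + j))) := by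
    have h3 := Finset.single_le_sum
      (f := fun j => -(v (n - 1 + j) * height n (varWeight n (n - 1 + j)))) (s := Finset.range B)
      (fun j _ => by
        have h4 := height_varWeight_le hn (show n - 1 ≤ n - 1 + j by omega)
        have h5 := (le_lev_of_mem hn ha hv (n - 1 + j)).1
        have h6 : height n (varWeight n (n - 1 + j)) ≤ 0 :=
          h4.trans (neg_nonpos.2 (Int.natCast_nonneg _))
        exact neg_nonneg.2 (mul_nonpos_of_nonneg_of_nonpos h5 h6)) (a := i - (n - 1)) (by
        rw [Finset.mem_range]
        by_contra hlt
        exact hvi (hB i (by omega)))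
    refine le_trans ?_ h3
    rw [show n - 1 + (i - (n - 1)) = i by omega]
    have h4 := height_varWeight_le hn hi
    have h5 := (le_lev_of_mem hn ha hv i).1
    have h6 : 1 ≤ v i := by omega
    nlinarith [Int.natCast_nonneg (i / (n - 1))]
  rw [Finset.sum_neg_distrib] at h2
  rw [h, map_add, map_sum (height n) _ (Finset.range B)]
  simp only [map_zsmul, smul_eq_mul]
  linarith

lemma finite_height_le (hn : 2 ≤ n) (ha : ∀ i, 0 < a i) (h : ℤ) :
    {v : ℕ →₀ ℤ | toReal v ∈ polytope a ∧ h ≤ height n (starWeight n v)}.Finite := by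
  refine (finite_supp_mem hn ha ((n - 1) * ((height n (topWeight a) - h).toNat + 1))).subset ?_
  rintro v ⟨hv, hh⟩
  refine ⟨hv, fun i hi => ?_⟩
  by_contra hne
  have h1 : (height n (topWeight a) - h).toNat + 1 ≤ i / (n - 1) :=
    (Nat.le_div_iff_mul_le (by omega)).2 (by rw [mul_comm]; exact hi)
  have h2 : n - 1 ≤ i := by
    refine le_trans ?_ hi
    exact Nat.le_mul_of_pos_right _ (by omega)
  have := height_starWeight_le hn ha hv h2 hne
  omega

lemma exists_genFun (hn : 2 ≤ n) (ha : ∀ i, 0 < a i) : ∃ S : CharRing n, IsGenFun (polytope a) S := by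
  have hfin : ∀ w : Weight n, {x : ℕ →₀ ℤ | toReal x ∈ polytope a ∧ starWeight n x = w}.Finite :=
    fun w => (finite_height_le hn ha (height n w)).subset fun x hx => ⟨hx.1, by rw [hx.2]⟩
  refine ⟨mkChar (fun w =>
    ({x : ℕ →₀ ℤ | toReal x ∈ polytope a ∧ starWeight n x = w}.ncard : ℂ)) (topWeight a)
    (fun w hw => ?_), fun w => ⟨hfin w, rfl⟩⟩
  obtain ⟨x, hx, rfl⟩ := Set.nonempty_of_ncard_ne_zero (by exact_mod_cast hw)
  exact starWeight_le hn ha hx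

/-! ### The characters of the vertices -/

/-- `g` is the expansion of the generating function of the section of the cone at `v`. -/
def IsSectionChar (a : Fin n → ℕ) (m : ℕ) (v : ℕ →₀ ℤ) (g : CharRing n) : Prop :=
  ∃ f, HasPhi (starWeight n) ((secSet a m v).indicator 1) f ∧ IsCharOf f g ∧ SuppLE g (starWeight n v)

/-- For a non-regular pattern the vanishing theorem needs a specialised sum to apply to; the
triangulation provides one. -/
lemma IsWindow.exists_sectionChar (hn : 2 ≤ n) (ha : ∀ i, 0 < a i) {m : ℕ} {v : ℕ →₀ ℤ}
    (h : IsWindow a m v) : ∃ g, IsSectionChar a m v g := by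
  by_cases hreg : IsRegularAt a m v
  · obtain ⟨β, hβ, hf⟩ := h.regular_hasPhi hn ha hreg
    obtain ⟨g, hg, hs⟩ := exists_isCharOf hn Finset.univ (starWeight n v) β fun j _ => hβ j
    exact ⟨g, _, hf.of_latSet, hg, hs⟩
  · have h1 := h.tangentSum_hasPhi hn ha
    rw [h.eq_zero_of_not_regular hn ha hreg h1] at h1
    exact ⟨0, 0, h1.of_latSet, isCharOf_zero, fun w hw => absurd rfl hw⟩

lemma IsSectionChar.mul_one_sub (hn : 2 ≤ n) {m : ℕ} {v : ℕ →₀ ℤ} (h : IsWindow a m v)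
    {g g' : CharRing n} (hg : IsSectionChar a m v g) (hg' : IsSectionChar a (m + 1) v g') :
    g' * toChar n (1 - AddMonoidAlgebra.single (varWeight n m) 1) = g := by
  obtain ⟨f, hf, hfg, -⟩ := hg
  obtain ⟨f', hf', hfg', -⟩ := hg'
  have h1 := hf'.unique (h.hasPhi_succ hn hf)
  refine (hfg'.hasChar.mul (HasChar.poly _)).unique ?_
  rw [h1, toRat_one_sub, inv_mul_cancel_right₀ (one_sub_ex_ne_zero (isRoot_varWeight hn m).ne_zero)]
  exact hfg.hasChar

/-- Successive characters satisfy `τ (m + 1) * (1 - exp (varWeight n m)) = τ m`, and all have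
support below the weight of `v`. For large `m` the shift by `varWeight n m`, of very negative
height, leads out of this support, so the coefficient no longer changes. -/
lemma exists_limit (hn : 2 ≤ n) (ha : ∀ i, 0 < a i) {v : ℕ →₀ ℤ} (hv : IsVertex a (toReal v)) :
    ∃ (τ : ℕ → CharRing n) (g : CharRing n),
      (∀ m, lastG a (toReal v) ≤ m → IsSectionChar a m v (τ m)) ∧ SuppLE g (starWeight n v) ∧
      ∀ w, ∃ M, ∀ m, M ≤ m → charCoeff (τ m) w = charCoeff g w := by
  set l := lastG a (toReal v) with hl
  have hex : ∀ m, ∃ g, l ≤ m → IsSectionChar a m v g := fun m => by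
    by_cases hm : l ≤ m
    · obtain ⟨g, hg⟩ := (hv.isWindow hn ha hm).exists_sectionChar hn ha
      exact ⟨g, fun _ => hg⟩
    · exact ⟨0, fun h => absurd h hm⟩
  choose τ hτ using hex
  -- From here on `m / (n - 1)` exceeds the difference of the heights of `v` and `w`.
  set b : Weight n → ℕ := fun w =>
    max l ((n - 1) * ((height n (starWeight n v) - height n w).toNat + 1)) with hb
  have hstab : ∀ w m, b w ≤ m → charCoeff (τ m) w = charCoeff (τ (b w)) w := by
    intro w m hm
    induction m, hm using Nat.le_induction with
    | base => rfl
    | succ m hm ih =>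
      have hlm : l ≤ m := (le_max_left _ _).trans hm
      have h1 := (hτ m hlm).mul_one_sub hn (hv.isWindow hn ha hlm) (hτ (m + 1) (by omega))
      have h2 := congrArg (fun g => charCoeff g w) h1
      simp only [charCoeff_mul_one_sub] at h2
      have h3 : charCoeff (τ (m + 1)) (w - varWeight n m) = 0 := by
        by_contra hne
        obtain ⟨-, -, -, hs⟩ := hτ (m + 1) (by omega)
        have h4 := height_le_of_le (hs _ hne)
        have h5 : (n - 1) * ((height n (starWeight n v) - height n w).toNat + 1) ≤ m :=
          (le_max_right _ _).trans hm
        have h6 : (height n (starWeight n v) - height n w).toNat + 1 ≤ m / (n - 1) :=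
          (Nat.le_div_iff_mul_le (by omega)).2 (by rw [mul_comm]; exact h5)
        have h7 := height_varWeight_le hn (i := m) (by
          refine le_trans ?_ h5
          exact Nat.le_mul_of_pos_right _ (by omega))
        rw [map_sub] at h4
        omega
      rw [h3, sub_zero] at h2
      rw [h2, ih]
  have hsupp : ∀ w, charCoeff (τ (b w)) w ≠ 0 → w ≤ starWeight n v := fun w hw => by
    obtain ⟨-, -, -, hs⟩ := hτ (b w) (le_max_left _ _)
    exact hs w hw
  exact ⟨τ, mkChar (fun w => charCoeff (τ (b w)) w) (starWeight n v) hsupp, hτ, hsupp,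
    fun w => ⟨b w, hstab w⟩⟩

/-! ### The contributions of the points near the end of the window -/

lemma LowRat.mono {H H' : ℤ} {f : RatZ n} (h : LowRat H f) (hH : H ≤ H') : LowRat H' f := by
  obtain ⟨N, E, hE, hN, rfl⟩ := h
  exact ⟨N, E, hE, fun w hw => (hN w hw).trans hH, rfl⟩

/-- A relatively open cone contributes `exp v` times factors `exp x / (1 - exp x)`, each bounded by
height 0 whatever the sign of `x`. No root property of the denominators is needed, so this covers
points outside the window condition. -/
lemma lowRat_tangentSum (hn : 2 ≤ n) {m : ℕ} (P : Finset (Fin m → ℤ)) (d : Fin m → ℤ) :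
    LowRat (height n (latWeight n m d)) (tangentSum (latWeight n m) P d) := by
  classical
  refine LowRat.sum _ fun f hf => ?_
  simp only [Finset.mem_filter] at hf
  unfold openConeSum
  rw [← add_zero (height n (latWeight n m d))]
  refine LowRat.mul (LowRat.poly (HeightLE.single le_rfl 1)) (LowRat.prod _ fun w hw => ?_)
  obtain ⟨h1, h2⟩ := Finset.mem_erase.1 hw
  exact LowRat.ex_div (hf.2.1.weight_ne (fun x => latWeight_ne_zero hn x) hf.2.2 h2 h1)

end Final

end InfBrion

end

/-! ### Comparison of coefficients and the theorem. -/

-- Only finitely many points of Π have height at least that of `w`. A section large enough for all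
-- of them satisfies Brion's identity; its window points give the vertex characters or 0, and the
-- other points, all of smaller height, do not affect the coefficient at `w`.
open InfBrion in
theorem InfBrion.coeff_sum_eq {n : ℕ} {a : Fin n → ℕ} (hn : 2 ≤ n) (ha : ∀ i, 0 < a i)
    {τ : (ℕ →₀ ℤ) → ℕ → CharRing n} {g : (ℕ →₀ ℤ) → CharRing n}
    (hτ : ∀ v, IsVertex a (toReal v) → ∀ m, lastG a (toReal v) ≤ m → IsSectionChar a m v (τ v m))
    (hg : ∀ v, IsVertex a (toReal v) → SuppLE (g v) (starWeight n v))
    (hlim : ∀ v, IsVertex a (toReal v) → ∀ w, ∃ M, ∀ m, M ≤ m →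
      charCoeff (τ v m) w = charCoeff (g v) w) (w : Weight n) [DecidablePred fun v => IsVertex a (toReal v)] :
    ({x : ℕ →₀ ℤ | toReal x ∈ polytope a ∧ starWeight n x = w}.ncard : ℂ) =
      ∑ v ∈ (finite_height_le hn ha (height n w)).toFinset,
        if IsVertex a (toReal v) then charCoeff (g v) w else 0 := by
  classical
  set E := (finite_height_le hn ha (height n w)).toFinset with hE
  have hEmem : ∀ v, v ∈ E ↔ toReal v ∈ polytope a ∧ height n w ≤ height n (starWeight n v) := by
    simp [hE]
  have hM : ∀ v, ∃ M, IsVertex a (toReal v) → ∀ m, M ≤ m → charCoeff (τ v m) w = charCoeff (g v) w :=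
    fun v => by
      by_cases hv : IsVertex a (toReal v)
      · obtain ⟨M, h⟩ := hlim v hv w
        exact ⟨M, fun _ => h⟩
      · exact ⟨0, fun h => absurd h hv⟩
  choose M hM using hM
  choose B hB using exists_supp_bound
  -- Beyond `m` the coefficients at `w` of the characters of vertices in `E` are stable, and every
  -- point of `E` satisfies the window condition.
  set m := E.sup fun v => max (M v) (max (B v) (lastG a (toReal v))) with hm
  have hmE : ∀ v ∈ E, M v ≤ m ∧ B v ≤ m ∧ lastG a (toReal v) ≤ m := fun v hv => by
    have := Finset.le_sup (f := fun v => max (M v) (max (B v) (lastG a (toReal v)))) hv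
    simp only [← hm] at this
    omega
  have hwin : ∀ v ∈ E, IsWindow a m v := fun v hv =>
    ⟨((hEmem v).1 hv).1, fun i hi => hB v i ((hmE v hv).2.1.trans hi),
      (lastG_le_iff hn ha ((hEmem v).1 hv).1).1 (hmE v hv).2.2⟩
  set P := latPts a hn ha m with hP
  set χ : (Fin m → ℤ) → CharRing n := fun d =>
    if IsVertex a (toReal (latHom m d)) then τ (latHom m d) m else 0 with hχ
  have hpt : ∀ d : Fin m → ℤ, (fun j : Fin m => psum (latHom m d) (j + 1)) = d := fun d =>
    funext fun j => psum_latHom_succ m d j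
  have hlast : ∀ d, IsWindow a m (latHom m d) → lastG a (toReal (latHom m d)) ≤ m := fun d hd =>
    (lastG_le_iff hn ha hd.mem).2 hd.strict
  have hgood : ∀ d, IsWindow a m (latHom m d) → HasChar (tangentSum (latWeight n m) P d) (χ d) := by
    intro d hd
    have h1 := hd.tangentSum_hasPhi hn ha
    rw [hpt] at h1
    simp only [hχ]
    split_ifs with hv
    · obtain ⟨f, hf, hfg, -⟩ := hτ _ hv m (hlast d hd)
      rw [h1.of_latSet.unique hf]
      exact hfg.hasChar
    · rw [hd.eq_zero_of_not_regular hn ha (fun hreg => hv (hd.isVertex hn hreg)) h1]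
      exact HasChar.zero
  have hsum := sum_tangentSum (st := latWeight n m) P fun x => latWeight_ne_zero hn x
  rw [← Finset.sum_filter_add_sum_filter_not P fun d => IsWindow a m (latHom m d)] at hsum
  have hbad : LowRat (height n w - 1)
      (∑ d ∈ P with ¬ IsWindow a m (latHom m d), tangentSum (latWeight n m) P d) := by
    refine LowRat.sum _ fun d hd => (lowRat_tangentSum hn P d).mono ?_
    rw [Finset.mem_filter] at hd
    by_contra hlt
    refine hd.2 (hwin _ ((hEmem _).2 ⟨(mem_latPts hn ha).1 hd.1, ?_⟩))
    change height n w ≤ height n (latWeight n m d)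
    omega
  -- The denominators of the individual bad terms need not be invertible in `R`; their total has an
  -- expansion because the rest of Brion's identity has one.
  have hchar : HasChar (∑ d ∈ P with ¬ IsWindow a m (latHom m d), tangentSum (latWeight n m) P d)
      (toChar n (∑ d ∈ P, AddMonoidAlgebra.single (latWeight n m d) 1) +
        -∑ d ∈ P with IsWindow a m (latHom m d), χ d) := by
    rw [eq_sub_of_add_eq' hsum, sub_eq_add_neg]
    refine HasChar.add ?_ (HasChar.sum _ fun d hd => hgood d (Finset.mem_filter.1 hd).2).neg
    have := HasChar.poly (∑ d ∈ P, AddMonoidAlgebra.single (latWeight n m d) (1 : ℂ))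
    rwa [map_sum (toRat n)] at this
  have hzero := hchar.coeff_eq_zero hbad (w := w) (by omega)
  rw [charCoeff_add, charCoeff_toChar] at hzero
  replace hzero := (eq_neg_of_add_eq_zero_left hzero).trans (neg_neg (charCoeff (∑ d ∈ P with IsWindow a m (latHom m d), χ d) w))
  rw [charCoeff_sum] at hzero
  have hL : (∑ d ∈ P, AddMonoidAlgebra.single (latWeight n m d) (1 : ℂ)).coeff w =
      ({x : ℕ →₀ ℤ | toReal x ∈ polytope a ∧ starWeight n x = w}.ncard : ℂ) := by
    have h1 : {x : ℕ →₀ ℤ | toReal x ∈ polytope a ∧ starWeight n x = w} =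
        latHom m '' ((P.filter fun d => latWeight n m d = w : Finset (Fin m → ℤ)) : Set (Fin m → ℤ)) := by
      ext x
      constructor
      · rintro ⟨hx, hxw⟩
        have hxE : x ∈ E := (hEmem x).2 ⟨hx, by rw [hxw]⟩
        have hxx := latHom_psum (hwin x hxE).supp
        refine ⟨fun j => psum x (j + 1), ?_, hxx⟩
        rw [Finset.mem_coe, Finset.mem_filter, mem_latPts, latWeight, AddMonoidHom.comp_apply, hxx]
        exact ⟨hx, hxw⟩
      · rintro ⟨d, hd, rfl⟩
        rw [Finset.mem_coe, Finset.mem_filter, mem_latPts] at hd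
        exact hd
    rw [h1, Set.ncard_image_of_injective _ (latHom_injective m), Set.ncard_coe_finset,
      ← Finset.sum_boole]
    rw [← charCoeff_toChar, map_sum, charCoeff_sum]
    refine Finset.sum_congr rfl fun d _ => ?_
    rw [charCoeff_toChar, AddMonoidAlgebra.coeff_single, Finsupp.single_apply]
  rw [← hL, hzero]
  set h : (ℕ →₀ ℤ) → ℂ := fun v => if IsVertex a (toReal v) then charCoeff (g v) w else 0 with hh
  -- The character of a vertex is supported below its weight, so a vertex of smaller height than `w`
  -- has coefficient 0 at `w`.
  have hout : ∀ v, v ∉ E → h v = 0 := fun v hv => by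
    simp only [hh]
    split_ifs with hvert
    · by_contra hne
      exact hv ((hEmem v).2 ⟨hvert.1, height_le_of_le (hg v hvert w hne)⟩)
    · rfl
  have hχh : ∀ d, IsWindow a m (latHom m d) → charCoeff (χ d) w = h (latHom m d) := by
    intro d hd
    by_cases hv : IsVertex a (toReal (latHom m d))
    · simp only [hχ, if_pos hv]
      by_cases hdE : latHom m d ∈ E
      · simp only [hh, if_pos hv]
        exact hM _ hv m (hmE _ hdE).1
      · rw [hout _ hdE]
        by_contra hne
        obtain ⟨-, -, -, hs⟩ := hτ _ hv m (hlast d hd)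
        exact hdE ((hEmem _).2 ⟨hv.1, height_le_of_le (hs w hne)⟩)
    · simp only [hχ, hh, if_neg hv]
      rfl
  rw [Finset.sum_congr rfl fun d hd => hχh d (Finset.mem_filter.1 hd).2,
    ← Finset.sum_image (f := h) (g := latHom m) (latHom_injective m).injOn]
  refine (Finset.sum_subset (fun v hv => ?_) fun v _ hv => hout v hv).symm
  have hvv := latHom_psum (hwin v hv).supp
  refine Finset.mem_image.2 ⟨fun j => psum v (j + 1), Finset.mem_filter.2 ⟨?_, ?_⟩, hvv⟩
  · rw [mem_latPts, hvv]; exact ((hEmem v).1 hv).1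
  · rw [hvv]; exact hwin v hv

theorem mainTheorem2 (n : ℕ) (hn : 2 ≤ n) (a : Fin n → ℕ) (ha : ∀ i, 0 < a i) :
    ∃ (S : InfBrion.CharRing n) (τ : {u : ℕ →₀ ℝ // InfBrion.IsVertex a u} → InfBrion.CharRing n),
      InfBrion.IsGenFun (InfBrion.polytope a) S ∧
      (∀ u : {u : ℕ →₀ ℝ // InfBrion.IsVertex a u}, InfBrion.IsLimitChar a u (τ u)) ∧
      ∀ w : InfBrion.Weight n, {u | InfBrion.charCoeff (τ u) w ≠ 0}.Finite ∧ InfBrion.charCoeff S w = ∑ᶠ u, InfBrion.charCoeff (τ u) w := by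
  classical
  open InfBrion in
  obtain ⟨S, hS⟩ := exists_genFun hn ha
  have hex : ∀ v : ℕ →₀ ℤ, ∃ (τ : ℕ → CharRing n) (g : CharRing n), IsVertex a (toReal v) →
      (∀ m, lastG a (toReal v) ≤ m → IsSectionChar a m v (τ m)) ∧ SuppLE g (starWeight n v) ∧
      ∀ w, ∃ M, ∀ m, M ≤ m → charCoeff (τ m) w = charCoeff g w := fun v => by
    by_cases hv : IsVertex a (toReal v)
    · obtain ⟨τ, g, h⟩ := exists_limit hn ha hv
      exact ⟨τ, g, fun _ => h⟩
    · exact ⟨0, 0, fun h => absurd h hv⟩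
  choose τ g hτg using hex
  choose p hp using fun u : {u : ℕ →₀ ℝ // IsVertex a u} => u.2.exists_int (by omega)
  have hpv : ∀ u, IsVertex a (toReal (p u)) := fun u => by rw [← hp u]; exact u.2
  have hpinj : Function.Injective p := fun u u' h => Subtype.ext (by rw [hp u, hp u', h])
  refine ⟨S, fun u => g (p u), hS, fun u => ?_, fun w => ?_⟩
  · obtain ⟨h1, -, h3⟩ := hτg (p u) (hpv u)
    refine ⟨τ (p u), fun m hm => ?_, h3⟩
    rw [hp u] at hm ⊢
    obtain ⟨f, hf, hfg, -⟩ := h1 m hm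
    rw [← genSeries_coneSection hn (hpv u)] at hf
    exact ⟨f, hf.isSigmaStar, hfg⟩
  · set E := (finite_height_le hn ha (height n w)).toFinset with hE
    have hmem : ∀ u, charCoeff (g (p u)) w ≠ 0 → p u ∈ E := fun u hu => by
      simp only [hE, Set.Finite.mem_toFinset]
      exact ⟨(hpv u).1, height_le_of_le ((hτg _ (hpv u)).2.1 w hu)⟩
    refine ⟨Set.Finite.of_finite_image (f := p) (E.finite_toSet.subset ?_) hpinj.injOn, ?_⟩
    · rintro _ ⟨u, hu, rfl⟩
      exact hmem u hu
    · rw [(hS w).2, coeff_sum_eq hn ha (fun v hv => (hτg v hv).1) (fun v hv => (hτg v hv).2.1)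
        (fun v hv => (hτg v hv).2.2) w]
      set h : (ℕ →₀ ℤ) → ℂ := fun v => if IsVertex a (toReal v) then charCoeff (g v) w else 0 with hh
      have h1 : ∀ u, charCoeff (g (p u)) w = h (p u) := fun u => by
        simp only [hh, if_pos (hpv u)]
      -- Vertices are identified with integral points through the injection `p`; points of `E`
      -- outside its range are not vertices, so `h` vanishes there.
      rw [finsum_congr h1, ← finsum_mem_range (f := h) hpinj, finsum_mem_def,
        finsum_eq_sum_of_support_subset (s := E)]
      · refine Finset.sum_congr rfl fun v _ => ?_
        rw [Set.indicator_apply]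
        split_ifs with hv
        · rfl
        · rw [hh]
          simp only
          rw [if_neg]
          intro hvert
          refine hv ⟨⟨toReal v, hvert⟩, toReal_injective ?_⟩
          rw [← hp]
      · intro v hv
        rw [Function.mem_support, Set.indicator_apply] at hv
        split_ifs at hv with hr
        · obtain ⟨u, rfl⟩ := hr
          exact hmem u (by rw [h1]; exact hv)
        · exact absurd rfl hv
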